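/- **Lemma (Evaluation of the GEXIT integral).** Conventions. An $L$-distribution is a probability measure $\mathsf a$ on $[-\infty,\infty]$ that is symmetric, i.e. $\mathsf a(-y)=\mathsf a(y)e^{-y}$ (so it has no mass at $-\infty$). Its entropy and Bhattacharyya parameter are $H(\mathsf a)=\int \log_2(1+e^{-y})\,\mathsf a(dy)$ and $\mathfrak B(\mathsf a)=\int e^{-y/2}\,\mathsf a(dy)$ (the integrands are $0$ at $+\infty$). For independent $Y\sim\mathsf a$, $Z\sim\mathsf b$, let $\mathsf a\circledast\mathsf b$ be the law of $Y+Z$ and $\mathsf a\boxplus\mathsf b$ the law of $2\,\mathrm{artanh}(\tanh(Y/2)\tanh(Z/2))$; $\mathsf a^{\circledast n}$ and $\mathsf a^{\boxplus n}$ denote $n$-fold powers. The canonical channel of $\mathsf a$ has output law $\mathsf a$ if $+1$ is sent and the reflection of $\mathsf a$ under $y\mapsto -y$ if $-1$ is sent; $\mathsf a\prec\mathsf b$ means that the canonical channel of $\mathsf b$ is degraded with respect to that of $\mathsf a$, i.e. is obtained by passing the output of the latter through a further channel (Markov kernel). Let $3\le l\le r$ be integers and let $\{\mathsf c_h\}_{h\in[0,1]}$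 be a family of $L$-distributions which is * complete and parametrized by entropy: $H(\mathsf c_h)=h$ for all $h\in[0,1]$; * ordered: $\mathsf c_{h_1}\prec\mathsf c_{h_2}$ whenever $h_1\le h_2$; * piecewise smooth: there is a finite set $S$ such that, for every continuously differentiable $f:\mathbb R\to\mathbb R$ with $e^{y/2}f(y)$ bounded, $\int f\,d\mathsf c_h$ (with $f(+\infty)=0$) exists for all $h \in [0,1]$ and is continuously differentiable in $h$ on $(0,1)\setminus S$. For $h\in[0,1]$ let $\mathsf x_h$ be the forward density evolution fixed point, i.e. the $L$-distribution that is the weak limit of $\mathsf x^{(0)}=\Delta_0$ (the point mass at $0$), $\mathsf x^{(n+1)}=\mathsf c_h\circledast\big((\mathsf x^{(n)})^{\boxplus(r-1)}\big)^{\circledast(l-1)}$, where weak convergence means convergence of the integrals of $f(|\tanh(y/2)|)$ for all continuous $f:[0,1]\to\mathbb R$. Put $a(x)=(1-(1-x)^{r-1})^{l-1}$, $b(x)=(l-1)^2(r-1)^2x(1-x)^{2(r-2)}$, $c(x)=\sqrt{x/a(x)}$, let $\tilde x$ be the unique solution of $a(x)=b(x)$ in $(0,1]$, and let $\tilde h\in[0,1]$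 be the entropy of the member of the family with Bhattacharyya parameter $c(\tilde x)$, i.e. $\mathfrak B(\mathsf c_{\tilde h})=c(\tilde x)$. Let $\tilde h\le h^*\le 1$ and $\mathsf x=\mathsf x_{h^*}$. For $h\in[0,1]$ put $\mathsf y_h=\mathsf x_h^{\boxplus(r-1)}$ and $$ g(h)=\frac{\partial}{\partial h'}H\big(\mathsf c_{h'}\circledast \mathsf y_h^{\circledast l}\big)\Big|_{h'=h}, $$ which is the meaning of $H\big(\tfrac{d\mathsf c_h}{dh}\circledast\mathsf y_h^{\circledast l}\big)$. Then this derivative exists for almost every $h\in(h^*,1]$, $g$ is integrable on $[h^*,1]$, and the BP GEXIT integral is $$\int_{h^*}^1 g(h)\,dh = 1-\frac lr-A,\qquad A=H(\mathsf x)+\Big(l-1-\frac lr\Big)H(\mathsf x^{\boxplus r})-(l-1)H(\mathsf x^{\boxplus(r-1)}).$$ -/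

import Mathlib

open MeasureTheory ProbabilityTheory Filter Topology Set

noncomputable section

namespace GEXIT

/-- Integral `∫ f(y) a(y) dy` of a function `f` of a real log-likelihood ratio against a measure `a`
on `[-∞, ∞]`. The functions used below tend to `0` at `+∞`, so the point `+∞` contributes `0`
(and the point `-∞` carries no mass for an `L`-distribution). -/
def lint (a : Measure EReal) (f : ℝ → ℝ) : ℝ :=
  ∫ y, (if y = ⊤ ∨ y = ⊥ then 0 else f y.toReal) ∂a

/-- `L`-distributions (distributions of log-likelihood ratios of binary-input memoryless
output-symmetric channels, given that `+1` was sent): probability measures on `[-∞, ∞]` which are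
symmetric, `a(-y) = a(y) e^{-y}`. Taking `E = {+∞}` shows that `a` has no mass at `-∞`. -/
structure IsLDist (a : Measure EReal) : Prop where
  prob : IsProbabilityMeasure a
  symm : ∀ E : Set EReal, MeasurableSet E → ⊥ ∉ E →
    a ((fun y : EReal => -y) ⁻¹' E) = ∫⁻ y in E, EReal.exp (-y) ∂a

/-- The entropy functional `H(a) = ∫ a(y) log₂(1 + e^{-y}) dy`. -/
def entropy (a : Measure EReal) : ℝ :=
  lint a (fun y => Real.logb 2 (1 + Real.exp (-y)))

/-- The Bhattacharyya functional `𝔅(a) = ∫ a(y) e^{-y/2} dy`. -/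
def batta (a : Measure EReal) : ℝ :=
  lint a (fun y => Real.exp (-y / 2))

/-- The map `y ↦ tanh(y/2)` from `[-∞, ∞]` onto `[-1, 1]` (from the `L`- to the `D`-domain). -/
def toD (y : EReal) : ℝ :=
  if y = ⊤ then 1 else if y = ⊥ then -1 else Real.tanh (y.toReal / 2)

/-- The inverse map `d ↦ 2 artanh d = ln((1+d)/(1-d))` from `[-1, 1]` onto `[-∞, ∞]`. -/
def ofD (d : ℝ) : EReal :=
  if 1 ≤ d then ⊤ else if d ≤ -1 then ⊥ else ((Real.log ((1 + d) / (1 - d)) : ℝ) : EReal)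

/-- Variable-node convolution `a ⊛ b`: the law of the sum of independent log-likelihood ratios. -/
def varConv (a b : Measure EReal) : Measure EReal := Measure.conv a b

/-- Check-node convolution `a ⊞ b`: the law of `2 artanh(tanh(Y/2) tanh(Z/2))` for independent
`Y ∼ a` and `Z ∼ b`. -/
def checkConv (a b : Measure EReal) : Measure EReal :=
  (a.prod b).map (fun p : EReal × EReal => ofD (toD p.1 * toD p.2))

/-- The power `a^{⊛ n}`; the neutral element is `Δ_0`. -/
def varPow (a : Measure EReal) : ℕ → Measure EReal
  | 0 => Measure.dirac 0
  | n + 1 => varConv (varPow a n) a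

/-- The power `a^{⊞ n}`; the neutral element is `Δ_{+∞}`. -/
def checkPow (a : Measure EReal) : ℕ → Measure EReal
  | 0 => Measure.dirac ⊤
  | n + 1 => checkConv (checkPow a n) a

/-- `a ≺ b`: the channel with `L`-distribution `b` is degraded with respect to the channel with
`L`-distribution `a`. The channel of `a` is represented by its canonical form: the output is
distributed as `a` if `+1` is sent, and as the reflection of `a` if `-1` is sent; `κ` is the
additional channel `p_{Z|Y}`. -/
def Degraded (a b : Measure EReal) : Prop :=
  ∃ κ : Kernel EReal EReal, IsMarkovKernel κ ∧ a.bind κ = b ∧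
    (a.map (fun y : EReal => -y)).bind κ = b.map (fun y : EReal => -y)

/-- A family ordered by degradation, with parameter in `[0, 1]`. -/
def OrderedFamily (c : ℝ → Measure EReal) : Prop :=
  ∀ h₁ ∈ Icc (0 : ℝ) 1, ∀ h₂ ∈ Icc (0 : ℝ) 1, h₁ ≤ h₂ → Degraded (c h₁) (c h₂)

/-- A complete family parametrized by its entropy: every `h ∈ [0, 1]` is attained, by `c_h`. -/
def CompleteEntropyFamily (c : ℝ → Measure EReal) : Prop :=
  ∀ h ∈ Icc (0 : ℝ) 1, entropy (c h) = h

/-- A piecewise smooth family: apart from finitely many parameters (the same ones for all `f`),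
`∫ f(y) c_h(y) dy` is continuously differentiable in `h`, for every continuously differentiable `f`
with `e^{y/2} f(y)` bounded. -/
def PiecewiseSmoothFamily (c : ℝ → Measure EReal) : Prop :=
  ∃ S : Finset ℝ, ∀ f : ℝ → ℝ, ContDiff ℝ 1 f →
    (∃ C : ℝ, ∀ y : ℝ, |Real.exp (y / 2) * f y| ≤ C) →
    (∀ h ∈ Icc (0 : ℝ) 1,
      Integrable (fun y : EReal => if y = ⊤ ∨ y = ⊥ then 0 else f y.toReal) (c h)) ∧
    ContDiffOn ℝ 1 (fun h => lint (c h) f) (Ioo (0 : ℝ) 1 \ S)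

/-- Forward density evolution of the `(l, r)`-regular ensemble over the channel `c`:
`x_0 = Δ_0` and `x_{n+1} = c ⊛ (x_n^{⊞ (r-1)})^{⊛ (l-1)}`. -/
def forwardDE (l r : ℕ) (c : Measure EReal) : ℕ → Measure EReal
  | 0 => Measure.dirac 0
  | n + 1 => varConv c (varPow (checkPow (forwardDE l r c n) (r - 1)) (l - 1))

/-- Weak convergence, expressed in the `|D|`-domain `[0, 1]`. -/
def WeakLimit (a : ℕ → Measure EReal) (b : Measure EReal) : Prop :=
  ∀ f : ℝ → ℝ, ContinuousOn f (Icc 0 1) →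
    Tendsto (fun n => ∫ y, f |toD y| ∂(a n)) atTop (𝓝 (∫ y, f |toD y| ∂b))

/-- `x` is the fixed point of forward density evolution for the channel `c`: the `L`-distribution
to which forward density evolution converges weakly (an `L`-distribution is determined by its
`|D|`-distribution, so there is only one). -/
def IsForwardFP (l r : ℕ) (c x : Measure EReal) : Prop :=
  IsLDist x ∧ WeakLimit (forwardDE l r c) x

/-- `a(x) = (1 - (1-x)^{r-1})^{l-1}`. -/
def aFun (l r : ℕ) (x : ℝ) : ℝ := (1 - (1 - x) ^ (r - 1)) ^ (l - 1)

/-- `b(x) = (l-1)² (r-1)² x (1-x)^{2(r-2)}`. -/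
def bFun (l r : ℕ) (x : ℝ) : ℝ :=
  ((l : ℝ) - 1) ^ 2 * ((r : ℝ) - 1) ^ 2 * x * (1 - x) ^ (2 * (r - 2))

/-- `c(x) = √(x / a(x))`. -/
def cFun (l r : ℕ) (x : ℝ) : ℝ := Real.sqrt (x / aFun l r x)

/-- `ht` is the entropy `h̃` of the family `c`: `c_{h̃}` is the member of the family with
Bhattacharyya parameter `c(x̃)`, where `x̃` is the solution of `a(x) = b(x)` in `(0, 1]`. -/
def IsTildeEntropy (l r : ℕ) (c : ℝ → Measure EReal) (ht : ℝ) : Prop :=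
  ht ∈ Icc (0 : ℝ) 1 ∧
    ∃ xt ∈ Ioc (0 : ℝ) 1, aFun l r xt = bFun l r xt ∧ batta (c ht) = cFun l r xt

/-- The function `h' ↦ H(c_{h'} ⊛ y_h^{⊛ l})` with `y_h = x_h^{⊞ (r-1)}` kept fixed. -/
def gexitEntropy (l r : ℕ) (c x : ℝ → Measure EReal) (h h' : ℝ) : ℝ :=
  entropy (varConv (c h') (varPow (checkPow (x h) (r - 1)) l))

/-- The integrand `H((d c_h / d h) ⊛ y_h^{⊛ l})`, `y_h = x_h^{⊞ (r-1)}`, of the GEXIT integral. -/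
def gexit (l r : ℕ) (c x : ℝ → Measure EReal) (h : ℝ) : ℝ :=
  deriv (gexitEntropy l r c x h) h

/-- `A = H(x) + (l - 1 - l/r) H(x^{⊞ r}) - (l-1) H(x^{⊞ (r-1)})`. -/
def areaA (l r : ℕ) (x : Measure EReal) : ℝ :=
  entropy x + ((l : ℝ) - 1 - (l : ℝ) / r) * entropy (checkPow x r)
    - ((l : ℝ) - 1) * entropy (checkPow x (r - 1))

end GEXIT

end

noncomputable section

namespace GEXIT

/-! ### The map to the `D`-domain -/

/-! With y = x^{⊞(r-1)}, the duality rule H(a ⊛ b) + H(a ⊞ b) = H(a) + H(b) turns A, at a density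
evolution fixed point, into H(c ⊛ y^{⊛l}) - l H(y) + (l - l/r) H(x^{⊞r}) (`IsForwardFP.areaA_eq`).
This functional of (c, x) is stationary in x at a fixed point. Along h ↦ x_h its derivative is
therefore the partial derivative in the channel alone, which is g(h), and the integral equals A(x_1)
- A(x_{h*}). Since c_1 has entropy 1 it is useless, all soft bits of x_1 vanish, and A(x_1) = 1 -
l/r.

No differentiability of h ↦ x_h is available, so stationarity is used through finite differences.
The coordinates are the even moments m_k of the soft bit tanh(y/2): 1 - H = ∑ q_k m_k with q_k > 0,
moments multiply under ⊞, and degradation decreases them because even powers are convex.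
`abs_areaA_sub_le` shows that the increment of A differs from the increment due to the channel by at
most ∑ q_k l Δm_k Δ(m_k^{r-1}). For a monotone function with values in [0,1], increments over a step
δ integrate to at most δ. After division by δ the error is thus governed by the largest Δm_k, which
tends to 0 once each m_k(x_h) is continuous in h (`integral_deriv_diagonal`).

Continuity on [h̃, 1] is where the threshold enters (`exists_batta_sub_le`). Write 𝔅 for the
Bhattacharyya parameter and X = 𝔅(x)². Comparing the equations 𝔅(x) = 𝔅(c) 𝔅(y)^{l-1} of two fixed
points bounds the increment of 𝔅(x) by that of 𝔅(c) plus θ times itself, where θ² is at most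
b(X)/a(X) times 𝔅(y')^{2(l-2)}, y' belonging to the worse channel. For h ≥ h̃ one has X ≥ x̃, hence
b(X) ≤ a(X), and one of the two factors stays away from 1 on each half of the interval. So 𝔅(x_h) is
Lipschitz in 𝔅(c_h), and positivity of the series coefficients passes this on to every single
moment. -/

lemma toD_coe (y : ℝ) : toD (y : EReal) = (1 - Real.exp (-y)) / (1 + Real.exp (-y)) := by
  have h : toD (y : EReal) = Real.tanh (y / 2) := by simp [toD]
  rw [h, Real.tanh_eq]
  have e : Real.exp (-y) = Real.exp (-(y / 2)) / Real.exp (y / 2) := by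
    rw [← Real.exp_sub]; ring_nf
  rw [e]
  have := Real.exp_pos (y / 2)
  have := Real.exp_pos (-(y / 2))
  field_simp

@[simp] lemma toD_top : toD ⊤ = 1 := by simp [toD]

@[simp] lemma toD_bot : toD ⊥ = -1 := by simp [toD]

@[simp] lemma toD_zero : toD 0 = 0 := by
  have := toD_coe 0
  simpa using this

lemma measurable_toD : Measurable toD := by
  apply EReal.measurable_of_measurable_real
  simp only [toD_coe]
  fun_prop

lemma toD_coe_lt_one (y : ℝ) : toD (y : EReal) < 1 := by
  rw [toD_coe, div_lt_one (by positivity)]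
  linarith [Real.exp_pos (-y)]

lemma neg_one_lt_toD_coe (y : ℝ) : -1 < toD (y : EReal) := by
  rw [toD_coe, lt_div_iff₀ (by positivity)]
  linarith [Real.exp_pos (-y)]

lemma toD_mem (y : EReal) : toD y ∈ Icc (-1 : ℝ) 1 := by
  induction y with
  | bot => simp
  | top => simp
  | coe y => exact ⟨(neg_one_lt_toD_coe y).le, (toD_coe_lt_one y).le⟩

lemma toD_neg (y : EReal) : toD (-y) = -toD y := by
  induction y with
  | bot => simp
  | top => simp
  | coe y =>
    rw [← EReal.coe_neg, toD_coe, toD_coe, neg_neg, Real.exp_neg]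
    have := Real.exp_pos y
    field_simp
    ring

lemma one_add_toD_coe (y : ℝ) : 1 + toD (y : EReal) = 2 / (1 + Real.exp (-y)) := by
  rw [toD_coe]
  have := Real.exp_pos (-y)
  field_simp
  ring

lemma one_sub_toD_coe (y : ℝ) :
    1 - toD (y : EReal) = 2 * Real.exp (-y) / (1 + Real.exp (-y)) := by
  rw [toD_coe]
  have := Real.exp_pos (-y)
  field_simp
  ring

lemma one_add_mul_pos {d e : ℝ} (hd : d ∈ Ioo (-1 : ℝ) 1) (he : e ∈ Icc (-1 : ℝ) 1) :
    0 < 1 + d * e := by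
  have h1 : |d * e| < 1 := by
    rw [abs_mul]
    calc |d| * |e| ≤ |d| * 1 := mul_le_mul_of_nonneg_left (abs_le.2 he) (abs_nonneg d)
      _ < 1 := by rw [mul_one]; exact abs_lt.2 hd
  linarith [(abs_lt.1 h1).1]

/-- The addition formula for tanh. The value `⊥` has to be excluded: `⊤ + ⊥ = ⊥` has soft bit -1,
whereas the quotient is 0/0 = 0. -/
lemma toD_add {y z : EReal} (hy : y ≠ ⊥) (hz : z ≠ ⊥) :
    toD (y + z) = (toD y + toD z) / (1 + toD y * toD z) := by
  induction y with
  | bot => exact absurd rfl hy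
  | top =>
    rw [EReal.top_add_of_ne_bot hz, toD_top, one_mul, div_self]
    induction z with
    | bot => exact absurd rfl hz
    | top => norm_num
    | coe z => linarith [neg_one_lt_toD_coe z]
  | coe y =>
    induction z with
    | bot => exact absurd rfl hz
    | top =>
      rw [EReal.add_top_of_ne_bot hy, toD_top, mul_one, add_comm, div_self]
      linarith [neg_one_lt_toD_coe y]
    | coe z =>
      rw [eq_div_iff (one_add_mul_pos ⟨neg_one_lt_toD_coe y, toD_coe_lt_one y⟩ (toD_mem z)).ne',
        ← EReal.coe_add, toD_coe, toD_coe, toD_coe, neg_add, Real.exp_add]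
      have h1 := Real.exp_pos (-y)
      have h2 := Real.exp_pos (-z)
      field_simp
      ring

lemma one_add_toD_mul_pos {y z : EReal} (hy : y ≠ ⊥) (hz : z ≠ ⊥) :
    0 < 1 + toD y * toD z := by
  induction y with
  | bot => exact absurd rfl hy
  | coe y => exact one_add_mul_pos ⟨neg_one_lt_toD_coe y, toD_coe_lt_one y⟩ (toD_mem z)
  | top =>
    induction z with
    | bot => exact absurd rfl hz
    | top => norm_num
    | coe z =>
      rw [toD_top, one_mul]
      linarith [neg_one_lt_toD_coe z]

lemma toD_ofD {d : ℝ} (hd : d ∈ Icc (-1 : ℝ) 1) : toD (ofD d) = d := by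
  unfold ofD
  split_ifs with h1 h2
  · simp [le_antisymm hd.2 h1]
  · simp [le_antisymm h2 hd.1]
  · push Not at h1 h2
    rw [toD_coe, ← Real.log_inv, Real.exp_log (by
      apply inv_pos.2; apply div_pos <;> linarith)]
    have : 1 - d ≠ 0 := by linarith
    have : 1 + d ≠ 0 := by linarith
    field_simp
    ring

lemma ofD_neg (d : ℝ) : ofD (-d) = -ofD d := by
  unfold ofD
  by_cases h1 : 1 ≤ d
  · have h2 : ¬ (1 ≤ -d) := by linarith
    simp [h1, h2]
  · by_cases h2 : d ≤ -1
    · have h3 : 1 ≤ -d := by linarith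
      simp [h1, h2, h3]
    · have h3 : ¬ 1 ≤ -d := by linarith
      have h4 : ¬ -d ≤ -1 := by linarith
      rw [if_neg h3, if_neg h4, if_neg h1, if_neg h2, ← EReal.coe_neg, ← Real.log_inv, inv_div]
      ring_nf

lemma measurable_ofD : Measurable ofD := by
  unfold ofD
  refine Measurable.ite measurableSet_Ici measurable_const
    (Measurable.ite measurableSet_Iic measurable_const ?_)
  fun_prop

lemma toD_mul_mem (y z : EReal) : toD y * toD z ∈ Icc (-1 : ℝ) 1 := by
  have h1 := abs_le.2 (toD_mem y)
  have h2 := abs_le.2 (toD_mem z)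
  refine abs_le.1 ?_
  rw [abs_mul]
  exact mul_le_one₀ h1 (abs_nonneg _) h2

/-! ### Symmetry in terms of the `D`-domain -/

lemma IsLDist.measure_bot {a : Measure EReal} (ha : IsLDist a) : a {⊥} = 0 := by
  have h := ha.symm {⊤} (measurableSet_singleton _) (by simp)
  have e : (fun y : EReal => -y) ⁻¹' {⊤} = {⊥} := by
    ext y; simp
  rw [e] at h
  simpa using h

lemma IsLDist.ae_ne_bot {a : Measure EReal} (ha : IsLDist a) : ∀ᵐ y ∂a, y ≠ ⊥ := by
  rw [ae_iff]
  simpa using ha.measure_bot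

/-- The symmetry axiom says nothing about sets containing `⊥`, hence the condition at `⊥`; off that
point it is an equality between the reflected measure and one with density e^{-y}. -/
lemma IsLDist.lintegral_comp_neg {a : Measure EReal} (ha : IsLDist a) {F : EReal → ENNReal}
    (hF : Measurable F) (hF0 : F ⊥ = 0) :
    ∫⁻ y, F (-y) ∂a = ∫⁻ y, EReal.exp (-y) * F y ∂a := by
  have hexp : Measurable fun y : EReal => EReal.exp (-y) := by fun_prop
  have e : (a.map (fun y : EReal => -y)).restrict {⊥}ᶜ =
      (a.withDensity fun y => EReal.exp (-y)).restrict {⊥}ᶜ := by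
    ext E hE
    have hE' : MeasurableSet (E ∩ {⊥}ᶜ) := hE.inter (measurableSet_singleton _).compl
    rw [Measure.restrict_apply hE, Measure.restrict_apply hE, Measure.map_apply measurable_neg hE',
      withDensity_apply _ hE', ha.symm _ hE' (by simp)]
  have key : ∀ μ : Measure EReal, ∫⁻ y, F y ∂μ = ∫⁻ y, F y ∂(μ.restrict {⊥}ᶜ) := by
    intro μ
    rw [← lintegral_indicator (measurableSet_singleton _).compl]
    congr 1
    ext y
    by_cases hy : y = ⊥
    · simp [hy, hF0]
    · simp [hy]
  calc ∫⁻ y, F (-y) ∂a = ∫⁻ y, F y ∂(a.map (fun y : EReal => -y)) :=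
        (lintegral_map hF measurable_neg).symm
    _ = ∫⁻ y, F y ∂(a.withDensity fun y => EReal.exp (-y)) := by rw [key, e, ← key]
    _ = _ := lintegral_withDensity_eq_lintegral_mul _ hexp hF

/-- In the soft bit d, the likelihood ratio e^{-y} is (1-d)/(1+d). Weighting by 1-d therefore
absorbs the density in the symmetry axiom. -/
lemma one_add_mul_exp {y : EReal} (hy : y ≠ ⊥) :
    EReal.exp (-y) * ENNReal.ofReal (1 + toD y) = ENNReal.ofReal (1 - toD y) := by
  induction y with
  | bot => exact absurd rfl hy
  | top => simp
  | coe y =>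
    rw [← EReal.coe_neg, EReal.exp_coe, ← ENNReal.ofReal_mul (Real.exp_pos _).le,
      one_add_toD_coe, one_sub_toD_coe]
    congr 1
    ring

/-- The measure `(1 - toD y) a(dy)` is invariant under reflection. -/
lemma IsLDist.lintegral_one_sub_comp_neg {a : Measure EReal} (ha : IsLDist a)
    {F : EReal → ENNReal} (hF : Measurable F) :
    ∫⁻ y, ENNReal.ofReal (1 - toD y) * F (-y) ∂a
      = ∫⁻ y, ENNReal.ofReal (1 - toD y) * F y ∂a := by
  have hm : Measurable fun y => ENNReal.ofReal (1 + toD y) * F y :=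
    (ENNReal.measurable_ofReal.comp (measurable_toD.const_add 1)).mul hF
  have h := ha.lintegral_comp_neg hm (by simp)
  simp only [toD_neg, ← sub_eq_add_neg] at h
  rw [h]
  refine lintegral_congr_ae ?_
  filter_upwards [ha.ae_ne_bot] with y hy
  rw [← mul_assoc, one_add_mul_exp hy]

/-- Converse of `IsLDist.lintegral_one_sub_comp_neg`, recovered by testing with 1_E/(1+d), whose
denominator is nonzero on E because `⊥ ∉ E`. In this form symmetry involves no exceptional point and
is linear in the weight, which suits convolutions. -/
lemma isLDist_of_lintegral {a : Measure EReal} [IsProbabilityMeasure a]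
    (h : ∀ F : EReal → ENNReal, Measurable F →
      ∫⁻ y, ENNReal.ofReal (1 - toD y) * F (-y) ∂a
        = ∫⁻ y, ENNReal.ofReal (1 - toD y) * F y ∂a) : IsLDist a := by
  refine ⟨inferInstance, fun E hE hbot => ?_⟩
  have hw : Measurable fun y => ENNReal.ofReal (1 + toD y) :=
    ENNReal.measurable_ofReal.comp (measurable_toD.const_add 1)
  have h1 := h (fun y => (ENNReal.ofReal (1 + toD y))⁻¹ * E.indicator 1 y)
    (hw.inv.mul (measurable_one.indicator hE))
  have hpos : ∀ y : EReal, y ≠ ⊥ → 0 < 1 + toD y := by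
    intro y hy
    induction y with
    | bot => exact absurd rfl hy
    | top => norm_num
    | coe y => linarith [neg_one_lt_toD_coe y]
  rw [← lintegral_indicator_one (hE.preimage measurable_neg), ← lintegral_indicator hE]
  calc ∫⁻ y, ((fun y : EReal => -y) ⁻¹' E).indicator 1 y ∂a
      = ∫⁻ y, ENNReal.ofReal (1 - toD y) *
          ((ENNReal.ofReal (1 + toD (-y)))⁻¹ * E.indicator 1 (-y)) ∂a := by
        congr 1
        ext y
        by_cases hy : -y ∈ E
        · have : -y ≠ ⊥ := fun h => hbot (h ▸ hy)
          have h2 := hpos _ this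
          simp only [indicator, mem_preimage, hy, if_true, Pi.one_apply, mul_one]
          rw [toD_neg] at h2 ⊢
          rw [← sub_eq_add_neg, ENNReal.mul_inv_cancel]
          · simpa using h2
          · simp
        · simp [indicator, hy]
    _ = _ := h1
    _ = _ := by
        congr 1
        ext y
        by_cases hy : y ∈ E
        · have h0 : y ≠ ⊥ := fun h => hbot (h ▸ hy)
          have h2 := hpos _ h0
          simp only [indicator, hy, if_true, Pi.one_apply, mul_one]
          rw [← one_add_mul_exp h0, mul_assoc, ENNReal.mul_inv_cancel, mul_one]
          · simpa using h2
          · simp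
        · simp [indicator, hy]

/-! ### Closure of `L`-distributions under the convolutions -/

lemma isLDist_dirac_zero : IsLDist (Measure.dirac 0) := by
  apply isLDist_of_lintegral
  intro F hF
  simp

lemma isLDist_dirac_top : IsLDist (Measure.dirac ⊤) := by
  apply isLDist_of_lintegral
  intro F hF
  simp

lemma measurable_check :
    Measurable fun p : EReal × EReal => ofD (toD p.1 * toD p.2) :=
  measurable_ofD.comp ((measurable_toD.comp measurable_fst).mul (measurable_toD.comp measurable_snd))

lemma lintegral_checkConv {a b : Measure EReal} [SFinite b] {F : EReal → ENNReal}
    (hF : Measurable F) :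
    ∫⁻ t, F t ∂(checkConv a b) = ∫⁻ y, ∫⁻ z, F (ofD (toD y * toD z)) ∂b ∂a := by
  rw [checkConv, lintegral_map hF measurable_check, lintegral_prod _ (by
    exact (hF.comp measurable_check).aemeasurable)]

lemma lintegral_varConv {a b : Measure EReal} [SFinite b] {F : EReal → ENNReal}
    (hF : Measurable F) :
    ∫⁻ t, F t ∂(varConv a b) = ∫⁻ y, ∫⁻ z, F (y + z) ∂b ∂a :=
  Measure.lintegral_conv hF

lemma isProbabilityMeasure_checkConv {a b : Measure EReal} [IsProbabilityMeasure a]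
    [IsProbabilityMeasure b] : IsProbabilityMeasure (checkConv a b) :=
  Measure.isProbabilityMeasure_map measurable_check.aemeasurable

lemma isProbabilityMeasure_varConv {a b : Measure EReal} [IsProbabilityMeasure a]
    [IsProbabilityMeasure b] : IsProbabilityMeasure (varConv a b) :=
  Measure.probabilitymeasure_of_probabilitymeasures_conv a b

/-- The weight splits as 1 - de = ((1+e)(1-d) + (1+d)(1-e))/2. In each summand only the variable
carrying the invariant weight is reflected, the other one being frozen, and the product de changes
sign. -/
lemma IsLDist.checkConv {a b : Measure EReal} (ha : IsLDist a) (hb : IsLDist b) :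
    IsLDist (checkConv a b) := by
  have := ha.prob
  have := hb.prob
  have := isProbabilityMeasure_checkConv (a := a) (b := b)
  apply isLDist_of_lintegral
  intro F hF
  have hw : Measurable fun y => ENNReal.ofReal (1 - toD y) :=
    ENNReal.measurable_ofReal.comp (measurable_toD.const_sub 1)
  have hw' : Measurable fun y => ENNReal.ofReal (1 + toD y) :=
    ENNReal.measurable_ofReal.comp (measurable_toD.const_add 1)
  have split : ∀ G : EReal → ENNReal, Measurable G →
      ∫⁻ t, ENNReal.ofReal (1 - toD t) * G t ∂(GEXIT.checkConv a b)
      = ∫⁻ z, ENNReal.ofReal ((1 + toD z) / 2) *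
          ∫⁻ y, ENNReal.ofReal (1 - toD y) * G (ofD (toD y * toD z)) ∂a ∂b
        + ∫⁻ y, ENNReal.ofReal ((1 + toD y) / 2) *
          ∫⁻ z, ENNReal.ofReal (1 - toD z) * G (ofD (toD y * toD z)) ∂b ∂a := by
    intro G hG
    have hGm : Measurable fun p : EReal × EReal => G (ofD (toD p.1 * toD p.2)) :=
      hG.comp measurable_check
    rw [lintegral_checkConv (F := fun t => ENNReal.ofReal (1 - toD t) * G t) (hw.mul hG)]
    have e1 : ∀ z, ENNReal.ofReal ((1 + toD z) / 2) *
          ∫⁻ y, ENNReal.ofReal (1 - toD y) * G (ofD (toD y * toD z)) ∂a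
        = ∫⁻ y, ENNReal.ofReal ((1 + toD z) / 2) *
          (ENNReal.ofReal (1 - toD y) * G (ofD (toD y * toD z))) ∂a := fun z =>
      (lintegral_const_mul _ (hw.mul (hGm.comp measurable_prodMk_right))).symm
    have e2 : ∀ y, ENNReal.ofReal ((1 + toD y) / 2) *
          ∫⁻ z, ENNReal.ofReal (1 - toD z) * G (ofD (toD y * toD z)) ∂b
        = ∫⁻ z, ENNReal.ofReal ((1 + toD y) / 2) *
          (ENNReal.ofReal (1 - toD z) * G (ofD (toD y * toD z))) ∂b := fun y =>
      (lintegral_const_mul _ (hw.mul (hGm.comp measurable_prodMk_left))).symm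
    have hk : Measurable fun y => ENNReal.ofReal ((1 + toD y) / 2) :=
      ENNReal.measurable_ofReal.comp ((measurable_toD.const_add 1).div_const 2)
    have m1 : Measurable fun p : EReal × EReal => ENNReal.ofReal ((1 + toD p.2) / 2) *
          (ENNReal.ofReal (1 - toD p.1) * G (ofD (toD p.1 * toD p.2))) :=
      (hk.comp measurable_snd).mul ((hw.comp measurable_fst).mul hGm)
    have m2 : Measurable fun p : EReal × EReal => ENNReal.ofReal ((1 + toD p.1) / 2) *
          (ENNReal.ofReal (1 - toD p.2) * G (ofD (toD p.1 * toD p.2))) :=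
      (hk.comp measurable_fst).mul ((hw.comp measurable_snd).mul hGm)
    simp_rw [e1, e2]
    have sw := lintegral_lintegral_swap (μ := b) (ν := a) (f := fun z y =>
      ENNReal.ofReal ((1 + toD z) / 2) * (ENNReal.ofReal (1 - toD y) * G (ofD (toD y * toD z))))
      (m1.comp measurable_swap).aemeasurable
    have m1' := m1.lintegral_prod_right' (ν := b)
    rw [sw, ← lintegral_add_left (by exact m1')]
    congr 1
    ext y
    rw [← lintegral_add_left (by exact m1.comp measurable_prodMk_left)]
    congr 1
    ext z
    rw [← mul_assoc, ← mul_assoc, ← add_mul]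
    congr 1
    have hy := toD_mem y
    have hz := toD_mem z
    rw [toD_ofD (toD_mul_mem y z), ← ENNReal.ofReal_mul (by linarith [hz.1]),
      ← ENNReal.ofReal_mul (by linarith [hy.1]), ← ENNReal.ofReal_add
        (mul_nonneg (by linarith [hz.1]) (by linarith [hy.2]))
        (mul_nonneg (by linarith [hy.1]) (by linarith [hz.2]))]
    congr 1
    ring
  rw [split (fun t => F (-t)) (hF.comp measurable_neg), split F hF]
  have h1 : ∀ z, ∫⁻ y, ENNReal.ofReal (1 - toD y) * F (-(ofD (toD y * toD z))) ∂a
      = ∫⁻ y, ENNReal.ofReal (1 - toD y) * F (ofD (toD y * toD z)) ∂a := by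
    intro z
    rw [← ha.lintegral_one_sub_comp_neg (F := fun y => F (ofD (toD y * toD z)))
      (hF.comp (measurable_check.comp measurable_prodMk_right))]
    simp_rw [toD_neg, neg_mul, ofD_neg]
  have h2 : ∀ y, ∫⁻ z, ENNReal.ofReal (1 - toD z) * F (-(ofD (toD y * toD z))) ∂b
      = ∫⁻ z, ENNReal.ofReal (1 - toD z) * F (ofD (toD y * toD z)) ∂b := by
    intro y
    rw [← hb.lintegral_one_sub_comp_neg (F := fun z => F (ofD (toD y * toD z)))
      (hF.comp (measurable_check.comp measurable_prodMk_left))]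
    simp_rw [toD_neg, mul_neg, ofD_neg]
  simp_rw [h1, h2]

/-- Here 1 - (d+e)/(1+de) = (1-d)(1-e)/(1+de): both invariant weights appear, and the denominator
does not change when both variables are reflected together. -/
lemma IsLDist.varConv {a b : Measure EReal} (ha : IsLDist a) (hb : IsLDist b) :
    IsLDist (varConv a b) := by
  have := ha.prob
  have := hb.prob
  have := isProbabilityMeasure_varConv (a := a) (b := b)
  apply isLDist_of_lintegral
  intro F hF
  have hw : Measurable fun y => ENNReal.ofReal (1 - toD y) :=
    ENNReal.measurable_ofReal.comp (measurable_toD.const_sub 1)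
  have hadd : Measurable fun p : EReal × EReal => p.1 + p.2 := measurable_add
  have hG : Measurable fun p : EReal × EReal =>
      ENNReal.ofReal ((1 + toD p.1 * toD p.2)⁻¹) * F (p.1 + p.2) :=
    (ENNReal.measurable_ofReal.comp (((measurable_toD.comp measurable_fst).mul
      (measurable_toD.comp measurable_snd)).const_add 1).inv).mul (hF.comp hadd)
  have hGy : ∀ y : EReal, Measurable fun z : EReal =>
      ENNReal.ofReal ((1 + toD y * toD z)⁻¹) * F (y + z) := fun y =>
    hG.comp (measurable_prodMk_left (x := y))
  have weight : ∀ {y z : EReal}, y ≠ ⊥ → z ≠ ⊥ → ENNReal.ofReal (1 - toD (y + z)) =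
      ENNReal.ofReal (1 - toD y) * (ENNReal.ofReal (1 - toD z) *
        ENNReal.ofReal ((1 + toD y * toD z)⁻¹)) := by
    intro y z hy hz
    have h0 := one_add_toD_mul_pos hy hz
    rw [← ENNReal.ofReal_mul (by linarith [(toD_mem z).2]),
      ← ENNReal.ofReal_mul (by linarith [(toD_mem y).2]), toD_add hy hz]
    congr 1
    field_simp
    ring
  have hmeas : Measurable fun y : EReal => ∫⁻ z, ENNReal.ofReal (1 - toD z) *
      (ENNReal.ofReal ((1 + toD y * toD z)⁻¹) * F (y + z)) ∂b :=
    Measurable.lintegral_prod_right' (f := fun p : EReal × EReal => ENNReal.ofReal (1 - toD p.2) *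
      (ENNReal.ofReal ((1 + toD p.1 * toD p.2)⁻¹) * F (p.1 + p.2)))
      ((hw.comp measurable_snd).mul hG)
  have key : ∀ {K : EReal → EReal → ENNReal}, (∀ y z, y ≠ ⊥ → z ≠ ⊥ → K y z =
      ENNReal.ofReal (1 - toD y) * (ENNReal.ofReal (1 - toD z) *
        (ENNReal.ofReal ((1 + toD (-y) * toD (-z))⁻¹) * F (-y + -z)))) →
      ∫⁻ y, ∫⁻ z, K y z ∂b ∂a = ∫⁻ y, ENNReal.ofReal (1 - toD y) * ∫⁻ z, ENNReal.ofReal (1 - toD z) *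
        (ENNReal.ofReal ((1 + toD y * toD z)⁻¹) * F (y + z)) ∂b ∂a := by
    intro K hK
    calc ∫⁻ y, ∫⁻ z, K y z ∂b ∂a
        = ∫⁻ y, ENNReal.ofReal (1 - toD y) * ∫⁻ z, ENNReal.ofReal (1 - toD z) *
        (ENNReal.ofReal ((1 + toD (-y) * toD (-z))⁻¹) * F (-y + -z)) ∂b ∂a := by
          refine lintegral_congr_ae ?_
          filter_upwards [ha.ae_ne_bot] with y hy
          rw [← lintegral_const_mul]
          · refine lintegral_congr_ae ?_
            filter_upwards [hb.ae_ne_bot] with z hz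
            exact hK y z hy hz
          · exact hw.mul ((hGy (-y)).comp measurable_neg)
      _ = ∫⁻ y, ENNReal.ofReal (1 - toD y) * ∫⁻ z, ENNReal.ofReal (1 - toD z) *
        (ENNReal.ofReal ((1 + toD (-y) * toD z)⁻¹) * F (-y + z)) ∂b ∂a := by
          congr 1
          ext y
          have := hb.lintegral_one_sub_comp_neg
            (F := fun z => ENNReal.ofReal ((1 + toD (-y) * toD z)⁻¹) * F (-y + z))
            (hGy (-y))
          rw [this]
      _ = _ := by
          exact ha.lintegral_one_sub_comp_neg hmeas
  have key' : ∀ {K : EReal → EReal → ENNReal}, (∀ y z, y ≠ ⊥ → z ≠ ⊥ → K y z =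
      ENNReal.ofReal (1 - toD y) * (ENNReal.ofReal (1 - toD z) *
        (ENNReal.ofReal ((1 + toD y * toD z)⁻¹) * F (y + z)))) →
      ∫⁻ y, ∫⁻ z, K y z ∂b ∂a = ∫⁻ y, ENNReal.ofReal (1 - toD y) * ∫⁻ z, ENNReal.ofReal (1 - toD z) *
        (ENNReal.ofReal ((1 + toD y * toD z)⁻¹) * F (y + z)) ∂b ∂a := by
    intro K hK
    refine lintegral_congr_ae ?_
    filter_upwards [ha.ae_ne_bot] with y hy
    rw [← lintegral_const_mul]
    · refine lintegral_congr_ae ?_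
      filter_upwards [hb.ae_ne_bot] with z hz
      exact hK y z hy hz
    · exact hw.mul (hGy y)
  rw [lintegral_varConv (F := fun t => ENNReal.ofReal (1 - toD t) * F (-t))
      (hw.mul (hF.comp measurable_neg)),
    lintegral_varConv (F := fun t => ENNReal.ofReal (1 - toD t) * F t) (hw.mul hF)]
  refine (key fun y z hy hz => ?_).trans (key' fun y z hy hz => ?_).symm
  · have e : -(y + z) = -y + -z := by
      rw [EReal.neg_add (Or.inl hy) (Or.inr hz), sub_eq_add_neg]
    rw [weight hy hz, mul_assoc, mul_assoc, e, toD_neg, toD_neg, neg_mul_neg]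
  · rw [weight hy hz, mul_assoc, mul_assoc]

lemma IsLDist.varPow {a : Measure EReal} (ha : IsLDist a) (n : ℕ) : IsLDist (varPow a n) := by
  induction n with
  | zero => exact isLDist_dirac_zero
  | succ n ih => exact ih.varConv ha

lemma IsLDist.checkPow {a : Measure EReal} (ha : IsLDist a) (n : ℕ) : IsLDist (checkPow a n) := by
  induction n with
  | zero => exact isLDist_dirac_top
  | succ n ih => exact ih.checkConv ha

lemma IsLDist.forwardDE {c : Measure EReal} (hc : IsLDist c) (l r n : ℕ) :
    IsLDist (forwardDE l r c n) := by
  induction n with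
  | zero => exact isLDist_dirac_zero
  | succ n ih => exact hc.varConv ((ih.checkPow _).varPow _)

/-! ### Bochner integrals against `L`-distributions -/

lemma measurable_comp_of_continuousOn {α β : Type*} [MeasurableSpace α] [TopologicalSpace β]
    [MeasurableSpace β] [BorelSpace β] {f : β → ℝ} {s : Set β} (hf : ContinuousOn f s)
    {g : α → β} (hg : Measurable g) (hgs : ∀ x, g x ∈ s) : Measurable fun x => f (g x) :=
  hf.domRestrict.measurable.comp (hg.subtype_mk (h := hgs))

/-- Stated as an equality of measures, the invariance passes to Bochner integrals and to
integrability without further measurability assumptions. -/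
lemma IsLDist.tilt_map_neg {a : Measure EReal} (ha : IsLDist a) :
    (a.withDensity fun y => ENNReal.ofReal (1 - toD y)).map (MeasurableEquiv.neg EReal)
      = a.withDensity fun y => ENNReal.ofReal (1 - toD y) := by
  have hw : Measurable fun y => ENNReal.ofReal (1 - toD y) :=
    ENNReal.measurable_ofReal.comp (measurable_toD.const_sub 1)
  ext E hE
  have h := ha.lintegral_one_sub_comp_neg (F := E.indicator 1) (measurable_one.indicator hE)
  have hE' : MeasurableSet ((MeasurableEquiv.neg EReal) ⁻¹' E) :=
    (MeasurableEquiv.neg EReal).measurable hE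
  rw [Measure.map_apply (MeasurableEquiv.neg EReal).measurable hE, withDensity_apply _ hE,
    withDensity_apply _ hE', ← lintegral_indicator hE, ← lintegral_indicator hE']
  have e1 : ∀ y, E.indicator (fun y => ENNReal.ofReal (1 - toD y)) y
      = ENNReal.ofReal (1 - toD y) * E.indicator 1 y := by
    intro y; by_cases hy : y ∈ E <;> simp [hy]
  have e2 : ∀ y, ((MeasurableEquiv.neg EReal) ⁻¹' E).indicator
      (fun y => ENNReal.ofReal (1 - toD y)) y
      = ENNReal.ofReal (1 - toD y) * E.indicator 1 (-y) := by
    intro y; by_cases hy : -y ∈ E <;> simp [indicator, hy]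
  simp_rw [e1, e2]
  exact h

lemma integral_tilt (a : Measure EReal) (f : EReal → ℝ) :
    ∫ y, f y ∂(a.withDensity fun y => ENNReal.ofReal (1 - toD y)) = ∫ y, (1 - toD y) * f y ∂a := by
  rw [integral_withDensity_eq_integral_toReal_smul]
  · congr 1
    ext y
    rw [ENNReal.toReal_ofReal (by linarith [(toD_mem y).2]), smul_eq_mul]
  · exact ENNReal.measurable_ofReal.comp (measurable_toD.const_sub 1)
  · simp

lemma integrable_tilt_iff {a : Measure EReal} {f : EReal → ℝ} :
    Integrable f (a.withDensity fun y => ENNReal.ofReal (1 - toD y))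
      ↔ Integrable (fun y => (1 - toD y) * f y) a := by
  rw [integrable_withDensity_iff_integrable_smul']
  · have : (fun y => (ENNReal.ofReal (1 - toD y)).toReal • f y) = fun y => (1 - toD y) * f y := by
      ext y
      rw [ENNReal.toReal_ofReal (by linarith [(toD_mem y).2]), smul_eq_mul]
    rw [this]
  · exact ENNReal.measurable_ofReal.comp (measurable_toD.const_sub 1)
  · simp

lemma IsLDist.integral_one_sub_comp_neg {a : Measure EReal} (ha : IsLDist a) (f : EReal → ℝ) :
    ∫ y, (1 - toD y) * f (-y) ∂a = ∫ y, (1 - toD y) * f y ∂a := by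
  rw [← integral_tilt, ← integral_tilt]
  conv_rhs => rw [← ha.tilt_map_neg]
  rw [integral_map_equiv]
  rfl

lemma IsLDist.integrable_one_sub_comp_neg {a : Measure EReal} (ha : IsLDist a) {f : EReal → ℝ}
    (hf : Integrable (fun y => (1 - toD y) * f (-y)) a) :
    Integrable (fun y => (1 - toD y) * f y) a := by
  rw [← integrable_tilt_iff] at hf ⊢
  rw [← ha.tilt_map_neg, integrable_map_equiv]
  exact hf

lemma integrable_of_abs_le {α : Type*} [MeasurableSpace α] {μ : Measure α} [IsFiniteMeasure μ]
    {f : α → ℝ} (hf : Measurable f) {C : ℝ} (hC : ∀ x, |f x| ≤ C) : Integrable f μ :=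
  Integrable.of_bound hf.aestronglyMeasurable C (Eventually.of_forall hC)

/-- Averages f over ±y with the posterior weights (1±d)/2. Only (1+d)f has to be bounded, so f may
blow up at -∞, as the entropy and Bhattacharyya integrands do. -/
lemma IsLDist.integral_symmetrize {a : Measure EReal} (ha : IsLDist a) {f : EReal → ℝ}
    (hf : Measurable f) {C : ℝ} (hC : ∀ y, |(1 + toD y) * f y| ≤ C) :
    Integrable f a ∧
      ∫ y, f y ∂a = ∫ y, ((1 + toD y) * f y + (1 - toD y) * f (-y)) / 2 ∂a := by
  have := ha.prob
  have i1 : Integrable (fun y => (1 + toD y) * f y) a :=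
    integrable_of_abs_le ((measurable_toD.const_add 1).mul hf) hC
  have i2 : Integrable (fun y => (1 - toD y) * f (-y)) a := by
    refine integrable_of_abs_le (C := C) ((measurable_toD.const_sub 1).mul
      (hf.comp measurable_neg)) fun y => ?_
    have := hC (-y)
    rwa [toD_neg, ← sub_eq_add_neg] at this
  have i3 := ha.integrable_one_sub_comp_neg i2
  have e : ∀ y, f y = ((1 + toD y) * f y + (1 - toD y) * f y) / 2 := fun y => by ring
  constructor
  · exact ((i1.add i3).div_const 2).congr (Eventually.of_forall fun y => (e y).symm)
  · rw [integral_congr_ae (Eventually.of_forall e), integral_div, integral_div,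
      integral_add i1 i3, integral_add i1 i2, ha.integral_one_sub_comp_neg]

/-- The integral of a function of `toD y`. -/
def evalD (a : Measure EReal) (f : ℝ → ℝ) : ℝ := ∫ y, f (toD y) ∂a

/-- The binary entropy as a function of the soft bit. -/
def etaD (d : ℝ) : ℝ :=
  1 - ((1 + d) * Real.log (1 + d) + (1 - d) * Real.log (1 - d)) / (2 * Real.log 2)

/-- Continuous even functions on `[-1, 1]`. -/
structure EvenCont (f : ℝ → ℝ) : Prop where
  cont : ContinuousOn f (Icc (-1) 1)
  even : ∀ d, f (-d) = f d

lemma EvenCont.measurable_comp {f : ℝ → ℝ} (hf : EvenCont f) {α : Type*} [MeasurableSpace α]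
    {g : α → ℝ} (hg : Measurable g) (hgs : ∀ x, g x ∈ Icc (-1 : ℝ) 1) :
    Measurable fun x => f (g x) :=
  measurable_comp_of_continuousOn hf.cont hg hgs

lemma EvenCont.exists_bound {f : ℝ → ℝ} (hf : EvenCont f) :
    ∃ C, 0 ≤ C ∧ ∀ d ∈ Icc (-1 : ℝ) 1, |f d| ≤ C := by
  obtain ⟨C, hC⟩ := isCompact_Icc.exists_bound_of_continuousOn hf.cont
  exact ⟨C, (norm_nonneg _).trans (hC 0 (by norm_num)), hC⟩

lemma EvenCont.integrable {f : ℝ → ℝ} (hf : EvenCont f) (a : Measure EReal) [IsFiniteMeasure a] :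
    Integrable (fun y => f (toD y)) a := by
  obtain ⟨C, -, hC⟩ := hf.exists_bound
  exact integrable_of_abs_le (hf.measurable_comp measurable_toD toD_mem) fun y => hC _ (toD_mem y)

lemma EvenCont.abs_eq {f : ℝ → ℝ} (hf : EvenCont f) (d : ℝ) : f |d| = f d := by
  rcases abs_choice d with h | h <;> rw [h]
  exact hf.even d

lemma evenCont_etaD : EvenCont etaD where
  cont := by
    have : Continuous fun x : ℝ => x * Real.log x := Real.continuous_mul_log
    have h1 : Continuous fun d : ℝ => (1 + d) * Real.log (1 + d) :=
      this.comp (continuous_const.add continuous_id)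
    have h2 : Continuous fun d : ℝ => (1 - d) * Real.log (1 - d) :=
      this.comp (continuous_const.sub continuous_id)
    unfold etaD
    exact (continuous_const.sub ((h1.add h2).div_const _)).continuousOn
  even d := by
    unfold etaD
    rw [sub_neg_eq_add, ← sub_eq_add_neg, add_comm ((1 - d) * _)]

lemma evenCont_sqrt : EvenCont fun d => Real.sqrt (1 - d ^ 2) where
  cont := by fun_prop
  even d := by simp

lemma evenCont_pow (k : ℕ) : EvenCont fun d => d ^ (2 * k) where
  cont := by fun_prop
  even d := by rw [Even.neg_pow (even_two_mul k)]

/-! ### The functionals in the `D`-domain -/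

lemma measurable_lint_integrand {f : ℝ → ℝ} (hf : Measurable f) :
    Measurable fun y : EReal => if y = ⊤ ∨ y = ⊥ then 0 else f y.toReal :=
  Measurable.ite ((measurableSet_singleton _).union (measurableSet_singleton _)) measurable_const
    (hf.comp measurable_ereal_toReal)

lemma etaD_one : etaD 1 = 0 := by
  have := Real.log_pos (show (1 : ℝ) < 2 by norm_num)
  unfold etaD
  norm_num

lemma measurable_logb_exp : Measurable fun y : ℝ => Real.logb 2 (1 + Real.exp (-y)) := by
  unfold Real.logb
  fun_prop

lemma logb_exp_bound (y : EReal) : |(1 + toD y) *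
    (if y = ⊤ ∨ y = ⊥ then 0 else Real.logb 2 (1 + Real.exp (-y.toReal)))| ≤ 2 / Real.log 2 := by
  have hl := Real.log_pos (show (1 : ℝ) < 2 by norm_num)
  induction y with
  | bot => simp; positivity
  | top => simp; positivity
  | coe y =>
    simp only [EReal.coe_ne_top, EReal.coe_ne_bot, or_self, if_false, EReal.toReal_coe]
    have hu := Real.exp_pos (-y)
    have h0 : 0 ≤ Real.log (1 + Real.exp (-y)) := Real.log_nonneg (by linarith)
    have h1 : Real.log (1 + Real.exp (-y)) ≤ 1 + Real.exp (-y) := by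
      have := Real.log_le_sub_one_of_pos (show 0 < 1 + Real.exp (-y) by linarith)
      linarith
    rw [one_add_toD_coe, Real.logb, abs_of_nonneg (by positivity)]
    rw [div_mul_div_comm, div_le_div_iff₀ (by positivity) hl]
    have := mul_le_mul_of_nonneg_right h1 (by positivity : 0 ≤ 2 * Real.log 2)
    nlinarith

/-- As 1 + e^{-y} = 2/(1+d), the symmetrized integrand is the binary entropy of (1+d)/2. -/
lemma IsLDist.entropy_eq {a : Measure EReal} (ha : IsLDist a) : entropy a = evalD a etaD := by
  have hl := Real.log_pos (show (1 : ℝ) < 2 by norm_num)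
  unfold entropy lint evalD
  rw [(ha.integral_symmetrize (measurable_lint_integrand measurable_logb_exp) logb_exp_bound).2]
  congr 1
  ext y
  induction y with
  | bot => simp [evenCont_etaD.even, etaD_one]
  | top => simp [etaD_one]
  | coe y =>
    rw [← EReal.coe_neg]
    simp only [EReal.coe_ne_top, EReal.coe_ne_bot, or_self, if_false, EReal.toReal_coe]
    have h1 : 1 + Real.exp (-y) = 2 / (1 + toD y) := by
      rw [one_add_toD_coe, div_div_eq_mul_div, mul_div_cancel_left₀ _ two_ne_zero]
    have h2 : 1 + Real.exp (- -y) = 2 / (1 - toD y) := by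
      rw [sub_eq_add_neg, ← toD_neg, ← EReal.coe_neg, one_add_toD_coe, div_div_eq_mul_div,
        mul_div_cancel_left₀ _ two_ne_zero]
    have p1 : 0 < 1 + toD y := by linarith [neg_one_lt_toD_coe y]
    have p2 : 0 < 1 - toD y := by linarith [toD_coe_lt_one y]
    rw [h1, h2, Real.logb, Real.logb, Real.log_div two_ne_zero p1.ne',
      Real.log_div two_ne_zero p2.ne', etaD]
    field_simp
    ring

/-- Both halves of the symmetrized integrand equal e^{-y/2}/(1+e^{-y}), and their sum is √(1-d²). -/
lemma IsLDist.batta_eq {a : Measure EReal} (ha : IsLDist a) :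
    batta a = evalD a fun d => Real.sqrt (1 - d ^ 2) := by
  unfold batta lint evalD
  have hsq : ∀ y : ℝ, Real.exp (-y / 2) ^ 2 = Real.exp (-y) := fun y => by
    rw [← Real.exp_nat_mul]; congr 1; push_cast; ring
  rw [(ha.integral_symmetrize (C := 2) (measurable_lint_integrand
    (show Measurable fun y : ℝ => Real.exp (-y / 2) by fun_prop)) ?_).2]
  · congr 1
    ext y
    induction y with
    | bot => simp
    | top => simp
    | coe y =>
      rw [← EReal.coe_neg]
      simp only [EReal.coe_ne_top, EReal.coe_ne_bot, or_self, if_false, EReal.toReal_coe]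
      have e : (1 - toD (y : EReal) ^ 2) = (2 * Real.exp (-y / 2) / (1 + Real.exp (-y))) ^ 2 := by
        have : 1 - toD (y : EReal) ^ 2 = (1 + toD y) * (1 - toD y) := by ring
        rw [this, one_add_toD_coe, one_sub_toD_coe, ← hsq]
        ring
      have h2 : Real.exp (- -y / 2) = (Real.exp (-y / 2))⁻¹ := by
        rw [← Real.exp_neg]; ring_nf
      have hp := Real.exp_pos (-y / 2)
      rw [e, Real.sqrt_sq (by positivity), one_add_toD_coe, one_sub_toD_coe, h2, ← hsq]
      field_simp
      ring
  · intro y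
    induction y with
    | bot => simp
    | top => simp
    | coe y =>
      simp only [EReal.coe_ne_top, EReal.coe_ne_bot, or_self, if_false, EReal.toReal_coe]
      have hp := Real.exp_pos (-y / 2)
      rw [one_add_toD_coe, abs_of_nonneg (by positivity), ← hsq, div_mul_eq_mul_div,
        div_le_iff₀ (by positivity)]
      nlinarith [sq_nonneg (Real.exp (-y / 2) - 1)]

/-! ### Evaluation on convolutions -/

/-- The kernel of the variable-node convolution in the `D`-domain, for even functions. -/
def varK (f : ℝ → ℝ) (d e : ℝ) : ℝ :=
  ((1 + d * e) * f ((d + e) / (1 + d * e)) + (1 - d * e) * f ((d - e) / (1 - d * e))) / 2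

lemma evalD_checkConv {a b : Measure EReal} [IsProbabilityMeasure a] [IsProbabilityMeasure b]
    {f : ℝ → ℝ} (hf : EvenCont f) :
    evalD (checkConv a b) f = ∫ y, ∫ z, f (toD y * toD z) ∂b ∂a := by
  have hm : Measurable fun y => f (toD y) := hf.measurable_comp measurable_toD toD_mem
  obtain ⟨C, -, hC⟩ := hf.exists_bound
  have hm2 : Measurable fun p : EReal × EReal => f (toD (ofD (toD p.1 * toD p.2))) :=
    hm.comp measurable_check
  rw [evalD, checkConv, integral_map measurable_check.aemeasurable hm.aestronglyMeasurable,
    integral_prod _ (integrable_of_abs_le hm2 fun p => hC _ (toD_mem _))]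
  simp_rw [toD_ofD (toD_mul_mem _ _)]

/-- Symmetrizing in both variables produces four sign patterns. Evenness of f identifies them in
pairs, with total weights (1±de)/2 at the soft bits of y+z and y-z. -/
lemma evalD_varConv {a b : Measure EReal} (ha : IsLDist a) (hb : IsLDist b)
    {f : ℝ → ℝ} (hf : EvenCont f) :
    evalD (varConv a b) f = ∫ y, ∫ z, varK f (toD y) (toD z) ∂b ∂a := by
  have := ha.prob
  have := hb.prob
  have hm : Measurable fun y => f (toD y) := hf.measurable_comp measurable_toD toD_mem
  obtain ⟨C, hC0, hC⟩ := hf.exists_bound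
  have hadd : Measurable fun p : EReal × EReal => p.1 + p.2 := measurable_add
  have hsub : Measurable fun p : EReal × EReal => p.1 + -p.2 :=
    hadd.comp (measurable_fst.prodMk measurable_snd.neg)
  have hS : Measurable fun p : EReal × EReal => f (toD (p.1 + p.2)) := hm.comp hadd
  have hS' : Measurable fun p : EReal × EReal => f (toD (p.1 + -p.2)) := hm.comp hsub
  have hD1 : Measurable fun p : EReal × EReal => toD p.1 := measurable_toD.comp measurable_fst
  have hD2 : Measurable fun p : EReal × EReal => toD p.2 := measurable_toD.comp measurable_snd
  have h1 : evalD (varConv a b) f = ∫ y, ∫ z, f (toD (y + z)) ∂b ∂a := by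
    rw [evalD, varConv, Measure.conv, integral_map hadd.aemeasurable hm.aestronglyMeasurable,
      integral_prod _ (integrable_of_abs_le hS fun p => hC _ (toD_mem _))]
  have bound : ∀ d ∈ Icc (-1 : ℝ) 1, ∀ v, |v| ≤ C → |(1 + d) * v| ≤ 2 * C := by
    intro d hd v hv
    rw [abs_mul, abs_of_nonneg (by linarith [hd.1])]
    exact mul_le_mul (by linarith [hd.2]) hv (abs_nonneg _) (by norm_num)
  have bound2 : ∀ d ∈ Icc (-1 : ℝ) 1, ∀ v w, |v| ≤ C → |w| ≤ C →
      |((1 + d) * v + (1 - d) * w) / 2| ≤ C := by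
    intro d hd v w hv hw
    rw [abs_le] at *
    constructor <;> nlinarith [hd.1, hd.2]
  set F : EReal → ℝ := fun y =>
    ∫ z, ((1 + toD z) * f (toD (y + z)) + (1 - toD z) * f (toD (y + -z))) / 2 ∂b with hF
  have hFint : Measurable fun p : EReal × EReal =>
      ((1 + toD p.2) * f (toD (p.1 + p.2)) + (1 - toD p.2) * f (toD (p.1 + -p.2))) / 2 :=
    (((hD2.const_add 1).mul hS).add ((hD2.const_sub 1).mul hS')).div_const 2
  have hFm : Measurable F := (hFint.stronglyMeasurable.integral_prod_right).measurable
  have hFi : ∀ y, Integrable (fun z =>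
      ((1 + toD z) * f (toD (y + z)) + (1 - toD z) * f (toD (y + -z))) / 2) b := fun y =>
    integrable_of_abs_le (C := C) (hFint.comp (measurable_prodMk_left (x := y))) fun z =>
      bound2 _ (toD_mem z) _ _ (hC _ (toD_mem _)) (hC _ (toD_mem _))
  have hFC : ∀ y, |F y| ≤ C := by
    intro y
    have := norm_integral_le_of_norm_le_const (μ := b) (C := C) (f := fun z =>
      ((1 + toD z) * f (toD (y + z)) + (1 - toD z) * f (toD (y + -z))) / 2)
      (Eventually.of_forall fun z => bound2 _ (toD_mem z) _ _ (hC _ (toD_mem (y + z))) (hC _ (toD_mem (y + -z))))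
    simpa using this
  have h2 : ∀ y, ∫ z, f (toD (y + z)) ∂b = F y := fun y =>
    (hb.integral_symmetrize (C := 2 * C) (hS.comp (measurable_prodMk_left (x := y))) fun z =>
      bound _ (toD_mem z) _ (hC _ (toD_mem _))).2
  simp_rw [h1, h2]
  rw [(ha.integral_symmetrize (C := 2 * C) hFm fun y => bound _ (toD_mem y) _ (hFC y)).2]
  refine integral_congr_ae ?_
  filter_upwards [ha.ae_ne_bot] with y hy
  have h3 : (1 + toD y) * F y + (1 - toD y) * F (-y) = ∫ z, ((1 + toD y) *
      (((1 + toD z) * f (toD (y + z)) + (1 - toD z) * f (toD (y + -z))) / 2) + (1 - toD y) *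
      (((1 + toD z) * f (toD (-y + z)) + (1 - toD z) * f (toD (-y + -z))) / 2)) ∂b := by
    rw [integral_add ((hFi y).const_mul _) ((hFi (-y)).const_mul _), integral_const_mul,
      integral_const_mul]
  rw [h3, ← integral_div]
  refine integral_congr_ae ?_
  filter_upwards [hb.ae_ne_bot] with z hz
  have e1 : f (toD (-y + -z)) = f (toD (y + z)) := by
    rw [← sub_eq_add_neg, ← EReal.neg_add (Or.inl hy) (Or.inr hz), toD_neg, hf.even]
  have e2 : f (toD (-y + z)) = f (toD (y + -z)) := by
    -- Negation does not distribute over `⊤ + ⊥`; in that case both sides are f(-1).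
    by_cases hyz : y = ⊤ ∧ z = ⊤
    · simp [hyz.1, hyz.2]
    · have : -(y + -z) = -y + z := by
        rw [EReal.neg_add (Or.inl hy), sub_eq_add_neg, neg_neg]
        by_cases h : y = ⊤
        · right; simpa using fun h' => hyz ⟨h, h'⟩
        · left; exact h
      rw [← this, toD_neg, hf.even]
  -- For z = `⊤` the soft bit of y - z is -1, which agrees with the quotient unless y is `⊤` too,
  -- and then the weight vanishes.
  have e3 : (1 - toD y * toD z) * f (toD (y + -z))
      = (1 - toD y * toD z) * f ((toD y - toD z) / (1 - toD y * toD z)) := by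
    by_cases h : z = ⊤
    · subst h
      rw [EReal.neg_top, EReal.add_bot, toD_bot, toD_top, mul_one]
      by_cases h' : 1 - toD y = 0
      · rw [h', zero_mul, zero_mul]
      · rw [← neg_sub 1 (toD y), neg_div, div_self h']
    · have : -z ≠ ⊥ := by simpa using h
      rw [toD_add hy this, toD_neg, mul_neg, ← sub_eq_add_neg, ← sub_eq_add_neg]
  rw [e1, e2, varK, ← e3, ← toD_add hy hz]
  ring

/-! ### The convex order -/

/-- Even, continuous, convex functions on `[-1, 1]`. -/
structure EvenConvex (f : ℝ → ℝ) : Prop extends EvenCont f where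
  convex : ConvexOn ℝ (Icc (-1) 1) f

/-- `a` is more informative than `b` in the convex order of the soft bits. -/
def Better (a b : Measure EReal) : Prop := ∀ f, EvenConvex f → evalD b f ≤ evalD a f

lemma Better.trans {a b c : Measure EReal} (h : Better a b) (h' : Better b c) : Better a c :=
  fun f hf => (h' f hf).trans (h f hf)

lemma Better.refl (a : Measure EReal) : Better a a := fun _ _ => le_rfl

lemma evenConvex_pow (k : ℕ) : EvenConvex fun d => d ^ (2 * k) where
  toEvenCont := evenCont_pow k
  convex := (Even.convexOn_pow (even_two_mul k)).subset (subset_univ _) (convex_Icc _ _)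

lemma EvenConvex.comp_mul {f : ℝ → ℝ} (hf : EvenConvex f) {e : ℝ} (he : e ∈ Icc (-1 : ℝ) 1) :
    EvenConvex fun d => f (d * e) := by
  have hmem : ∀ d ∈ Icc (-1 : ℝ) 1, d * e ∈ Icc (-1 : ℝ) 1 := fun d hd => by
    refine abs_le.1 ?_
    rw [abs_mul]
    exact mul_le_one₀ (abs_le.2 hd) (abs_nonneg _) (abs_le.2 he)
  refine ⟨⟨hf.cont.comp (by fun_prop) hmem, fun d => by rw [neg_mul, hf.even]⟩, convex_Icc _ _, ?_⟩
  intro x hx y hy s t hs ht hst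
  have := hf.convex.2 (hmem x hx) (hmem y hy) hs ht hst
  simp only [smul_eq_mul] at this ⊢
  convert this using 2
  ring

lemma div_one_add_mem {d e : ℝ} (hd : d ∈ Icc (-1 : ℝ) 1) (he : e ∈ Icc (-1 : ℝ) 1) :
    (d + e) / (1 + d * e) ∈ Icc (-1 : ℝ) 1 := by
  obtain ⟨h1, h2⟩ := hd
  obtain ⟨h3, h4⟩ := he
  have h0 : 0 ≤ 1 + d * e := by
    rcases le_total 0 d with h | h <;> rcases le_total 0 e with h' | h' <;> nlinarith
  rcases h0.eq_or_lt with h | h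
  · rw [← h, div_zero]; norm_num
  · constructor
    · rw [le_div_iff₀ h]; nlinarith
    · rw [div_le_one h]; nlinarith

/-- At the corners where 1+de = 0 the argument of f has no limit, but f is bounded and the prefactor
tends to 0. -/
lemma continuousOn_varK_half {f : ℝ → ℝ} (hf : EvenCont f) :
    ContinuousOn (fun p : ℝ × ℝ => (1 + p.1 * p.2) * f ((p.1 + p.2) / (1 + p.1 * p.2)))
      (Icc (-1) 1 ×ˢ Icc (-1) 1) := by
  obtain ⟨C, hC0, hC⟩ := hf.exists_bound
  rintro ⟨d, e⟩ ⟨hd, he⟩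
  by_cases h0 : 1 + d * e = 0
  · have hb : ∀ p ∈ (Icc (-1 : ℝ) 1 ×ˢ Icc (-1 : ℝ) 1),
        ‖(1 + p.1 * p.2) * f ((p.1 + p.2) / (1 + p.1 * p.2))‖ ≤ |1 + p.1 * p.2| * C := by
      rintro ⟨d, e⟩ ⟨hd, he⟩
      rw [norm_mul]
      exact mul_le_mul_of_nonneg_left (hC _ (div_one_add_mem hd he)) (norm_nonneg _)
    have ht : Tendsto (fun p : ℝ × ℝ => |1 + p.1 * p.2| * C)
        (𝓝[Icc (-1) 1 ×ˢ Icc (-1) 1] (d, e)) (𝓝 0) := by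
      have : Continuous fun p : ℝ × ℝ => |1 + p.1 * p.2| * C := by fun_prop
      have h := this.tendsto (d, e)
      simp only [h0, abs_zero, zero_mul] at h
      exact h.mono_left nhdsWithin_le_nhds
    have := squeeze_zero_norm' (eventually_nhdsWithin_of_forall hb) ht
    simpa [ContinuousWithinAt, h0] using this
  · have hc : ContinuousWithinAt (fun p : ℝ × ℝ => (p.1 + p.2) / (1 + p.1 * p.2))
        (Icc (-1) 1 ×ˢ Icc (-1) 1) (d, e) := by
      apply ContinuousAt.continuousWithinAt
      exact ContinuousAt.div (by fun_prop) (by fun_prop) h0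
    have hk : ContinuousWithinAt (fun p : ℝ × ℝ => f ((p.1 + p.2) / (1 + p.1 * p.2)))
        (Icc (-1) 1 ×ˢ Icc (-1) 1) (d, e) :=
      ContinuousWithinAt.comp (g := f) (t := Icc (-1) 1)
        (f := fun p : ℝ × ℝ => (p.1 + p.2) / (1 + p.1 * p.2))
        (hf.cont _ (div_one_add_mem hd he)) hc fun p hp => div_one_add_mem hp.1 hp.2
    refine ContinuousWithinAt.mul ?_ hk
    exact Continuous.continuousWithinAt (by fun_prop)

lemma varK_eq (f : ℝ → ℝ) (d e : ℝ) : varK f d e =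
    ((1 + d * e) * f ((d + e) / (1 + d * e)) +
      (1 + d * (-e)) * f ((d + -e) / (1 + d * (-e)))) / 2 := by
  simp only [varK, mul_neg, ← sub_eq_add_neg]

lemma EvenCont.continuousOn_varK {f : ℝ → ℝ} (hf : EvenCont f) :
    ContinuousOn (fun p : ℝ × ℝ => varK f p.1 p.2) (Icc (-1) 1 ×ˢ Icc (-1) 1) := by
  simp only [varK_eq]
  have h := continuousOn_varK_half hf
  have h' : ContinuousOn (fun p : ℝ × ℝ => (p.1, -p.2)) (Icc (-1) 1 ×ˢ Icc (-1) 1) :=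
    Continuous.continuousOn (by fun_prop)
  have h2 := h.comp h' (fun p hp => ⟨hp.1, by
    have := hp.2; exact ⟨by linarith [this.2], by linarith [this.1]⟩⟩)
  exact (h.add h2).div_const 2

lemma varK_comm {f : ℝ → ℝ} (hf : EvenCont f) (d e : ℝ) : varK f d e = varK f e d := by
  unfold varK
  rw [add_comm d e, mul_comm d e, ← hf.even ((d - e) / _), ← neg_div, neg_sub]

lemma varK_neg {f : ℝ → ℝ} (hf : EvenCont f) (d e : ℝ) : varK f (-d) e = varK f d e := by
  unfold varK
  rw [← hf.even ((-d + e) / _), ← hf.even ((-d - e) / _), ← neg_div, ← neg_div]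
  ring_nf

/-- This is the perspective (t, u) ↦ t f(u/t) of a convex function along the affine map d ↦ (1+de,
d+e), so convexity is inherited. -/
lemma convexOn_perspective {f : ℝ → ℝ} (hf : ConvexOn ℝ (Icc (-1) 1) f) {e : ℝ}
    (he : e ∈ Icc (-1 : ℝ) 1) :
    ConvexOn ℝ (Icc (-1) 1) fun d => (1 + d * e) * f ((d + e) / (1 + d * e)) := by
  refine ⟨convex_Icc _ _, ?_⟩
  intro x hx y hy s t hs ht hst
  simp only [smul_eq_mul]
  have h0 : ∀ {d : ℝ}, d ∈ Icc (-1 : ℝ) 1 → 0 ≤ 1 + d * e := by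
    rintro d ⟨h1, h2⟩
    obtain ⟨h3, h4⟩ := he
    rcases le_total 0 d with h | h <;> rcases le_total 0 e with h' | h' <;> nlinarith
  -- On the square, 1+de = 0 forces d+e = 0, so the value 0 given to division by 0 does no harm in
  -- the identities below.
  have hnum : ∀ {d : ℝ}, d ∈ Icc (-1 : ℝ) 1 → 1 + d * e = 0 → d + e = 0 := by
    rintro d ⟨h1, h2⟩ h
    obtain ⟨h3, h4⟩ := he
    nlinarith
  set X := 1 + x * e with hX
  set Y := 1 + y * e with hY
  have hX0 := h0 hx
  have hY0 := h0 hy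
  have eZ : 1 + (s * x + t * y) * e = s * X + t * Y := by
    rw [hX, hY]; linear_combination (-1) * hst
  rw [eZ]
  rcases (add_nonneg (mul_nonneg hs hX0) (mul_nonneg ht hY0)).eq_or_lt with hz | hz
  · have z1 : s * X = 0 := by nlinarith [mul_nonneg hs hX0, mul_nonneg ht hY0]
    have z2 : t * Y = 0 := by nlinarith [mul_nonneg hs hX0, mul_nonneg ht hY0]
    rw [← hz, zero_mul, ← mul_assoc, ← mul_assoc, z1, z2]
    simp
  · have hne : s * X + t * Y ≠ 0 := hz.ne'
    have h := hf.2 (div_one_add_mem hx he) (div_one_add_mem hy he)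
      (div_nonneg (mul_nonneg hs hX0) hz.le) (div_nonneg (mul_nonneg ht hY0) hz.le)
      (by rw [← add_div, div_self hne])
    simp only [smul_eq_mul] at h
    rw [← hX, ← hY] at h
    have e1 : X * ((x + e) / X) = x + e := by
      by_cases h' : X = 0
      · rw [h', zero_mul, hnum hx h']
      · field_simp
    have e2 : Y * ((y + e) / Y) = y + e := by
      by_cases h' : Y = 0
      · rw [h', zero_mul, hnum hy h']
      · field_simp
    have e3 : s * X / (s * X + t * Y) * ((x + e) / X) + t * Y / (s * X + t * Y) * ((y + e) / Y)
        = (s * x + t * y + e) / (s * X + t * Y) := by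
      rw [div_mul_eq_mul_div, div_mul_eq_mul_div, ← add_div, mul_assoc, mul_assoc, e1, e2]
      congr 1
      linear_combination e * hst
    rw [e3] at h
    calc _ ≤ (s * X + t * Y) * (s * X / (s * X + t * Y) * f ((x + e) / X) +
          t * Y / (s * X + t * Y) * f ((y + e) / Y)) := mul_le_mul_of_nonneg_left h hz.le
      _ = _ := by field_simp

lemma EvenConvex.varK {f : ℝ → ℝ} (hf : EvenConvex f) {e : ℝ} (he : e ∈ Icc (-1 : ℝ) 1) :
    EvenConvex fun d => varK f d e := by
  have he' : -e ∈ Icc (-1 : ℝ) 1 := ⟨by linarith [he.2], by linarith [he.1]⟩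
  refine ⟨⟨?_, fun d => varK_neg hf.toEvenCont d e⟩, ?_⟩
  · exact hf.continuousOn_varK.comp (f := fun d => (d, e)) (by fun_prop) fun d hd => ⟨hd, he⟩
  · have := ((convexOn_perspective hf.convex he).add (convexOn_perspective hf.convex he')).smul
      (show (0 : ℝ) ≤ 1 / 2 by norm_num)
    refine this.congr fun d _ => ?_
    simp only [varK_eq, Pi.add_apply, smul_eq_mul]
    ring

lemma measurable_kernel {κ : ℝ × ℝ → ℝ} (hκ : ContinuousOn κ (Icc (-1) 1 ×ˢ Icc (-1) 1)) :
    Measurable fun p : EReal × EReal => κ (toD p.1, toD p.2) :=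
  measurable_comp_of_continuousOn hκ ((measurable_toD.comp measurable_fst).prodMk
    (measurable_toD.comp measurable_snd)) fun _ => ⟨toD_mem _, toD_mem _⟩

lemma integrable_kernel {κ : ℝ × ℝ → ℝ} (hκ : ContinuousOn κ (Icc (-1) 1 ×ˢ Icc (-1) 1))
    (μ : Measure (EReal × EReal)) [IsFiniteMeasure μ] :
    Integrable (fun p : EReal × EReal => κ (toD p.1, toD p.2)) μ := by
  obtain ⟨C, hC⟩ := (isCompact_Icc.prod isCompact_Icc).exists_bound_of_continuousOn hκ
  exact integrable_of_abs_le (measurable_kernel hκ) fun p => hC _ ⟨toD_mem _, toD_mem _⟩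

/-- Fubini freezes the second soft bit. Monotonicity of both convolutions then reduces to the
kernels being even and convex in the first one. -/
lemma integral_kernel_mono {κ : ℝ × ℝ → ℝ} (hκ : ContinuousOn κ (Icc (-1) 1 ×ˢ Icc (-1) 1))
    {a a' b : Measure EReal} [IsProbabilityMeasure a] [IsProbabilityMeasure a']
    [IsProbabilityMeasure b]
    (h : ∀ e ∈ Icc (-1 : ℝ) 1, ∫ y, κ (toD y, e) ∂a' ≤ ∫ y, κ (toD y, e) ∂a) :
    ∫ y, ∫ z, κ (toD y, toD z) ∂b ∂a' ≤ ∫ y, ∫ z, κ (toD y, toD z) ∂b ∂a := by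
  have sw : ∀ μ : Measure EReal, IsProbabilityMeasure μ → ∫ y, ∫ z, κ (toD y, toD z) ∂b ∂μ
      = ∫ z, ∫ y, κ (toD y, toD z) ∂μ ∂b := fun μ _ =>
    integral_integral_swap (f := fun y z => κ (toD y, toD z)) (integrable_kernel hκ (μ.prod b))
  rw [sw a inferInstance, sw a' inferInstance]
  exact integral_mono (integrable_kernel hκ (a'.prod b)).integral_prod_right
    (integrable_kernel hκ (a.prod b)).integral_prod_right fun z => h _ (toD_mem z)

lemma continuousOn_checkK {f : ℝ → ℝ} (hf : EvenCont f) :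
    ContinuousOn (fun p : ℝ × ℝ => f (p.1 * p.2)) (Icc (-1) 1 ×ˢ Icc (-1) 1) := by
  refine hf.cont.comp (by fun_prop) ?_
  rintro ⟨d, e⟩ ⟨hd, he⟩
  refine abs_le.1 ?_
  rw [abs_mul]
  exact mul_le_one₀ (abs_le.2 hd) (abs_nonneg _) (abs_le.2 he)

lemma evalD_checkConv_comm {a b : Measure EReal} [IsProbabilityMeasure a] [IsProbabilityMeasure b]
    {f : ℝ → ℝ} (hf : EvenCont f) : evalD (checkConv a b) f = evalD (checkConv b a) f := by
  rw [evalD_checkConv hf, evalD_checkConv hf,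
    integral_integral_swap (integrable_kernel (continuousOn_checkK hf) _)]
  simp_rw [mul_comm]

lemma Better.checkConv_left {a a' b : Measure EReal} [IsProbabilityMeasure a]
    [IsProbabilityMeasure a'] [IsProbabilityMeasure b] (h : Better a a') :
    Better (checkConv a b) (checkConv a' b) := by
  intro f hf
  rw [evalD_checkConv hf.toEvenCont, evalD_checkConv hf.toEvenCont]
  exact integral_kernel_mono (continuousOn_checkK hf.toEvenCont) fun e he => h _ (hf.comp_mul he)

lemma Better.checkConv {a a' b b' : Measure EReal} [IsProbabilityMeasure a]
    [IsProbabilityMeasure a'] [IsProbabilityMeasure b] [IsProbabilityMeasure b']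
    (h : Better a a') (h' : Better b b') :
    Better (checkConv a b) (checkConv a' b') := by
  intro f hf
  refine le_trans ?_ (h.checkConv_left (b := b) f hf)
  rw [evalD_checkConv_comm hf.toEvenCont, evalD_checkConv_comm (a := a') hf.toEvenCont]
  exact h'.checkConv_left f hf

lemma varConv_comm (a b : Measure EReal) [SFinite a] [SFinite b] : varConv a b = varConv b a :=
  Measure.conv_comm a b

lemma varConv_assoc (a b c : Measure EReal) [SFinite a] [SFinite b] [SFinite c] :
    varConv (varConv a b) c = varConv a (varConv b c) :=
  Measure.conv_assoc a b c

lemma Better.varConv_left {a a' b : Measure EReal} (ha : IsLDist a) (ha' : IsLDist a')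
    (hb : IsLDist b) (h : Better a a') : Better (varConv a b) (varConv a' b) := by
  intro f hf
  have := ha.prob
  have := ha'.prob
  have := hb.prob
  rw [evalD_varConv ha hb hf.toEvenCont, evalD_varConv ha' hb hf.toEvenCont]
  exact integral_kernel_mono hf.toEvenCont.continuousOn_varK fun e he => h _ (hf.varK he)

lemma Better.varConv {a a' b b' : Measure EReal} (ha : IsLDist a) (ha' : IsLDist a')
    (hb : IsLDist b) (hb' : IsLDist b') (h : Better a a') (h' : Better b b') :
    Better (varConv a b) (varConv a' b') := by
  have := ha.prob
  have := ha'.prob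
  have := hb.prob
  have := hb'.prob
  refine (h.varConv_left ha ha' hb).trans ?_
  rw [varConv_comm a' b, varConv_comm a' b']
  exact h'.varConv_left hb hb' ha'

lemma Better.checkPow {a a' : Measure EReal} (ha : IsLDist a) (ha' : IsLDist a')
    (h : Better a a') (n : ℕ) : Better (checkPow a n) (checkPow a' n) := by
  induction n with
  | zero => exact Better.refl _
  | succ n ih =>
    have := ha.prob
    have := ha'.prob
    have := (ha.checkPow n).prob
    have := (ha'.checkPow n).prob
    exact ih.checkConv h

lemma Better.varPow {a a' : Measure EReal} (ha : IsLDist a) (ha' : IsLDist a')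
    (h : Better a a') (n : ℕ) : Better (varPow a n) (varPow a' n) := by
  induction n with
  | zero => exact Better.refl _
  | succ n ih => exact ih.varConv (ha.varPow n) (ha'.varPow n) ha ha' h

lemma Better.forwardDE {c c' : Measure EReal} (hc : IsLDist c) (hc' : IsLDist c')
    (h : Better c c') (l r n : ℕ) : Better (forwardDE l r c n) (forwardDE l r c' n) := by
  induction n with
  | zero => exact Better.refl _
  | succ n ih =>
    have h1 := hc.forwardDE l r n
    have h2 := hc'.forwardDE l r n
    exact h.varConv hc hc' ((h1.checkPow _).varPow _) ((h2.checkPow _).varPow _)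
      ((ih.checkPow h1 h2 _).varPow (h1.checkPow _) (h2.checkPow _) _)

/-! ### Degradation implies the convex order -/

lemma integrable_toD_mul {μ : Measure EReal} [IsFiniteMeasure μ] {g : EReal → ℝ}
    (hg : Measurable g) {C : ℝ} (hC : ∀ y, |g y| ≤ C) : Integrable (fun y => toD y * g y) μ := by
  refine integrable_of_abs_le (C := C) (measurable_toD.mul hg) fun y => ?_
  rw [abs_mul]
  calc |toD y| * |g y| ≤ 1 * |g y| :=
        mul_le_mul_of_nonneg_right (abs_le.2 (toD_mem y)) (abs_nonneg _)
    _ ≤ C := by rw [one_mul]; exact hC y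

/-- For equally likely inputs ±1, the soft bit is the conditional mean of the input given the
output: it is the density of a minus its reflection with respect to their sum. -/
lemma IsLDist.integral_toD_mul_symm {a : Measure EReal} (ha : IsLDist a) {g : EReal → ℝ}
    (hg : Measurable g) {C : ℝ} (hC : ∀ y, |g y| ≤ C) :
    ∫ y, toD y * g y ∂(a + a.map (fun y : EReal => -y))
      = ∫ y, g y ∂a - ∫ y, g y ∂(a.map (fun y : EReal => -y)) := by
  have := ha.prob
  have hneg : AEMeasurable (fun y : EReal => -y) a := measurable_neg.aemeasurable
  have hm : Measurable fun y : EReal => toD y * g y := measurable_toD.mul hg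
  have hgn : Measurable fun y : EReal => g (-y) := hg.comp measurable_neg
  have i1 := integrable_of_abs_le (μ := a) hg hC
  have i2 := integrable_of_abs_le (μ := a) hgn fun y => hC (-y)
  have i3 := integrable_toD_mul (μ := a) hg hC
  have i4 := integrable_toD_mul (μ := a) hgn fun y => hC (-y)
  have := Measure.isProbabilityMeasure_map hneg
  rw [integral_add_measure i3 (integrable_toD_mul hg hC),
    integral_map hneg hm.aestronglyMeasurable, integral_map hneg hg.aestronglyMeasurable]
  have h := ha.integral_one_sub_comp_neg g
  simp only [sub_mul, one_mul] at h
  rw [integral_sub i2 i4, integral_sub i1 i3] at h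
  simp only [toD_neg, neg_mul, integral_neg]
  linarith

lemma IsLDist.integral_symm_even {a : Measure EReal} (ha : IsLDist a) {f : ℝ → ℝ}
    (hf : EvenCont f) :
    ∫ y, f (toD y) ∂(a + a.map (fun y : EReal => -y)) = 2 * evalD a f := by
  have := ha.prob
  have hneg : AEMeasurable (fun y : EReal => -y) a := measurable_neg.aemeasurable
  have := Measure.isProbabilityMeasure_map hneg
  rw [integral_add_measure (hf.integrable _) (hf.integrable _), integral_map hneg
    (hf.measurable_comp measurable_toD toD_mem).aestronglyMeasurable]
  simp only [toD_neg, hf.even, evalD]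
  ring

/-- The posterior kernel runs the degrading channel backwards. The conditional mean of the soft bit
of Y given Z is the soft bit of Z, both being conditional means of the input, and Jensen's
inequality gives the convex order. -/
lemma Degraded.better {a b : Measure EReal} (ha : IsLDist a) (hb : IsLDist b)
    (h : Degraded a b) : Better a b := by
  obtain ⟨κ, hκ, h1, h2⟩ := h
  intro f hf
  have := ha.prob
  have := hb.prob
  have := Measure.isProbabilityMeasure_map (measurable_neg (G := EReal)).aemeasurable (μ := a)
  have := Measure.isProbabilityMeasure_map (measurable_neg (G := EReal)).aemeasurable (μ := b)
  set m := a + a.map (fun y : EReal => -y) with hm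
  set n := b + b.map (fun y : EReal => -y) with hn
  have hmn : m.bind κ = n := by
    rw [hm, hn, Measure.comp_add, h1, h2]
  set π := posterior κ m with hπ
  have hswap : n ⊗ₘ π = (m ⊗ₘ κ).map Prod.swap := by
    rw [← hmn]; exact compProd_posterior_eq_map_swap
  have hDm : Measurable fun p : EReal × EReal => toD p.2 := measurable_toD.comp measurable_snd
  have hDi : Integrable (fun p : EReal × EReal => toD p.2) (n ⊗ₘ π) :=
    integrable_of_abs_le (C := 1) hDm fun p => abs_le.2 (toD_mem _)
  have hπi : ∀ {g : EReal → ℝ} {C : ℝ}, Measurable g → (∀ y, |g y| ≤ C) →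
      Integrable (fun z => ∫ y, g y ∂(π z)) n := by
    intro g C hg hC
    refine Integrable.of_bound hg.stronglyMeasurable.integral_kernel.aestronglyMeasurable C
      (Eventually.of_forall fun z => ?_)
    simpa using norm_integral_le_of_norm_le_const (μ := π z) (f := g) (C := C)
      (Eventually.of_forall hC)
  have hmean : ∀ᵐ z ∂n, ∫ y, toD y ∂(π z) = toD z := by
    refine Integrable.ae_eq_of_forall_setIntegral_eq _ _ (hπi measurable_toD fun y => abs_le.2 (toD_mem y))
      (integrable_of_abs_le (C := 1) measurable_toD fun p => abs_le.2 (toD_mem _)) fun E hE _ => ?_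
    have hκE : Measurable fun y => (κ y).real E := (κ.measurable_coe hE).ennreal_toReal
    have hκC : ∀ y, |(κ y).real E| ≤ 1 := fun y => by
      rw [abs_of_nonneg measureReal_nonneg]; exact measureReal_le_one
    have hEm : Measurable (E.indicator (1 : EReal → ℝ)) := measurable_one.indicator hE
    have hEC : ∀ y, |E.indicator (1 : EReal → ℝ) y| ≤ 1 := fun y => by
      by_cases hy : y ∈ E <;> simp [hy]
    have hbE : ∀ μ : Measure EReal, IsProbabilityMeasure μ →
        ∫ y, (κ y).real E ∂μ = (μ.bind κ).real E := by
      intro μ _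
      rw [measureReal_def, Measure.bind_apply hE κ.aemeasurable]
      exact integral_toReal (κ.measurable_coe hE).aemeasurable
        (Eventually.of_forall fun y => measure_lt_top _ _)
    have hI : ∀ μ : Measure EReal, ∫ y, E.indicator (1 : EReal → ℝ) y ∂μ = μ.real E := fun μ =>
      integral_indicator_one hE
    calc ∫ z in E, ∫ y, toD y ∂(π z) ∂n
        = ∫ p in E ×ˢ univ, toD p.2 ∂(n ⊗ₘ π) := by
          rw [Measure.setIntegral_compProd hE MeasurableSet.univ hDi.integrableOn]
          simp
      _ = ∫ p in (univ ×ˢ E), toD p.1 ∂(m ⊗ₘ κ) := by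
          rw [hswap, setIntegral_map (hE.prod MeasurableSet.univ) hDm.aestronglyMeasurable
            measurable_swap.aemeasurable]
          congr 2
          ext p
          simp
      -- From here the integral is evaluated as the difference of the probabilities of E at the
      -- degraded output under the two inputs.
      _ = ∫ y, toD y * (κ y).real E ∂m := by
          rw [Measure.setIntegral_compProd MeasurableSet.univ hE]
          · simp [mul_comm]
          · exact (integrable_of_abs_le (C := 1) (measurable_toD.comp measurable_fst)
              fun p => abs_le.2 (toD_mem _)).integrableOn
      _ = b.real E - (b.map (fun y : EReal => -y)).real E := by
          rw [hm, ha.integral_toD_mul_symm hκE hκC, hbE _ inferInstance, hbE _ inferInstance, h1, h2]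
      _ = ∫ y, toD y * E.indicator 1 y ∂n := by
          rw [hn, hb.integral_toD_mul_symm hEm hEC, hI, hI]
      _ = ∫ z in E, toD z ∂n := by
          rw [← integral_indicator hE]
          congr 1
          ext y
          by_cases hy : y ∈ E <;> simp [hy]
  obtain ⟨C, -, hC⟩ := hf.exists_bound
  have hfi : Integrable (fun p : EReal × EReal => f (toD p.2)) (n ⊗ₘ π) := by
    exact integrable_of_abs_le (hf.measurable_comp hDm fun p => toD_mem _) fun p => hC _ (toD_mem _)
  have key : ∫ z, f (toD z) ∂n ≤ ∫ y, f (toD y) ∂m := by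
    calc ∫ z, f (toD z) ∂n ≤ ∫ z, ∫ y, f (toD y) ∂(π z) ∂n := by
          refine integral_mono_ae (hf.integrable n) (hπi (hf.measurable_comp measurable_toD toD_mem) fun y => hC _ (toD_mem y)) ?_
          filter_upwards [hmean] with z hz
          rw [← hz]
          exact hf.convex.map_integral_le hf.cont isClosed_Icc (Eventually.of_forall toD_mem)
            (integrable_of_abs_le (C := 1) measurable_toD fun p => abs_le.2 (toD_mem _))
            (hf.integrable _)
      _ = ∫ p, f (toD p.2) ∂(n ⊗ₘ π) := (Measure.integral_compProd hfi).symm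
      _ = ∫ p, f (toD p.1) ∂(m ⊗ₘ κ) := by
          rw [hswap, integral_map measurable_swap.aemeasurable
            (hf.measurable_comp hDm fun p => toD_mem _).aestronglyMeasurable]
          rfl
      _ = ∫ y, f (toD y) ∂m := by
          rw [Measure.integral_compProd]
          · simp
          · exact integrable_of_abs_le (hf.measurable_comp (measurable_toD.comp measurable_fst)
              fun p => toD_mem _) fun p => hC _ (toD_mem _)
  rw [hm, hn, ha.integral_symm_even hf.toEvenCont, hb.integral_symm_even hf.toEvenCont] at key
  linarith

/-! ### Weak convergence and the fixed-point equation -/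

/-- Convergence of the integrals of all continuous even functions of the soft bit. -/
def WeakConv (a : ℕ → Measure EReal) (b : Measure EReal) : Prop :=
  ∀ f, EvenCont f → Tendsto (fun n => evalD (a n) f) atTop (𝓝 (evalD b f))

lemma WeakLimit.weakConv {a : ℕ → Measure EReal} {b : Measure EReal} (h : WeakLimit a b) :
    WeakConv a b := by
  intro f hf
  have := h f (hf.cont.mono (Icc_subset_Icc (by norm_num) le_rfl))
  simpa only [hf.abs_eq, evalD] using this

lemma weakConv_const (a : Measure EReal) : WeakConv (fun _ => a) a := fun _ _ => tendsto_const_nhds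

/-- The absolute value of the soft bit, as a point of `[0, 1]`. -/
def absBit (y : EReal) : Icc (0 : ℝ) 1 := ⟨|toD y|, abs_nonneg _, abs_le.2 (toD_mem y)⟩

lemma measurable_absBit : Measurable absBit :=
  Measurable.subtype_mk (continuous_abs.measurable.comp measurable_toD)

/-- The law of the absolute value of the soft bit. -/
def absLaw (a : Measure EReal) [IsProbabilityMeasure a] : ProbabilityMeasure (Icc (0 : ℝ) 1) :=
  ⟨a.map absBit, Measure.isProbabilityMeasure_map measurable_absBit.aemeasurable⟩

/-- Even functions see only the absolute soft bit. Passing to its law gives genuine weak convergence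
of probability measures on [0,1], for which forming products is continuous. -/
lemma WeakConv.tendsto_absLaw {a : ℕ → Measure EReal} {b : Measure EReal}
    [∀ n, IsProbabilityMeasure (a n)] [IsProbabilityMeasure b] (h : WeakConv a b) :
    Tendsto (fun n => absLaw (a n)) atTop (𝓝 (absLaw b)) := by
  rw [ProbabilityMeasure.tendsto_iff_forall_integral_tendsto]
  intro F
  have h01 : (0 : ℝ) ≤ 1 := zero_le_one
  have hF : EvenCont fun d => IccExtend h01 F |d| :=
    ⟨((F.continuous.Icc_extend' (h := h01)).comp continuous_abs).continuousOn, fun d => by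
      rw [abs_neg]⟩
  have e : ∀ μ : Measure EReal, ∀ [IsProbabilityMeasure μ],
      ∫ x, F x ∂(absLaw μ : Measure (Icc (0 : ℝ) 1)) = evalD μ fun d => IccExtend h01 F |d| := by
    intro μ _
    have : (absLaw μ : Measure (Icc (0 : ℝ) 1)) = μ.map absBit := rfl
    rw [this, integral_map measurable_absBit.aemeasurable
      F.continuous.measurable.aestronglyMeasurable, evalD]
    congr 1
    ext y
    exact (IccExtend_of_mem h01 F (absBit y).2).symm
  simp_rw [e]
  exact h _ hF

/-- A kernel even in each variable is a continuous function on the compact square [0,1]², integrated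
against a product of absolute laws. -/
lemma WeakConv.integral_kernel {a b : ℕ → Measure EReal} {a' b' : Measure EReal}
    [∀ n, IsProbabilityMeasure (a n)] [IsProbabilityMeasure a']
    [∀ n, IsProbabilityMeasure (b n)] [IsProbabilityMeasure b']
    (ha : WeakConv a a') (hb : WeakConv b b') {κ : ℝ × ℝ → ℝ}
    (hκ : ContinuousOn κ (Icc (-1) 1 ×ˢ Icc (-1) 1)) (h1 : ∀ d e, κ (-d, e) = κ (d, e))
    (h2 : ∀ d e, κ (d, -e) = κ (d, e)) :
    Tendsto (fun n => ∫ y, ∫ z, κ (toD y, toD z) ∂(b n) ∂(a n)) atTop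
      (𝓝 (∫ y, ∫ z, κ (toD y, toD z) ∂b' ∂a')) := by
  let K : C(Icc (0 : ℝ) 1 × Icc (0 : ℝ) 1, ℝ) := ⟨fun p => κ (p.1, p.2), by
    refine hκ.comp_continuous (f := fun p : Icc (0 : ℝ) 1 × Icc (0 : ℝ) 1 => ((p.1 : ℝ), (p.2 : ℝ)))
      (by fun_prop) fun p => ⟨⟨?_, p.1.2.2⟩, ⟨?_, p.2.2.2⟩⟩
    · linarith [p.1.2.1]
    · linarith [p.2.2.1]⟩
  have hlim : Tendsto (fun n => (absLaw (a n)).prod (absLaw (b n))) atTop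
      (𝓝 ((absLaw a').prod (absLaw b'))) :=
    (ProbabilityMeasure.continuous_prod.tendsto (absLaw a', absLaw b')).comp
      (ha.tendsto_absLaw.prodMk_nhds hb.tendsto_absLaw)
  have hT := (ProbabilityMeasure.tendsto_iff_forall_integral_tendsto.1 hlim)
    (BoundedContinuousFunction.mkOfCompact K)
  have hk1 : ∀ d e, κ (|d|, e) = κ (d, e) := fun d e => by
    rcases abs_choice d with h | h <;> rw [h]
    exact h1 d e
  have hk2 : ∀ d e, κ (d, |e|) = κ (d, e) := fun d e => by
    rcases abs_choice e with h | h <;> rw [h]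
    exact h2 d e
  have e : ∀ μ ν : Measure EReal, ∀ [IsProbabilityMeasure μ] [IsProbabilityMeasure ν],
      ∫ p, BoundedContinuousFunction.mkOfCompact K p
        ∂((absLaw μ).prod (absLaw ν) : Measure (Icc (0 : ℝ) 1 × Icc (0 : ℝ) 1))
        = ∫ y, ∫ z, κ (toD y, toD z) ∂ν ∂μ := by
    intro μ ν _ _
    have : ((absLaw μ).prod (absLaw ν) : Measure (Icc (0 : ℝ) 1 × Icc (0 : ℝ) 1))
        = (μ.prod ν).map (Prod.map absBit absBit) :=
      Measure.map_prod_map μ ν measurable_absBit measurable_absBit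
    rw [this, integral_map (measurable_absBit.prodMap measurable_absBit).aemeasurable
      (BoundedContinuousFunction.continuous _).measurable.aestronglyMeasurable]
    have e' : ∀ p : EReal × EReal, BoundedContinuousFunction.mkOfCompact K
        (Prod.map absBit absBit p) = κ (toD p.1, toD p.2) := fun p => by
      simp only [BoundedContinuousFunction.mkOfCompact_apply, K, ContinuousMap.coe_mk, Prod.map,
        absBit, hk1, hk2]
    simp_rw [e']
    exact integral_prod _ (integrable_kernel hκ (μ.prod ν))
  have hT' := hT.congr fun n => e (a n) (b n)
  rwa [e] at hT'

lemma WeakConv.checkConv {a b : ℕ → Measure EReal} {a' b' : Measure EReal}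
    (ia : ∀ n, IsLDist (a n)) (ia' : IsLDist a') (ib : ∀ n, IsLDist (b n)) (ib' : IsLDist b')
    (ha : WeakConv a a') (hb : WeakConv b b') :
    WeakConv (fun n => checkConv (a n) (b n)) (checkConv a' b') := by
  have := fun n => (ia n).prob
  have := fun n => (ib n).prob
  have := ia'.prob
  have := ib'.prob
  intro f hf
  simp_rw [evalD_checkConv hf]
  exact ha.integral_kernel hb (continuousOn_checkK hf) (fun d e => by simp [hf.even])
    (fun d e => by simp [hf.even])

lemma WeakConv.varConv {a b : ℕ → Measure EReal} {a' b' : Measure EReal}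
    (ia : ∀ n, IsLDist (a n)) (ia' : IsLDist a') (ib : ∀ n, IsLDist (b n)) (ib' : IsLDist b')
    (ha : WeakConv a a') (hb : WeakConv b b') :
    WeakConv (fun n => varConv (a n) (b n)) (varConv a' b') := by
  have := fun n => (ia n).prob
  have := fun n => (ib n).prob
  have := ia'.prob
  have := ib'.prob
  intro f hf
  simp_rw [evalD_varConv (ia _) (ib _) hf, evalD_varConv ia' ib' hf]
  exact ha.integral_kernel hb hf.continuousOn_varK (fun d e => varK_neg hf d e)
    (fun d e => by simp only [varK_comm hf d, varK_neg hf])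

lemma WeakConv.checkPow {a : ℕ → Measure EReal} {a' : Measure EReal}
    (ia : ∀ n, IsLDist (a n)) (ia' : IsLDist a') (ha : WeakConv a a') (k : ℕ) :
    WeakConv (fun n => checkPow (a n) k) (checkPow a' k) := by
  induction k with
  | zero => exact weakConv_const _
  | succ k ih => exact ih.checkConv (fun n => (ia n).checkPow k) (ia'.checkPow k) ia ia' ha

lemma WeakConv.varPow {a : ℕ → Measure EReal} {a' : Measure EReal}
    (ia : ∀ n, IsLDist (a n)) (ia' : IsLDist a') (ha : WeakConv a a') (k : ℕ) :
    WeakConv (fun n => varPow (a n) k) (varPow a' k) := by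
  induction k with
  | zero => exact weakConv_const _
  | succ k ih => exact ih.varConv (fun n => (ia n).varPow k) (ia'.varPow k) ia ia' ha

/-- The density evolution fixed-point equation, tested against continuous even functions. -/
lemma IsForwardFP.evalD_eq {l r : ℕ} {c x : Measure EReal} (hc : IsLDist c)
    (h : IsForwardFP l r c x) {f : ℝ → ℝ} (hf : EvenCont f) :
    evalD x f = evalD (varConv c (varPow (checkPow x (r - 1)) (l - 1))) f := by
  have hx := h.1
  have h1 := h.2.weakConv
  have hD := hc.forwardDE l r
  have h2 : WeakConv (fun n => forwardDE l r c (n + 1))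
      (varConv c (varPow (checkPow x (r - 1)) (l - 1))) :=
    WeakConv.varConv (fun _ => hc) hc (fun n => ((hD n).checkPow _).varPow _)
      ((hx.checkPow _).varPow _) (weakConv_const c)
      (WeakConv.varPow (fun n => (hD n).checkPow _) (hx.checkPow _)
        (WeakConv.checkPow hD hx h1 _) _)
  -- The shifted iteration has both limits. The two measures need not be identified: agreement on
  -- even functions is enough for moments, entropy and 𝔅.
  exact tendsto_nhds_unique ((h1 f hf).comp (tendsto_add_atTop_nat 1)) (h2 f hf)

lemma IsForwardFP.better {l r : ℕ} {c c' x x' : Measure EReal} (hc : IsLDist c) (hc' : IsLDist c')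
    (h : IsForwardFP l r c x) (h' : IsForwardFP l r c' x') (hcc : Better c c') : Better x x' :=
  fun f hf => le_of_tendsto_of_tendsto' (h'.2.weakConv f hf.toEvenCont)
    (h.2.weakConv f hf.toEvenCont) fun n => hcc.forwardDE hc hc' l r n f hf

/-! ### Expansions in even moments -/

/-- `φ(d) = 1 - ∑ q_k d^{2(k+1)}` on `[-1, 1]`, with positive coefficients. -/
structure IsMomentSeries (φ : ℝ → ℝ) (q : ℕ → ℝ) : Prop where
  pos : ∀ k, 0 < q k
  hasSum : ∀ d ∈ Icc (-1 : ℝ) 1, HasSum (fun k => q k * d ^ (2 * (k + 1))) (1 - φ d)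

/-- Abel's theorem for nonnegative coefficients: partial sums are bounded by g(1), so the
coefficients are summable, the series is continuous up to 1, and the limits agree. -/
lemma hasSum_one_of_hasSum_lt_one {q : ℕ → ℝ} (hq : ∀ k, 0 ≤ q k) {g : ℝ → ℝ}
    (hg : ContinuousOn g (Icc 0 1))
    (h : ∀ t ∈ Ico (0 : ℝ) 1, HasSum (fun k => q k * t ^ (k + 1)) (g t)) :
    HasSum q (g 1) := by
  have hne : (𝓝[Ico (0 : ℝ) 1] 1).NeBot := by
    rw [← mem_closure_iff_nhdsWithin_neBot, closure_Ico (by norm_num)]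
    simp
  have hg1 : Tendsto g (𝓝[Ico (0 : ℝ) 1] 1) (𝓝 (g 1)) :=
    (hg 1 (by simp)).mono_left (nhdsWithin_mono _ Ico_subset_Icc_self)
  have hpart : ∀ s : Finset ℕ, ∑ k ∈ s, q k ≤ g 1 := by
    intro s
    have hc : Continuous fun t : ℝ => ∑ k ∈ s, q k * t ^ (k + 1) := by fun_prop
    have h1 : Tendsto (fun t : ℝ => ∑ k ∈ s, q k * t ^ (k + 1)) (𝓝[Ico (0 : ℝ) 1] 1)
        (𝓝 (∑ k ∈ s, q k)) := by
      have := (hc.tendsto 1).mono_left (nhdsWithin_le_nhds (s := Ico (0 : ℝ) 1))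
      simpa using this
    refine le_of_tendsto_of_tendsto h1 hg1 (eventually_nhdsWithin_of_forall fun t ht => ?_)
    exact sum_le_hasSum s (fun k _ => mul_nonneg (hq k) (pow_nonneg ht.1 _)) (h t ht)
  have hs : Summable q := summable_of_sum_le hq hpart
  have hcont : ContinuousOn (fun t : ℝ => ∑' k, q k * t ^ (k + 1)) (Icc 0 1) := by
    refine continuousOn_tsum (fun k => by fun_prop) hs fun k t ht => ?_
    rw [Real.norm_eq_abs, abs_of_nonneg (mul_nonneg (hq k) (pow_nonneg ht.1 _))]
    exact mul_le_of_le_one_right (hq k) (pow_le_one₀ ht.1 ht.2)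
  have h2 : Tendsto (fun t : ℝ => ∑' k, q k * t ^ (k + 1)) (𝓝[Ico (0 : ℝ) 1] 1)
      (𝓝 (∑' k, q k)) := by
    have := (hcont 1 (by simp)).mono_left (nhdsWithin_mono _ Ico_subset_Icc_self)
    simpa using this
  have h3 : (fun t : ℝ => ∑' k, q k * t ^ (k + 1)) =ᶠ[𝓝[Ico (0 : ℝ) 1] 1] g :=
    eventually_nhdsWithin_of_forall fun t ht => (h t ht).tsum_eq
  rw [← tendsto_nhds_unique (h2.congr' h3) hg1]
  exact hs.hasSum

lemma isMomentSeries_of_lt_one {φ : ℝ → ℝ} (hφ : EvenCont φ) {q : ℕ → ℝ} (hq : ∀ k, 0 < q k)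
    (h : ∀ d ∈ Ico (0 : ℝ) 1, HasSum (fun k => q k * d ^ (2 * (k + 1))) (1 - φ d)) :
    IsMomentSeries φ q := by
  have h1 : HasSum q (1 - φ 1) := by
    have := hasSum_one_of_hasSum_lt_one (fun k => (hq k).le) (g := fun t => 1 - φ (Real.sqrt t))
      (continuousOn_const.sub (hφ.cont.comp Real.continuous_sqrt.continuousOn fun t ht =>
        ⟨by linarith [Real.sqrt_nonneg t], by rw [Real.sqrt_le_one]; exact ht.2⟩)) fun t ht => by
        have := h (Real.sqrt t) ⟨Real.sqrt_nonneg t, by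
          rw [Real.sqrt_lt' one_pos, one_pow]; exact ht.2⟩
        simpa only [pow_mul, Real.sq_sqrt ht.1] using this
    simpa using this
  have h0 : ∀ d ∈ Icc (0 : ℝ) 1, HasSum (fun k => q k * d ^ (2 * (k + 1))) (1 - φ d) := by
    intro d hd
    rcases hd.2.eq_or_lt with h' | h'
    · subst h'; simpa using h1
    · exact h d ⟨hd.1, h'⟩
  refine ⟨hq, fun d hd => ?_⟩
  rcases le_total 0 d with h' | h'
  · exact h0 d ⟨h', hd.2⟩
  · have := h0 (-d) ⟨by linarith, by linarith [hd.1]⟩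
    simpa only [Even.neg_pow (even_two_mul _), hφ.even] using this

/-- Coefficients of the entropy kernel. -/
def entropyCoeff (k : ℕ) : ℝ := 1 / ((2 * k + 1) * (k + 1)) / (2 * Real.log 2)

/-- Uses (1+d)log(1+d) + (1-d)log(1-d) = d(log(1+d) - log(1-d)) + log(1-d²); the coefficients
combine as 2/(2k+1) - 1/(k+1) = 1/((2k+1)(k+1)). -/
lemma isMomentSeries_etaD : IsMomentSeries etaD entropyCoeff := by
  have hl := Real.log_pos (show (1 : ℝ) < 2 by norm_num)
  refine isMomentSeries_of_lt_one evenCont_etaD (fun k => by unfold entropyCoeff; positivity) ?_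
  intro d hd
  have habs : |d| < 1 := abs_lt.2 ⟨by linarith [hd.1], hd.2⟩
  have habs2 : |d ^ 2| < 1 := by
    rw [abs_pow]; exact pow_lt_one₀ (abs_nonneg _) habs two_ne_zero
  have h1 := (Real.hasSum_log_sub_log_of_abs_lt_one habs).mul_left d
  have h2 := Real.hasSum_pow_div_log_of_abs_lt_one habs2
  have h3 := (h1.sub h2).div_const (2 * Real.log 2)
  have e : Real.log (1 - d ^ 2) = Real.log (1 + d) + Real.log (1 - d) := by
    rw [← Real.log_mul (by linarith [hd.1]) (by linarith [hd.2])]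
    ring_nf
  have e1 : ∀ k : ℕ, (d * (2 * (1 / (2 * k + 1)) * d ^ (2 * k + 1)) -
      (d ^ 2) ^ (k + 1) / (k + 1)) / (2 * Real.log 2) = entropyCoeff k * d ^ (2 * (k + 1)) := by
    intro k
    unfold entropyCoeff
    have : (2 * (k : ℝ) + 1) ≠ 0 := by positivity
    have : ((k : ℝ) + 1) ≠ 0 := by positivity
    rw [← pow_mul]
    field_simp
    ring
  have e2 : (d * (Real.log (1 + d) - Real.log (1 - d)) - -Real.log (1 - d ^ 2)) /
      (2 * Real.log 2) = 1 - etaD d := by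
    rw [e, etaD]
    ring
  rwa [e2, funext e1] at h3

/-- Coefficients of the Bhattacharyya kernel. -/
def battaCoeff (k : ℕ) : ℝ := -(Ring.choose (1 / 2 : ℝ) (k + 1) * (-1) ^ (k + 1))

lemma choose_half_succ (k : ℕ) : Ring.choose (1 / 2 : ℝ) (k + 1)
    = Ring.choose (1 / 2 : ℝ) k * (1 / 2 - k) / (k + 1) := by
  have h := Ring.choose_smul_choose (1 / 2 : ℝ) (Nat.le_succ k)
  rw [show k.succ - k = 1 by omega, Nat.choose_succ_self_right, Ring.choose_one_right,
    nsmul_eq_mul] at h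
  rw [← h]
  push_cast
  field_simp

lemma battaCoeff_pos (k : ℕ) : 0 < battaCoeff k := by
  induction k with
  | zero => simp [battaCoeff]
  | succ k ih =>
    have e : battaCoeff (k + 1) = battaCoeff k * ((k + 1 / 2) / (k + 2)) := by
      unfold battaCoeff
      rw [choose_half_succ (k + 1)]
      push_cast
      have : ((k : ℝ) + 1 + 1) ≠ 0 := by positivity
      have : ((k : ℝ) + 2) ≠ 0 := by positivity
      field_simp
      ring
    rw [e]
    positivity

/-- The binomial series of exponent 1/2 at -d²: every coefficient after the constant one is
negative. -/
lemma isMomentSeries_sqrt : IsMomentSeries (fun d => Real.sqrt (1 - d ^ 2)) battaCoeff := by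
  refine isMomentSeries_of_lt_one evenCont_sqrt battaCoeff_pos ?_
  intro d hd
  have hd2 : d ^ 2 < 1 := pow_lt_one₀ hd.1 hd.2 two_ne_zero
  have h := (Real.one_add_rpow_hasFPowerSeriesOnBall_zero (a := 1 / 2)).hasSum
    (y := -d ^ 2) (by
      rw [Metric.mem_eball, edist_zero_right, ← ofReal_norm, ENNReal.ofReal_lt_one]
      simpa using hd2)
  simp only [binomialSeries_apply, List.ofFn_const, List.prod_replicate, zero_add,
    smul_eq_mul] at h
  rw [← Real.sqrt_eq_rpow, ← sub_eq_add_neg] at h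
  rw [← hasSum_nat_add_iff' 1] at h
  have h' := h.neg
  simp only [Finset.range_one, Finset.sum_singleton, Ring.choose_zero_right, pow_zero, mul_one,
    neg_sub] at h'
  have e1 : ∀ k : ℕ, -(Ring.choose (1 / 2 : ℝ) (k + 1) * (-d ^ 2) ^ (k + 1))
      = battaCoeff k * d ^ (2 * (k + 1)) := by
    intro k
    unfold battaCoeff
    rw [pow_mul, neg_pow (d ^ 2)]
    ring
  rwa [funext e1] at h'

/-! ### Moments -/

/-- The even moments of the soft bit. -/
def mom (a : Measure EReal) (k : ℕ) : ℝ := evalD a fun d => d ^ (2 * (k + 1))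

lemma pow_even_mem {d : ℝ} (hd : d ∈ Icc (-1 : ℝ) 1) (k : ℕ) :
    d ^ (2 * (k + 1)) ∈ Icc (0 : ℝ) 1 := by
  rw [pow_mul]
  have : d ^ 2 ≤ 1 := by rw [sq_le_one_iff_abs_le_one]; exact abs_le.2 hd
  exact ⟨by positivity, pow_le_one₀ (by positivity) this⟩

lemma evalD_mono {a : Measure EReal} [IsProbabilityMeasure a] {f g : ℝ → ℝ} (hf : EvenCont f)
    (hg : EvenCont g) (h : ∀ d ∈ Icc (-1 : ℝ) 1, f d ≤ g d) : evalD a f ≤ evalD a g :=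
  integral_mono (hf.integrable a) (hg.integrable a) fun y => h _ (toD_mem y)

lemma evalD_const (a : Measure EReal) [IsProbabilityMeasure a] (C : ℝ) :
    evalD a (fun _ => C) = C := by simp [evalD]

lemma evenCont_const (C : ℝ) : EvenCont fun _ => C := ⟨continuousOn_const, fun _ => rfl⟩

lemma mom_mem (a : Measure EReal) [IsProbabilityMeasure a] (k : ℕ) : mom a k ∈ Icc (0 : ℝ) 1 := by
  constructor
  · exact integral_nonneg fun y => (pow_even_mem (toD_mem y) k).1
  · have := evalD_mono (a := a) (evenCont_pow (k + 1)) (evenCont_const 1)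
      fun d hd => (pow_even_mem hd k).2
    rwa [evalD_const] at this

lemma mom_le_mom_zero (a : Measure EReal) [IsProbabilityMeasure a] (k : ℕ) :
    mom a k ≤ mom a 0 := by
  refine evalD_mono (evenCont_pow (k + 1)) (evenCont_pow 1) fun d hd => ?_
  rw [pow_mul, pow_mul]
  have : d ^ 2 ≤ 1 := by rw [sq_le_one_iff_abs_le_one]; exact abs_le.2 hd
  exact pow_le_pow_of_le_one (by positivity) this (by omega)

lemma Better.mom_le {a b : Measure EReal} (h : Better a b) (k : ℕ) : mom b k ≤ mom a k :=
  h _ (evenConvex_pow (k + 1))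

/-- The soft bit of a ⊞ b is a product of independent soft bits. -/
lemma mom_checkConv (a b : Measure EReal) [IsProbabilityMeasure a] [IsProbabilityMeasure b]
    (k : ℕ) : mom (checkConv a b) k = mom a k * mom b k := by
  unfold mom
  rw [evalD_checkConv (evenCont_pow (k + 1))]
  simp only [mul_pow, integral_const_mul, integral_mul_const, evalD]

lemma mom_checkPow {a : Measure EReal} (ha : IsLDist a) (n k : ℕ) :
    mom (checkPow a n) k = mom a k ^ n := by
  induction n with
  | zero => simp [mom, evalD, checkPow]
  | succ n ih =>
    have := ha.prob
    have := (ha.checkPow n).prob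
    rw [checkPow, mom_checkConv, ih, pow_succ]

lemma IsMomentSeries.summable {φ : ℝ → ℝ} {q : ℕ → ℝ} (h : IsMomentSeries φ q) : Summable q := by
  simpa using (h.hasSum 1 (by norm_num)).summable

lemma IsMomentSeries.hasSum_mom {φ : ℝ → ℝ} {q : ℕ → ℝ} (h : IsMomentSeries φ q)
    (a : Measure EReal) [IsProbabilityMeasure a] (hφ : EvenCont φ) :
    HasSum (fun k => q k * mom a k) (1 - evalD a φ) := by
  have h1 : 1 - evalD a φ = ∫ y, ∑' k, q k * toD y ^ (2 * (k + 1)) ∂a := by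
    simp_rw [(h.hasSum _ (toD_mem _)).tsum_eq]
    rw [integral_sub (integrable_const _) (hφ.integrable a)]
    simp [evalD]
  have hi : ∀ k, Integrable (fun y => q k * toD y ^ (2 * (k + 1))) a := fun k =>
    ((evenCont_pow (k + 1)).integrable a).const_mul _
  have hn : ∀ k y, ‖q k * toD y ^ (2 * (k + 1))‖ ≤ q k := fun k y => by
    have := pow_even_mem (toD_mem y) k
    rw [Real.norm_eq_abs, abs_of_nonneg (mul_nonneg (h.pos k).le this.1)]
    exact mul_le_of_le_one_right (h.pos k).le this.2
  have := hasSum_integral_of_summable_integral_norm hi (Summable.of_nonneg_of_le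
    (fun k => integral_nonneg fun y => norm_nonneg _) (fun k => by
      have := integral_mono (hi k).norm (integrable_const (q k)) (hn k)
      simpa using this) h.summable)
  rw [h1]
  simpa only [integral_const_mul, mom, evalD] using this

/-! ### Entropy and Bhattacharyya parameter of convolutions -/

/-- Each logarithm that would be singular is multiplied by a factor vanishing at the same point, so
the expansion holds up to the boundary of the square. -/
lemma one_add_mul_etaD {d e : ℝ} (hd : d ∈ Icc (-1 : ℝ) 1) (he : e ∈ Icc (-1 : ℝ) 1) :
    (1 + d * e) * etaD ((d + e) / (1 + d * e)) = (1 + d * e) -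
      ((1 + d) * (1 + e) * (Real.log (1 + d) + Real.log (1 + e) - Real.log (1 + d * e)) +
        (1 - d) * (1 - e) * (Real.log (1 - d) + Real.log (1 - e) - Real.log (1 + d * e))) /
        (2 * Real.log 2) := by
  have hl := Real.log_pos (show (1 : ℝ) < 2 by norm_num)
  by_cases h : 1 + d * e = 0
  · have h1 : (1 + d) * (1 + e) = 0 := by
      obtain ⟨a1, a2⟩ := hd; obtain ⟨b1, b2⟩ := he; nlinarith
    have h2 : (1 - d) * (1 - e) = 0 := by
      obtain ⟨a1, a2⟩ := hd; obtain ⟨b1, b2⟩ := he; nlinarith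
    rw [h1, h2, h]; ring
  · have e1 : 1 + (d + e) / (1 + d * e) = (1 + d) * (1 + e) / (1 + d * e) := by
      field_simp; ring
    have e2 : 1 - (d + e) / (1 + d * e) = (1 - d) * (1 - e) / (1 + d * e) := by
      field_simp; ring
    have l1 : (1 + d) * (1 + e) * Real.log ((1 + d) * (1 + e) / (1 + d * e)) = (1 + d) * (1 + e) *
        (Real.log (1 + d) + Real.log (1 + e) - Real.log (1 + d * e)) := by
      by_cases h1 : 1 + d = 0
      · rw [h1]; ring
      · by_cases h2 : 1 + e = 0
        · rw [h2]; ring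
        · rw [Real.log_div (mul_ne_zero h1 h2) h, Real.log_mul h1 h2]
    have l2 : (1 - d) * (1 - e) * Real.log ((1 - d) * (1 - e) / (1 + d * e)) = (1 - d) * (1 - e) *
        (Real.log (1 - d) + Real.log (1 - e) - Real.log (1 + d * e)) := by
      by_cases h1 : 1 - d = 0
      · rw [h1]; ring
      · by_cases h2 : 1 - e = 0
        · rw [h2]; ring
        · rw [Real.log_div (mul_ne_zero h1 h2) h, Real.log_mul h1 h2]
    rw [etaD, e1, e2, ← l1, ← l2]
    field_simp

/-- The duality rule for entropy, for the kernels. -/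
lemma varK_etaD {d e : ℝ} (hd : d ∈ Icc (-1 : ℝ) 1) (he : e ∈ Icc (-1 : ℝ) 1) :
    varK etaD d e = etaD d + etaD e - etaD (d * e) := by
  have hl := Real.log_pos (show (1 : ℝ) < 2 by norm_num)
  rw [varK_eq, one_add_mul_etaD hd he,
    one_add_mul_etaD hd ⟨by linarith [he.2], by linarith [he.1]⟩]
  simp only [mul_neg, ← sub_eq_add_neg, sub_neg_eq_add]
  unfold etaD
  field_simp
  ring

lemma integral_add_sub {α : Type*} [MeasurableSpace α] {μ : Measure α} {f g h : α → ℝ}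
    (hf : Integrable f μ) (hg : Integrable g μ) (hh : Integrable h μ) :
    ∫ x, (f x + g x - h x) ∂μ = ∫ x, f x ∂μ + ∫ x, g x ∂μ - ∫ x, h x ∂μ := by
  rw [← integral_add hf hg]
  exact integral_sub (hf.add hg) hh

lemma IsLDist.entropy_varConv {a b : Measure EReal} (ha : IsLDist a) (hb : IsLDist b) :
    entropy (GEXIT.varConv a b) = entropy a + entropy b - entropy (GEXIT.checkConv a b) := by
  have := ha.prob
  have := hb.prob
  rw [(ha.varConv hb).entropy_eq, (ha.checkConv hb).entropy_eq, ha.entropy_eq, hb.entropy_eq,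
    evalD_varConv ha hb evenCont_etaD, evalD_checkConv evenCont_etaD]
  simp_rw [varK_etaD (toD_mem _) (toD_mem _)]
  have hi := integrable_kernel (continuousOn_checkK evenCont_etaD) (a.prod b)
  have h1 : ∀ y, ∫ z, (etaD (toD y) + etaD (toD z) - etaD (toD y * toD z)) ∂b
      = etaD (toD y) + evalD b etaD - ∫ z, etaD (toD y * toD z) ∂b := by
    intro y
    have i1 := evenCont_etaD.integrable b
    have i2 : Integrable (fun z => etaD (toD y * toD z)) b := by
      obtain ⟨C, -, hC⟩ := evenCont_etaD.exists_bound
      exact integrable_of_abs_le (evenCont_etaD.measurable_comp (measurable_toD.const_mul _)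
        fun z => toD_mul_mem y z) fun z => hC _ (toD_mul_mem y z)
    rw [integral_add_sub (integrable_const _) i1 i2]
    simp [evalD]
  simp_rw [h1]
  rw [integral_add_sub (evenCont_etaD.integrable a) (integrable_const _) hi.integral_prod_left]
  simp [evalD]

lemma IsLDist.hasSum_entropy {a : Measure EReal} (ha : IsLDist a) :
    HasSum (fun k => entropyCoeff k * mom a k) (1 - entropy a) := by
  have := ha.prob
  rw [ha.entropy_eq]
  exact isMomentSeries_etaD.hasSum_mom a evenCont_etaD

lemma IsLDist.hasSum_batta {a : Measure EReal} (ha : IsLDist a) :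
    HasSum (fun k => battaCoeff k * mom a k) (1 - batta a) := by
  have := ha.prob
  rw [ha.batta_eq]
  exact isMomentSeries_sqrt.hasSum_mom a evenCont_sqrt

/-- Moments do not multiply under ⊛. Duality trades the entropy of a ⊛ b for that of a ⊞ b and so
makes it bilinear in the moments. -/
lemma IsLDist.hasSum_entropy_varConv {a b : Measure EReal} (ha : IsLDist a) (hb : IsLDist b) :
    HasSum (fun k => entropyCoeff k * (mom a k * mom b k))
      (1 - entropy a - entropy b + entropy (GEXIT.varConv a b)) := by
  have := ha.prob
  have := hb.prob
  have h := (ha.checkConv hb).hasSum_entropy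
  simp only [mom_checkConv] at h
  rw [ha.entropy_varConv hb]
  convert h using 1
  ring

lemma varK_sqrt {d e : ℝ} (hd : d ∈ Icc (-1 : ℝ) 1) (he : e ∈ Icc (-1 : ℝ) 1) :
    varK (fun d => Real.sqrt (1 - d ^ 2)) d e = Real.sqrt (1 - d ^ 2) * Real.sqrt (1 - e ^ 2) := by
  have half : ∀ e ∈ Icc (-1 : ℝ) 1, (1 + d * e) * Real.sqrt (1 - ((d + e) / (1 + d * e)) ^ 2)
      = Real.sqrt (1 - d ^ 2) * Real.sqrt (1 - e ^ 2) := by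
    intro e he
    obtain ⟨a1, a2⟩ := hd
    obtain ⟨b1, b2⟩ := he
    have h0 : 0 ≤ 1 + d * e := by
      rcases le_total 0 d with h | h <;> rcases le_total 0 e with h' | h' <;> nlinarith
    have hd2 : 0 ≤ 1 - d ^ 2 := by nlinarith
    rw [← Real.sqrt_mul hd2]
    rcases h0.eq_or_lt with h | h
    · have : (1 - d ^ 2) * (1 - e ^ 2) = 0 := by
        have h1 : (1 + d) * (1 + e) = 0 := by nlinarith
        linear_combination ((1 - d) * (1 - e)) * h1
      rw [← h, this]; simp
    · rw [show (1 - d ^ 2) * (1 - e ^ 2) = (1 + d * e) ^ 2 * (1 - ((d + e) / (1 + d * e)) ^ 2) by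
        field_simp; ring, Real.sqrt_mul (sq_nonneg _), Real.sqrt_sq h0]
  rw [varK_eq]
  rw [half e he, half (-e) ⟨by linarith [he.2], by linarith [he.1]⟩]
  simp

lemma IsLDist.batta_varConv {a b : Measure EReal} (ha : IsLDist a) (hb : IsLDist b) :
    batta (GEXIT.varConv a b) = batta a * batta b := by
  rw [(ha.varConv hb).batta_eq, ha.batta_eq, hb.batta_eq, evalD_varConv ha hb evenCont_sqrt]
  simp_rw [varK_sqrt (toD_mem _) (toD_mem _), integral_const_mul, integral_mul_const, evalD]

lemma batta_dirac_zero : batta (Measure.dirac 0) = 1 := by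
  rw [isLDist_dirac_zero.batta_eq, evalD]
  simp

lemma IsLDist.batta_varPow {a : Measure EReal} (ha : IsLDist a) (n : ℕ) :
    batta (GEXIT.varPow a n) = batta a ^ n := by
  induction n with
  | zero => exact batta_dirac_zero
  | succ n ih => rw [GEXIT.varPow, (ha.varPow n).batta_varConv ha, ih, pow_succ]

lemma IsLDist.batta_mem {a : Measure EReal} (ha : IsLDist a) : batta a ∈ Icc (0 : ℝ) 1 := by
  have := ha.prob
  constructor
  · rw [ha.batta_eq]
    exact integral_nonneg fun y => Real.sqrt_nonneg _
  · have h := ha.hasSum_batta.nonneg fun k =>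
      mul_nonneg (battaCoeff_pos k).le (mom_mem a k).1
    linarith

lemma batta_congr {a b : Measure EReal} (ha : IsLDist a) (hb : IsLDist b)
    (h : ∀ f, EvenCont f → evalD a f = evalD b f) : batta a = batta b := by
  rw [ha.batta_eq, hb.batta_eq, h _ evenCont_sqrt]

/-- Jensen's inequality for the convex function t ↦ √(p + q t²), with the supporting line at the
mean B supplied by Cauchy–Schwarz: p + qBβ ≤ √(p+qB²) √(p+qβ²). -/
lemma sqrt_le_evalD (a : Measure EReal) [IsProbabilityMeasure a] {p q : ℝ} (hp : 0 ≤ p)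
    (hq : 0 ≤ q) :
    Real.sqrt (p + q * (evalD a fun d => Real.sqrt (1 - d ^ 2)) ^ 2)
      ≤ evalD a fun d => Real.sqrt (p + q * Real.sqrt (1 - d ^ 2) ^ 2) := by
  set B := evalD a fun d => Real.sqrt (1 - d ^ 2) with hB
  set S := Real.sqrt (p + q * B ^ 2) with hS
  have hS2 : S ^ 2 = p + q * B ^ 2 := Real.sq_sqrt (by positivity)
  have hev : EvenCont fun d => Real.sqrt (p + q * Real.sqrt (1 - d ^ 2) ^ 2) :=
    ⟨by fun_prop, fun d => by simp⟩
  rcases (Real.sqrt_nonneg (p + q * B ^ 2)).eq_or_lt with h | h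
  · rw [← hS] at h
    rw [← h]
    exact integral_nonneg fun y => Real.sqrt_nonneg _
  · rw [← hS] at h
    have hB0 : 0 ≤ B := integral_nonneg fun y => Real.sqrt_nonneg _
    have key : ∀ d : ℝ, p + q * B * Real.sqrt (1 - d ^ 2)
        ≤ S * Real.sqrt (p + q * Real.sqrt (1 - d ^ 2) ^ 2) := by
      intro d
      set β := Real.sqrt (1 - d ^ 2)
      have hβ : 0 ≤ β := Real.sqrt_nonneg _
      rw [hS, ← Real.sqrt_mul (by positivity)]
      apply Real.le_sqrt_of_sq_le
      nlinarith [mul_nonneg (mul_nonneg hp hq) (sq_nonneg (B - β))]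
    have h1 := evalD_mono (a := a) (f := fun d => p + q * B * Real.sqrt (1 - d ^ 2))
      (g := fun d => S * Real.sqrt (p + q * Real.sqrt (1 - d ^ 2) ^ 2))
      ⟨by fun_prop, fun d => by simp⟩ ⟨by fun_prop, fun d => by simp⟩ fun d _ => key d
    have e1 : evalD a (fun d => p + q * B * Real.sqrt (1 - d ^ 2)) = p + q * B * B := by
      rw [evalD, integral_add (integrable_const _)
        ((evenCont_sqrt.integrable a).const_mul _), integral_const_mul]
      simp [hB, evalD]
    have e2 : evalD a (fun d => S * Real.sqrt (p + q * Real.sqrt (1 - d ^ 2) ^ 2))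
        = S * evalD a fun d => Real.sqrt (p + q * Real.sqrt (1 - d ^ 2) ^ 2) :=
      integral_const_mul _ _
    rw [e1, e2] at h1
    nlinarith

/-- Since 1 - d²e² = (1-d²) + d²(1-e²), the Jensen inequality above applies in e and then in d.
Equality holds when |d| and |e| are constant, that is, for binary symmetric channels. -/
lemma sq_batta_checkConv_ge {a b : Measure EReal} (ha : IsLDist a) (hb : IsLDist b) :
    1 - (1 - batta a ^ 2) * (1 - batta b ^ 2) ≤ batta (checkConv a b) ^ 2 := by
  have := ha.prob
  have := hb.prob
  have hBa := ha.batta_mem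
  have hBb := hb.batta_mem
  have hBb2 : batta b ^ 2 ≤ 1 := pow_le_one₀ hBb.1 hBb.2
  have hβ : ∀ y : EReal, 0 ≤ 1 - toD y ^ 2 := fun y => by
    have := toD_mem y
    nlinarith [this.1, this.2]
  have h1 : ∀ y, Real.sqrt (batta b ^ 2 + (1 - batta b ^ 2) * Real.sqrt (1 - toD y ^ 2) ^ 2)
      ≤ ∫ z, Real.sqrt (1 - (toD y * toD z) ^ 2) ∂b := by
    intro y
    have h := sqrt_le_evalD b (hβ y) (sq_nonneg (toD y))
    rw [← hb.batta_eq] at h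
    rw [Real.sq_sqrt (hβ y)]
    refine le_trans (le_of_eq ?_) (h.trans (le_of_eq ?_))
    · congr 1; ring
    · unfold evalD
      congr 1
      ext z
      beta_reduce
      rw [Real.sq_sqrt (hβ z)]
      congr 1; ring
  have h2 := sqrt_le_evalD a (sq_nonneg (batta b)) (sub_nonneg.2 hBb2)
  rw [← ha.batta_eq] at h2
  have hi := integrable_kernel (continuousOn_checkK evenCont_sqrt) (a.prod b)
  have hev : EvenCont fun d =>
      Real.sqrt (batta b ^ 2 + (1 - batta b ^ 2) * Real.sqrt (1 - d ^ 2) ^ 2) :=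
    ⟨by fun_prop, fun d => by simp⟩
  have h3 := h2.trans (integral_mono (hev.integrable a) hi.integral_prod_left h1)
  have e : batta (checkConv a b) = ∫ y, ∫ z, Real.sqrt (1 - (toD y * toD z) ^ 2) ∂b ∂a := by
    rw [(ha.checkConv hb).batta_eq, evalD_checkConv evenCont_sqrt]
  rw [← e] at h3
  have h4 := Real.sqrt_le_iff.1 h3
  nlinarith [h4.2]

lemma sq_batta_checkPow_ge {a : Measure EReal} (ha : IsLDist a) (n : ℕ) :
    1 - (1 - batta a ^ 2) ^ n ≤ batta (checkPow a n) ^ 2 := by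
  induction n with
  | zero => simp; positivity
  | succ n ih =>
    have h := sq_batta_checkConv_ge (ha.checkPow n) ha
    have h1 : batta a ^ 2 ≤ 1 := pow_le_one₀ ha.batta_mem.1 ha.batta_mem.2
    rw [checkPow, pow_succ]
    nlinarith

/-- The variance of √(1-d²) is nonnegative. -/
lemma IsLDist.mom_zero_le {a : Measure EReal} (ha : IsLDist a) :
    mom a 0 ≤ 1 - batta a ^ 2 := by
  have := ha.prob
  have hβ : ∀ y : EReal, 0 ≤ 1 - toD y ^ 2 := fun y => by
    have := toD_mem y
    nlinarith [this.1, this.2]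
  have h : 0 ≤ ∫ y, (Real.sqrt (1 - toD y ^ 2) - batta a) ^ 2 ∂a :=
    integral_nonneg fun y => sq_nonneg _
  have e : ∀ y, (Real.sqrt (1 - toD y ^ 2) - batta a) ^ 2
      = (1 + batta a ^ 2) + -toD y ^ 2 - 2 * batta a * Real.sqrt (1 - toD y ^ 2) := fun y => by
    rw [sub_sq, Real.sq_sqrt (hβ y)]; ring
  have i1 : Integrable (fun y => -toD y ^ 2) a := ((evenCont_pow 1).integrable a).neg
  simp_rw [e] at h
  rw [integral_add_sub (integrable_const _) i1 ((evenCont_sqrt.integrable a).const_mul _),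
    integral_neg, integral_const_mul] at h
  have hb : ∫ y, Real.sqrt (1 - toD y ^ 2) ∂a = batta a := ha.batta_eq.symm
  have hm : ∫ y, toD y ^ 2 ∂a = mom a 0 := rfl
  rw [hb, hm] at h
  simp at h
  nlinarith

/-! ### Quantitative consequences of the convex order -/

lemma Better.batta_le {a b : Measure EReal} (ha : IsLDist a) (hb : IsLDist b) (h : Better a b) :
    batta a ≤ batta b := by
  have := hasSum_le (fun k => mul_le_mul_of_nonneg_left (h.mom_le k) (battaCoeff_pos k).le)
    hb.hasSum_batta ha.hasSum_batta
  linarith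

/-- Differences of moments are controlled by differences of a functional with an expansion. -/
lemma coeff_mul_mom_sub_le {q : ℕ → ℝ} (hq : ∀ k, 0 < q k) {a b : Measure EReal} {A B : ℝ}
    (h : Better a b) (hA : HasSum (fun k => q k * mom a k) (1 - A))
    (hB : HasSum (fun k => q k * mom b k) (1 - B)) (k : ℕ) :
    q k * (mom a k - mom b k) ≤ B - A := by
  have h1 := hA.sub hB
  have h2 := le_hasSum h1 k fun j _ => by
    rw [← mul_sub]
    exact mul_nonneg (hq j).le (sub_nonneg.2 (h.mom_le j))
  linarith

lemma pow_sub_pow_le_mul {x y : ℝ} (hy : 0 ≤ y) (hyx : y ≤ x) (n : ℕ) :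
    x ^ n - y ^ n ≤ n * x ^ (n - 1) * (x - y) := by
  induction n with
  | zero => simp
  | succ n ih =>
    have hx := hy.trans hyx
    have e : x ^ (n + 1) - y ^ (n + 1) = x ^ n * (x - y) + y * (x ^ n - y ^ n) := by ring
    rw [e]
    rcases n.eq_zero_or_pos with h | h
    · subst h; simp
    · have h1 : y * (x ^ n - y ^ n) ≤ x * (n * x ^ (n - 1) * (x - y)) :=
        mul_le_mul hyx ih (sub_nonneg.2 (pow_le_pow_left₀ hy hyx n)) hx
      have h2 : x * x ^ (n - 1) = x ^ n := by rw [← pow_succ', Nat.sub_add_cancel h]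
      rw [Nat.add_sub_cancel]
      push_cast
      calc _ ≤ x ^ n * (x - y) + x * (n * x ^ (n - 1) * (x - y)) := by linarith
        _ = x ^ n * (x - y) + n * (x * x ^ (n - 1)) * (x - y) := by ring
        _ = _ := by rw [h2]; ring

/-- The mean value bound is applied to each m_k^n; its derivative factor is uniform in k because
every m_k is at most m_0 ≤ 1 - 𝔅(a)². -/
lemma batta_checkPow_sub_le {a b : Measure EReal} (ha : IsLDist a) (hb : IsLDist b)
    (h : Better a b) (n : ℕ) :
    batta (checkPow b n) - batta (checkPow a n)
      ≤ n * (1 - batta a ^ 2) ^ (n - 1) * (batta b - batta a) := by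
  have := ha.prob
  have := hb.prob
  have h1 := (ha.checkPow n).hasSum_batta.sub (hb.checkPow n).hasSum_batta
  have h2 := (ha.hasSum_batta.sub hb.hasSum_batta).mul_left (n * (1 - batta a ^ 2) ^ (n - 1))
  have := hasSum_le (fun k => ?_) h1 h2
  · linarith
  · rw [mom_checkPow ha, mom_checkPow hb, ← mul_sub, ← mul_sub]
    have h3 := pow_sub_pow_le_mul (mom_mem b k).1 (h.mom_le k) n
    have h4 : mom a k ^ (n - 1) ≤ (1 - batta a ^ 2) ^ (n - 1) :=
      pow_le_pow_left₀ (mom_mem a k).1 ((mom_le_mom_zero a k).trans ha.mom_zero_le) _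
    have h5 : (n : ℝ) * mom a k ^ (n - 1) * (mom a k - mom b k)
        ≤ n * (1 - batta a ^ 2) ^ (n - 1) * (mom a k - mom b k) :=
      mul_le_mul_of_nonneg_right (mul_le_mul_of_nonneg_left h4 (Nat.cast_nonneg n))
        (sub_nonneg.2 (h.mom_le k))
    calc _ ≤ battaCoeff k * (n * (1 - batta a ^ 2) ^ (n - 1) * (mom a k - mom b k)) :=
          mul_le_mul_of_nonneg_left (h3.trans h5) (battaCoeff_pos k).le
      _ = _ := by ring

/-! ### The functions `a` and `b` -/

lemma aFun_mono (l r : ℕ) {x y : ℝ} (hx : 0 ≤ x) (hxy : x ≤ y) (hy : y ≤ 1) :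
    aFun l r x ≤ aFun l r y := by
  unfold aFun
  have h1 : (1 - y) ^ (r - 1) ≤ (1 - x) ^ (r - 1) :=
    pow_le_pow_left₀ (by linarith) (by linarith) _
  have h2 : (1 - x) ^ (r - 1) ≤ 1 := pow_le_one₀ (by linarith) (by linarith)
  exact pow_le_pow_left₀ (by linarith) (by linarith) _

lemma aFun_pos {l r : ℕ} (hr : 2 ≤ r) {x : ℝ} (hx : 0 < x) (hx1 : x ≤ 1) : 0 < aFun l r x := by
  unfold aFun
  have h2 : (1 - x) ^ (r - 1) < 1 := pow_lt_one₀ (by linarith) (by linarith) (by omega)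
  exact pow_pos (by linarith) _

/-- Beyond a solution of `a = b`, the function `b` is strictly below `a`. -/
lemma bFun_lt_aFun {l r : ℕ} (hl : 3 ≤ l) (hr : 3 ≤ r) {x y : ℝ} (hx : 0 < x) (hxy : x < y)
    (hy : y ≤ 1) (h : aFun l r x = bFun l r x) : bFun l r y < aFun l r y := by
  have hK : 0 < ((l : ℝ) - 1) ^ 2 * ((r : ℝ) - 1) ^ 2 := by
    have : (3 : ℝ) ≤ l := by exact_mod_cast hl
    have : (3 : ℝ) ≤ r := by exact_mod_cast hr
    have : 0 < (l : ℝ) - 1 := by linarith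
    have : 0 < (r : ℝ) - 1 := by linarith
    positivity
  set K := ((l : ℝ) - 1) ^ 2 * ((r : ℝ) - 1) ^ 2 with hKdef
  obtain ⟨l', rfl⟩ := Nat.exists_eq_add_of_le' hl
  obtain ⟨r', rfl⟩ := Nat.exists_eq_add_of_le' hr
  have ea : ∀ t : ℝ, aFun (l' + 3) (r' + 3) t = (1 - (1 - t) ^ (r' + 2)) ^ (l' + 2) := fun t => rfl
  have eb : ∀ t : ℝ, bFun (l' + 3) (r' + 3) t = K * t * (1 - t) ^ (2 * (r' + 1)) := fun t => by
    simp only [bFun, hKdef]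
    congr 3
  -- At y = 1 the function b vanishes while a equals 1; below 1 the powers of 1-y are positive.
  rcases hy.eq_or_lt with rfl | hy1
  · rw [eb, ea]; simp
  -- With u(t) = 1 - (1-t)^{r-1} = t S(t), the ratio a/b is u^{l-3} · t · (S(t)/(1-t)^{r-2})² / K:
  -- every nonconstant factor increases, the last one strictly. Here l - 3 and r - 3 are `l'` and
  -- `r'`.
  set S : ℝ → ℝ := fun t => ∑ j ∈ Finset.range (r' + 2), (1 - t) ^ j with hS
  have hu : ∀ t, 1 - (1 - t) ^ (r' + 2) = t * S t := fun t => by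
    have := geom_sum_mul (1 - t) (r' + 2)
    simp only [hS]
    linear_combination this
  -- comparison of the partial sums, relative to the last power
  have hcmp : S x * (1 - y) ^ (r' + 1) < S y * (1 - x) ^ (r' + 1) := by
    simp only [hS, Finset.sum_mul]
    apply Finset.sum_lt_sum
    · intro j hj
      have hj' : j ≤ r' + 1 := by have := Finset.mem_range.1 hj; omega
      obtain ⟨i, hi⟩ := Nat.exists_eq_add_of_le hj'
      have e1 : (1 - x) ^ j * (1 - y) ^ (r' + 1) = ((1 - x) * (1 - y)) ^ j * (1 - y) ^ i := by
        rw [hi, pow_add, mul_pow]; ring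
      have e2 : (1 - y) ^ j * (1 - x) ^ (r' + 1) = ((1 - x) * (1 - y)) ^ j * (1 - x) ^ i := by
        rw [hi, pow_add, mul_pow]; ring
      rw [e1, e2]
      exact mul_le_mul_of_nonneg_left (pow_le_pow_left₀ (by linarith) (by linarith) _)
        (pow_nonneg (mul_nonneg (by linarith) (by linarith)) _)
    · refine ⟨0, by simp, ?_⟩
      simp only [pow_zero, one_mul]
      exact pow_lt_pow_left₀ (by linarith) (by linarith) (by omega)
  have hSx : 0 < S x := Finset.sum_pos (fun j _ => pow_pos (by linarith) _) (by simp)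
  have hSy : 0 < S y := Finset.sum_pos (fun j _ => pow_pos (by linarith) _) (by simp)
  have px : 0 < (1 - x) ^ (r' + 1) := pow_pos (by linarith) _
  have py : 0 < (1 - y) ^ (r' + 1) := pow_pos (by linarith) _
  -- `a(t) = u(t)^l' (t S(t))²`
  have ha : ∀ t, aFun (l' + 3) (r' + 3) t = (t * S t) ^ l' * (t * S t) ^ 2 := fun t => by
    rw [ea, hu, pow_add]
  have hum : x * S x ≤ y * S y := by
    rw [← hu, ← hu]
    have := pow_le_pow_left₀ (by linarith : 0 ≤ 1 - y) (by linarith : 1 - y ≤ 1 - x) (r' + 2)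
    linarith
  have h1 : (x * S x) ^ l' ≤ (y * S y) ^ l' := pow_le_pow_left₀ (by positivity) hum _
  have h2 : (S x * (1 - y) ^ (r' + 1)) ^ 2 < (S y * (1 - x) ^ (r' + 1)) ^ 2 :=
    pow_lt_pow_left₀ hcmp (by positivity) two_ne_zero
  have hxE : K * x * (1 - x) ^ (2 * (r' + 1)) = (x * S x) ^ l' * (x * S x) ^ 2 := by
    rw [← ha, ← eb, h]
  rw [eb, ha]
  have hq : ∀ t : ℝ, (1 - t) ^ (2 * (r' + 1)) = ((1 - t) ^ (r' + 1)) ^ 2 := fun t => by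
    rw [← pow_mul, mul_comm]
  rw [hq] at hxE ⊢
  have key : (K * y * ((1 - y) ^ (r' + 1)) ^ 2) * (x * ((1 - x) ^ (r' + 1)) ^ 2)
      < ((y * S y) ^ l' * (y * S y) ^ 2) * (x * ((1 - x) ^ (r' + 1)) ^ 2) := by
    calc _ = y * x * ((x * S x) ^ l' * x) * (S x * (1 - y) ^ (r' + 1)) ^ 2 := by
          linear_combination (y * ((1 - y) ^ (r' + 1)) ^ 2) * hxE
      _ < y * x * ((x * S x) ^ l' * x) * (S y * (1 - x) ^ (r' + 1)) ^ 2 := by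
          have hy0 : 0 < y := hx.trans hxy
          exact mul_lt_mul_of_pos_left h2 (by positivity)
      _ ≤ y * x * ((y * S y) ^ l' * y) * (S y * (1 - x) ^ (r' + 1)) ^ 2 := by
          have hy0 : 0 < y := hx.trans hxy
          gcongr
      _ = _ := by ring
  exact lt_of_mul_lt_mul_right key (by positivity)

/-! ### Bhattacharyya parameters of forward fixed points -/

section fixedPoint

variable {l r : ℕ} {c x : Measure EReal}

lemma IsForwardFP.isLDist_node (h : IsForwardFP l r c x) : IsLDist (checkPow x (r - 1)) :=
  h.1.checkPow _

lemma IsForwardFP.batta_eq (hc : IsLDist c) (h : IsForwardFP l r c x) :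
    batta x = batta c * batta (checkPow x (r - 1)) ^ (l - 1) := by
  have hy := h.isLDist_node
  rw [← hy.batta_varPow, ← hc.batta_varConv (hy.varPow _)]
  exact batta_congr h.1 (hc.varConv (hy.varPow _)) fun f hf => h.evalD_eq hc hf

lemma sq_batta_step {y : Measure EReal} (hc : IsLDist c) (hy : IsLDist y) :
    batta c ^ 2 * aFun l r (batta y ^ 2)
      ≤ batta (varConv c (varPow (checkPow y (r - 1)) (l - 1))) ^ 2 := by
  have hy' := hy.checkPow (r - 1)
  rw [hc.batta_varConv (hy'.varPow _), hy'.batta_varPow, mul_pow, ← pow_mul, mul_comm (l - 1) 2,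
    pow_mul]
  refine mul_le_mul_of_nonneg_left ?_ (sq_nonneg _)
  have h1 : batta y ^ 2 ≤ 1 := pow_le_one₀ hy.batta_mem.1 hy.batta_mem.2
  have h2 : (1 - batta y ^ 2) ^ (r - 1) ≤ 1 :=
    pow_le_one₀ (by linarith) (by linarith [sq_nonneg (batta y)])
  exact pow_le_pow_left₀ (by linarith) (sq_batta_checkPow_ge hy _) _

/-- A subsolution X of the scalar recursion X ↦ 𝔅(c)² a(X) stays below 𝔅² of every iterate, since
the iteration starts at 𝔅 = 1 and a is increasing; the bound survives in the limit. -/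
lemma IsForwardFP.sq_batta_ge (hc : IsLDist c) (h : IsForwardFP l r c x) {X : ℝ} (hX0 : 0 ≤ X)
    (hX1 : X ≤ 1) (hX : X ≤ batta c ^ 2 * aFun l r X) : X ≤ batta x ^ 2 := by
  have hD : ∀ n, X ≤ batta (forwardDE l r c n) ^ 2 := by
    intro n
    induction n with
    | zero =>
      have : batta (forwardDE l r c 0) = 1 := batta_dirac_zero
      rw [this]; linarith
    | succ n ih =>
      have hn := hc.forwardDE l r n
      refine hX.trans (le_trans ?_ (sq_batta_step (l := l) (r := r) hc hn))
      exact mul_le_mul_of_nonneg_left (aFun_mono l r hX0 ih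
        (pow_le_one₀ hn.batta_mem.1 hn.batta_mem.2)) (sq_nonneg _)
  have hlim := h.2.weakConv _ evenCont_sqrt
  simp_rw [← (hc.forwardDE l r _).batta_eq] at hlim
  rw [← h.1.batta_eq] at hlim
  exact ge_of_tendsto' (hlim.pow 2) hD

lemma IsForwardFP.sq_batta_mul_aFun_le (hc : IsLDist c) (h : IsForwardFP l r c x) :
    batta c ^ 2 * aFun l r (batta x ^ 2) ≤ batta x ^ 2 := by
  have := sq_batta_step (l := l) (r := r) hc h.1
  rwa [← batta_congr h.1 (hc.varConv (h.isLDist_node.varPow _)) fun f hf => h.evalD_eq hc hf]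
    at this

/-- Comparison of the Bhattacharyya parameters of two fixed points. -/
lemma batta_sub_le {c' x' : Measure EReal} (hc : IsLDist c) (hc' : IsLDist c')
    (h : IsForwardFP l r c x) (h' : IsForwardFP l r c' x') (hcc : Better c c') {θ : ℝ}
    (hl : 1 ≤ l) (hr : 2 ≤ r) (hx : 0 < batta x)
    (hθ : (bFun l r (batta x ^ 2) / aFun l r (batta x ^ 2)) *
      (batta (checkPow x' (r - 1)) ^ (l - 2)) ^ 2 ≤ θ ^ 2) (hθ0 : 0 ≤ θ) :
    (1 - θ) * (batta x' - batta x) ≤ batta c' - batta c := by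
  have hxx := h.better hc hc' h' hcc
  have hBc := hc.batta_mem
  have hBc' := hc'.batta_mem
  have hBx := h.1.batta_mem
  have hy := h.isLDist_node
  have hy' := h'.isLDist_node
  have hBy := hy.batta_mem
  have hBy' := hy'.batta_mem
  have e1 := h.batta_eq hc
  have e2 := h'.batta_eq hc'
  have hyy : batta (checkPow x (r - 1)) ≤ batta (checkPow x' (r - 1)) :=
    (hxx.checkPow h.1 h'.1 _).batta_le hy hy'
  have hcc' : batta c ≤ batta c' := hcc.batta_le hc hc'
  have hx' : batta x ≤ batta x' := hxx.batta_le h.1 h'.1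
  have h1 := batta_checkPow_sub_le h.1 h'.1 hxx (r - 1)
  have h2 := pow_sub_pow_le_mul hBy.1 hyy (l - 1)
  set X := batta x ^ 2 with hX
  have hX1 : X ≤ 1 := pow_le_one₀ hBx.1 hBx.2
  have hX0 : 0 < X := by positivity
  have ha : 0 < aFun l r X := aFun_pos hr hX0 hX1
  have hfp := h.sq_batta_mul_aFun_le hc
  rw [← hX] at hfp
  set y' := batta (checkPow x' (r - 1))
  set y := batta (checkPow x (r - 1))
  have hlr : ((l - 1 : ℕ) : ℝ) = l - 1 := by push_cast [Nat.cast_sub hl]; ring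
  have hrr : ((r - 1 : ℕ) : ℝ) = r - 1 := by
    rw [Nat.cast_sub (by omega)]; push_cast; ring
  rw [hlr, show l - 1 - 1 = l - 2 by omega] at h2
  rw [hrr, show r - 1 - 1 = r - 2 by omega] at h1
  have hl0 : 0 ≤ (l : ℝ) - 1 := by
    have : (1 : ℝ) ≤ l := by exact_mod_cast hl
    linarith
  have hr0 : 0 ≤ (r : ℝ) - 1 := by
    have : (2 : ℝ) ≤ r := by exact_mod_cast hr
    linarith
  -- The factor by which an increment of 𝔅(x) returns to itself through check node and variable
  -- node.
  set φ := batta c * ((l - 1) * y' ^ (l - 2) * ((r - 1) * (1 - X) ^ (r - 2))) with hφ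
  have h1X : 0 ≤ (1 - X) ^ (r - 2) := pow_nonneg (by linarith) _
  have hφ0 : 0 ≤ φ := mul_nonneg hBc.1 (mul_nonneg (mul_nonneg hl0 (pow_nonneg hBy'.1 _))
    (mul_nonneg hr0 h1X))
  -- In φ², the inequality 𝔅(c)² a(X) ≤ X replaces 𝔅(c)² by X/a(X), which creates b(X)/a(X).
  have hφθ : φ ≤ θ := by
    refine le_of_sq_le_sq ?_ hθ0
    refine le_trans ?_ hθ
    have e : φ ^ 2 = batta c ^ 2 * (((l : ℝ) - 1) ^ 2 * ((r : ℝ) - 1) ^ 2 * (1 - X) ^ (2 * (r - 2)))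
        * (y' ^ (l - 2)) ^ 2 := by
      rw [hφ, mul_comm 2 (r - 2), pow_mul]; ring
    rw [e]
    refine mul_le_mul_of_nonneg_right ?_ (sq_nonneg _)
    rw [le_div_iff₀ ha]
    have hQ : 0 ≤ ((l : ℝ) - 1) ^ 2 * ((r : ℝ) - 1) ^ 2 * (1 - X) ^ (2 * (r - 2)) := by
      have : 0 ≤ (1 - X) ^ (2 * (r - 2)) := pow_nonneg (by linarith) _
      positivity
    calc _ = (batta c ^ 2 * aFun l r X) *
          (((l : ℝ) - 1) ^ 2 * ((r : ℝ) - 1) ^ 2 * (1 - X) ^ (2 * (r - 2))) := by ring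
      _ ≤ X * (((l : ℝ) - 1) ^ 2 * ((r : ℝ) - 1) ^ 2 * (1 - X) ^ (2 * (r - 2))) :=
          mul_le_mul_of_nonneg_right hfp hQ
      _ = _ := by unfold bFun; ring
  have h3 : batta c * (y' ^ (l - 1) - y ^ (l - 1)) ≤ φ * (batta x' - batta x) := by
    calc _ ≤ batta c * (((l : ℝ) - 1) * y' ^ (l - 2) * (y' - y)) :=
          mul_le_mul_of_nonneg_left h2 hBc.1
      _ ≤ batta c * (((l : ℝ) - 1) * y' ^ (l - 2) *
          (((r : ℝ) - 1) * (1 - X) ^ (r - 2) * (batta x' - batta x))) :=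
          mul_le_mul_of_nonneg_left (mul_le_mul_of_nonneg_left h1
            (mul_nonneg hl0 (pow_nonneg hBy'.1 _))) hBc.1
      _ = _ := by rw [hφ]; ring
  have h4 : (batta c' - batta c) * y' ^ (l - 1) ≤ batta c' - batta c :=
    mul_le_of_le_one_right (sub_nonneg.2 hcc') (pow_le_one₀ hBy'.1 hBy'.2)
  have h5 : φ * (batta x' - batta x) ≤ θ * (batta x' - batta x) :=
    mul_le_mul_of_nonneg_right hφθ (sub_nonneg.2 hx')
  -- The increment splits as 𝔅(x') - 𝔅(x) = (𝔅(c') - 𝔅(c)) y'^{l-1} + 𝔅(c)(y'^{l-1} - y^{l-1}).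
  nlinarith

end fixedPoint

/-! ### Continuity along the family -/

lemma continuousOn_of_abs_sub_le {s : Set ℝ} {f g : ℝ → ℝ} {K : ℝ} (hg : ContinuousOn g s)
    (h : ∀ x ∈ s, ∀ y ∈ s, x ≤ y → |f y - f x| ≤ K * |g y - g x|) : ContinuousOn f s := by
  have h' : ∀ x ∈ s, ∀ y ∈ s, |f y - f x| ≤ K * |g y - g x| := by
    intro x hx y hy
    rcases le_total x y with hxy | hxy
    · exact h x hx y hy hxy
    · rw [abs_sub_comm, abs_sub_comm (g y)]
      exact h y hy x hx hxy
  intro x hx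
  rw [ContinuousWithinAt, tendsto_iff_norm_sub_tendsto_zero]
  have hgx := tendsto_iff_norm_sub_tendsto_zero.1 (hg x hx)
  refine squeeze_zero' (Eventually.of_forall fun _ => norm_nonneg _)
    (eventually_nhdsWithin_of_forall fun y hy => h' x hx y hy) ?_
  simpa using hgx.const_mul K

section family

variable {l r : ℕ} {c x : ℝ → Measure EReal}

/-- A family ordered in the convex order. -/
lemma OrderedFamily.better (hc : ∀ h ∈ Icc (0 : ℝ) 1, IsLDist (c h)) (hord : OrderedFamily c)
    {h h' : ℝ} (hh : h ∈ Icc (0 : ℝ) 1) (hh' : h' ∈ Icc (0 : ℝ) 1) (hle : h ≤ h') :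
    Better (c h) (c h') :=
  (hord h hh h' hh' hle).better (hc h hh) (hc h' hh')

/-- All terms of the entropy expansion move in the same direction along an ordered family, so each
moment is Lipschitz in the entropy, which is the parameter. -/
lemma continuousOn_mom_family (hc : ∀ h ∈ Icc (0 : ℝ) 1, IsLDist (c h)) (hord : OrderedFamily c)
    (hcomp : CompleteEntropyFamily c) (k : ℕ) : ContinuousOn (fun h => mom (c h) k) (Icc 0 1) := by
  have hq := isMomentSeries_etaD.pos
  refine continuousOn_of_abs_sub_le (K := 1 / entropyCoeff k) continuousOn_id ?_
  intro h hh h' hh' hle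
  have hb := hord.better hc hh hh' hle
  have := coeff_mul_mom_sub_le hq hb (hc h hh).hasSum_entropy (hc h' hh').hasSum_entropy k
  rw [hcomp h hh, hcomp h' hh'] at this
  rw [abs_sub_comm, abs_of_nonneg (sub_nonneg.2 (hb.mom_le k)), id, id,
    abs_of_nonneg (sub_nonneg.2 hle), div_mul_eq_mul_div, one_mul, le_div_iff₀ (hq k), mul_comm]
  exact this

lemma continuousOn_tsum_coeff_mul {q : ℕ → ℝ} (hq : ∀ k, 0 < q k) (hs : Summable q)
    {f : ℕ → ℝ → ℝ} {s : Set ℝ} (hf : ∀ k, ContinuousOn (f k) s)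
    (hf1 : ∀ k, ∀ h ∈ s, f k h ∈ Icc (0 : ℝ) 1) : ContinuousOn (fun h => ∑' k, q k * f k h) s := by
  refine continuousOn_tsum (fun k => continuousOn_const.mul (hf k)) hs fun k h hh => ?_
  have := hf1 k h hh
  rw [Real.norm_eq_abs, abs_of_nonneg (mul_nonneg (hq k).le this.1)]
  exact mul_le_of_le_one_right (hq k).le this.2

lemma continuousOn_batta_family (hc : ∀ h ∈ Icc (0 : ℝ) 1, IsLDist (c h)) (hord : OrderedFamily c)
    (hcomp : CompleteEntropyFamily c) : ContinuousOn (fun h => batta (c h)) (Icc 0 1) := by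
  have h1 := continuousOn_tsum_coeff_mul battaCoeff_pos isMomentSeries_sqrt.summable
    (continuousOn_mom_family hc hord hcomp) fun k h hh => by
      have := (hc h hh).prob
      exact mom_mem _ k
  refine ((continuousOn_const (c := (1 : ℝ))).sub h1).congr fun h hh => ?_
  have := (hc h hh).hasSum_batta.tsum_eq
  change batta (c h) = 1 - ∑' k, battaCoeff k * mom (c h) k
  rw [this]
  ring

/-- Equality of 𝔅 for ordered distributions would force all moments, hence the entropies, to
coincide. -/
lemma batta_lt_of_entropy_lt {a b : Measure EReal} (ha : IsLDist a) (hb : IsLDist b)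
    (h : Better a b) (hlt : entropy a < entropy b) : batta a < batta b := by
  by_contra hle
  push Not at hle
  have hm : ∀ k, mom a k = mom b k := by
    intro k
    have h1 := coeff_mul_mom_sub_le battaCoeff_pos h ha.hasSum_batta hb.hasSum_batta k
    have h2 := battaCoeff_pos k
    have h3 := h.mom_le k
    nlinarith
  have h1 := ha.hasSum_entropy
  simp only [hm] at h1
  have := h1.unique hb.hasSum_entropy
  linarith

lemma batta_family_lt (hc : ∀ h ∈ Icc (0 : ℝ) 1, IsLDist (c h)) (hord : OrderedFamily c)
    (hcomp : CompleteEntropyFamily c) {h h' : ℝ} (hh : h ∈ Icc (0 : ℝ) 1)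
    (hh' : h' ∈ Icc (0 : ℝ) 1) (hlt : h < h') : batta (c h) < batta (c h') :=
  batta_lt_of_entropy_lt (hc h hh) (hc h' hh') (hord.better hc hh hh' hlt.le)
    (by rwa [hcomp h hh, hcomp h' hh'])

lemma batta_checkPow_lt_one {a : Measure EReal} (ha : IsLDist a) (h : batta a < 1) (n : ℕ) :
    batta (checkPow a n) < 1 := by
  have hex : ∃ k, 0 < mom a k := by
    by_contra hno
    push Not at hno
    have := ha.prob
    have h0 : ∀ k, mom a k = 0 := fun k => le_antisymm (hno k) (mom_mem a k).1
    have h1 := ha.hasSum_batta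
    simp only [h0, mul_zero] at h1
    have := h1.unique hasSum_zero
    linarith
  obtain ⟨k, hk⟩ := hex
  have hy := ha.checkPow n
  have := hy.prob
  have h1 := le_hasSum hy.hasSum_batta k fun j _ =>
    mul_nonneg (battaCoeff_pos j).le (mom_mem _ j).1
  rw [mom_checkPow ha] at h1
  have := mul_pos (battaCoeff_pos k) (pow_pos hk n)
  linarith

lemma IsForwardFP.batta_lt_one {l r : ℕ} {c x : Measure EReal} (hc : IsLDist c)
    (h : IsForwardFP l r c x) (hlt : batta c < 1) : batta x < 1 := by
  rw [h.batta_eq hc]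
  have hy := h.isLDist_node.batta_mem
  calc _ ≤ batta c * 1 := mul_le_mul_of_nonneg_left (pow_le_one₀ hy.1 hy.2) hc.batta_mem.1
    _ < 1 := by rwa [mul_one]

/-- The contraction factor of `batta_sub_le` may degenerate at both ends: b/a can reach 1 at h̃, and
𝔅(y) can reach 1 at h = 1. Below the midpoint 𝔅(y) is bounded away from 1; above it b/a is. The two
estimates are then chained. -/
lemma exists_batta_sub_le (hl : 3 ≤ l) (hr : 3 ≤ r)
    (hc : ∀ h ∈ Icc (0 : ℝ) 1, IsLDist (c h)) (hord : OrderedFamily c)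
    (hcomp : CompleteEntropyFamily c) (hx : ∀ h ∈ Icc (0 : ℝ) 1, IsForwardFP l r (c h) (x h))
    {ht : ℝ} (htilde : IsTildeEntropy l r c ht) (hlt : ht < 1) :
    ∃ K, ∀ h ∈ Icc ht 1, ∀ h' ∈ Icc ht 1, h ≤ h' →
      batta (x h') - batta (x h) ≤ K * (batta (c h') - batta (c h)) := by
  obtain ⟨ht01, xt, hxt, hab, hB⟩ := htilde
  have hmem : ∀ h ∈ Icc ht 1, h ∈ Icc (0 : ℝ) 1 := fun h hh => ⟨ht01.1.trans hh.1, hh.2⟩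
  have hbet : ∀ h ∈ Icc ht 1, ∀ h' ∈ Icc ht 1, h ≤ h' → Better (c h) (c h') :=
    fun h hh h' hh' hle => hord.better hc (hmem h hh) (hmem h' hh') hle
  have hBle : ∀ h ∈ Icc ht 1, ∀ h' ∈ Icc ht 1, h ≤ h' → batta (c h) ≤ batta (c h') :=
    fun h hh h' hh' hle =>
      (hbet h hh h' hh' hle).batta_le (hc h (hmem h hh)) (hc h' (hmem h' hh'))
  have htm : ht ∈ Icc ht 1 := ⟨le_rfl, hlt.le⟩
  have hax : 0 < aFun l r xt := aFun_pos (by omega) hxt.1 hxt.2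
  have hB2 : batta (c ht) ^ 2 = xt / aFun l r xt := by
    rw [hB, cFun, Real.sq_sqrt (div_nonneg hxt.1.le hax.le)]
  -- lower bound on the Bhattacharyya parameter of the fixed points
  have hX : ∀ h ∈ Icc ht 1, xt ≤ batta (x h) ^ 2 := by
    intro h hh
    refine (hx h (hmem h hh)).sq_batta_ge (hc h (hmem h hh)) hxt.1.le hxt.2 ?_
    have h1 : batta (c ht) ^ 2 ≤ batta (c h) ^ 2 :=
      pow_le_pow_left₀ (hc ht ht01).batta_mem.1 (hBle ht htm h hh hh.1) 2
    calc xt = batta (c ht) ^ 2 * aFun l r xt := by rw [hB2]; field_simp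
      _ ≤ _ := mul_le_mul_of_nonneg_right h1 hax.le
  have hX1 : ∀ h ∈ Icc ht 1, batta (x h) ^ 2 ≤ 1 := fun h hh =>
    pow_le_one₀ (hx h (hmem h hh)).1.batta_mem.1 (hx h (hmem h hh)).1.batta_mem.2
  have hXpos : ∀ h ∈ Icc ht 1, 0 < batta (x h) := fun h hh => by
    have h1 := hX h hh
    have h2 := (hx h (hmem h hh)).1.batta_mem.1
    rcases h2.eq_or_lt with h3 | h3
    · rw [← h3] at h1; linarith [hxt.1]
    · exact h3
  -- Equality X = x̃ would give 𝔅(c_h)² ≤ x̃/a(x̃) = 𝔅(c_{h̃})², against strict monotonicity of 𝔅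
  -- along the family.
  have hXlt : ∀ h ∈ Icc ht 1, ht < h → xt < batta (x h) ^ 2 := by
    intro h hh hlt'
    refine lt_of_le_of_ne (hX h hh) fun heq => ?_
    have h1 := (hx h (hmem h hh)).sq_batta_mul_aFun_le (hc h (hmem h hh))
    rw [← heq, ← le_div_iff₀ hax, ← hB2] at h1
    have h2 := batta_family_lt hc hord hcomp ht01 (hmem h hh) hlt'
    have h3 := pow_lt_pow_left₀ h2 (hc ht ht01).batta_mem.1 two_ne_zero
    linarith
  have hratio : ∀ h ∈ Icc ht 1, bFun l r (batta (x h) ^ 2) ≤ aFun l r (batta (x h) ^ 2) := by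
    intro h hh
    rcases (hX h hh).eq_or_lt with heq | hlt'
    · rw [← heq, hab]
    · exact (bFun_lt_aFun hl hr hxt.1 hlt' (hX1 h hh) hab).le
  have hapos : ∀ h ∈ Icc ht 1, 0 < aFun l r (batta (x h) ^ 2) := fun h hh =>
    aFun_pos (by omega) (by have := hXpos h hh; positivity) (hX1 h hh)
  set hm := (ht + 1) / 2 with hhm
  have hmI : hm ∈ Icc ht 1 := ⟨by linarith, by linarith⟩
  have hyL : ∀ h ∈ Icc ht 1, IsLDist (checkPow (x h) (r - 1)) := fun h hh =>
    (hx h (hmem h hh)).isLDist_node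
  -- the part below the midpoint
  set θ₁ := batta (checkPow (x hm) (r - 1)) ^ (l - 2) with hθ₁
  have hone : (1 : ℝ) ∈ Icc (0 : ℝ) 1 := by simp
  have hcm : batta (c hm) < 1 :=
    (batta_family_lt hc hord hcomp (hmem hm hmI) hone (by linarith)).trans_le
      (hc 1 hone).batta_mem.2
  have hθ₁lt : θ₁ < 1 := pow_lt_one₀ (hyL hm hmI).batta_mem.1
    (batta_checkPow_lt_one (hx hm (hmem hm hmI)).1
      ((hx hm (hmem hm hmI)).batta_lt_one (hc hm (hmem hm hmI)) hcm) _) (by omega)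
  have hθ₁0 : 0 ≤ θ₁ := pow_nonneg (hyL hm hmI).batta_mem.1 _
  have part1 : ∀ h ∈ Icc ht 1, ∀ h' ∈ Icc ht 1, h ≤ h' → h' ≤ hm →
      (1 - θ₁) * (batta (x h') - batta (x h)) ≤ batta (c h') - batta (c h) := by
    intro h hh h' hh' hle hle'
    refine batta_sub_le (hc h (hmem h hh)) (hc h' (hmem h' hh')) (hx h (hmem h hh))
      (hx h' (hmem h' hh')) (hbet h hh h' hh' hle) (by omega) (by omega) (hXpos h hh) ?_ hθ₁0
    have h1 : batta (checkPow (x h') (r - 1)) ≤ batta (checkPow (x hm) (r - 1)) :=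
      (((hx h' (hmem h' hh')).better (hc h' (hmem h' hh')) (hc hm (hmem hm hmI))
        (hx hm (hmem hm hmI)) (hbet h' hh' hm hmI hle')).checkPow (hx h' (hmem h' hh')).1
        (hx hm (hmem hm hmI)).1 _).batta_le (hyL h' hh') (hyL hm hmI)
    have h2 : (batta (checkPow (x h') (r - 1)) ^ (l - 2)) ^ 2 ≤ θ₁ ^ 2 :=
      pow_le_pow_left₀ (pow_nonneg (hyL h' hh').batta_mem.1 _)
        (pow_le_pow_left₀ (hyL h' hh').batta_mem.1 h1 _) 2
    have h3 : bFun l r (batta (x h) ^ 2) / aFun l r (batta (x h) ^ 2) ≤ 1 :=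
      (div_le_one (hapos h hh)).2 (hratio h hh)
    calc _ ≤ 1 * (batta (checkPow (x h') (r - 1)) ^ (l - 2)) ^ 2 :=
          mul_le_mul_of_nonneg_right h3 (sq_nonneg _)
      _ ≤ θ₁ ^ 2 := by rwa [one_mul]
  -- the part above the midpoint
  have hXm := hXlt hm hmI (by linarith)
  have hcont : ContinuousOn (fun t => bFun l r t / aFun l r t) (Icc (batta (x hm) ^ 2) 1) := by
    refine ContinuousOn.div ?_ ?_ fun t ht' =>
      (aFun_pos (by omega) (by linarith [ht'.1, hxt.1]) ht'.2).ne'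
    · unfold bFun; fun_prop
    · unfold aFun; fun_prop
  -- Compactness turns the pointwise inequality b < a beyond x̃ into one uniform ratio below 1.
  obtain ⟨t₀, ht₀, hmax⟩ := isCompact_Icc.exists_isMaxOn ⟨1, hX1 hm hmI, le_rfl⟩ hcont
  set ρ := bFun l r t₀ / aFun l r t₀ with hρ
  have ha0 : 0 < aFun l r t₀ := aFun_pos (by omega) (by linarith [ht₀.1, hxt.1]) ht₀.2
  have hρlt : ρ < 1 :=
    (div_lt_one ha0).2 (bFun_lt_aFun hl hr hxt.1 (hXm.trans_le ht₀.1) ht₀.2 hab)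
  have hρ0 : 0 ≤ ρ := by
    refine div_nonneg ?_ ha0.le
    have : 0 ≤ t₀ := by linarith [ht₀.1, hxt.1]
    have h1 : 0 ≤ (1 - t₀) ^ (2 * (r - 2)) := pow_nonneg (by linarith [ht₀.2]) _
    unfold bFun
    positivity
  have hs1 : Real.sqrt ρ < 1 := by rw [Real.sqrt_lt' one_pos]; simpa using hρlt
  have part2 : ∀ h ∈ Icc ht 1, ∀ h' ∈ Icc ht 1, h ≤ h' → hm ≤ h →
      (1 - Real.sqrt ρ) * (batta (x h') - batta (x h)) ≤ batta (c h') - batta (c h) := by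
    intro h hh h' hh' hle hle'
    refine batta_sub_le (hc h (hmem h hh)) (hc h' (hmem h' hh')) (hx h (hmem h hh))
      (hx h' (hmem h' hh')) (hbet h hh h' hh' hle) (by omega) (by omega) (hXpos h hh) ?_
      (Real.sqrt_nonneg _)
    rw [Real.sq_sqrt hρ0]
    have h1 : batta (x hm) ≤ batta (x h) :=
      ((hx hm (hmem hm hmI)).better (hc hm (hmem hm hmI)) (hc h (hmem h hh))
        (hx h (hmem h hh)) (hbet hm hmI h hh hle')).batta_le (hx hm (hmem hm hmI)).1
        (hx h (hmem h hh)).1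
    have h2 : bFun l r (batta (x h) ^ 2) / aFun l r (batta (x h) ^ 2) ≤ ρ :=
      hmax ⟨pow_le_pow_left₀ (hXpos hm hmI).le h1 2, hX1 h hh⟩
    have h3 := (hyL h' hh').batta_mem
    have h4 : (batta (checkPow (x h') (r - 1)) ^ (l - 2)) ^ 2 ≤ 1 :=
      pow_le_one₀ (pow_nonneg h3.1 _) (pow_le_one₀ h3.1 h3.2)
    calc _ ≤ ρ * (batta (checkPow (x h') (r - 1)) ^ (l - 2)) ^ 2 :=
          mul_le_mul_of_nonneg_right h2 (sq_nonneg _)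
      _ ≤ ρ := mul_le_of_le_one_right hρ0 h4
  set K := max (1 / (1 - θ₁)) (1 / (1 - Real.sqrt ρ)) with hK
  have fin : ∀ {θ u v : ℝ}, θ < 1 → 1 / (1 - θ) ≤ K → 0 ≤ v → (1 - θ) * u ≤ v → u ≤ K * v := by
    intro θ u v hθ hθK hv huv
    have h1 : 0 < 1 - θ := by linarith
    have h2 : u ≤ 1 / (1 - θ) * v := by
      rw [div_mul_eq_mul_div, one_mul, le_div_iff₀ h1, mul_comm]
      exact huv
    exact h2.trans (mul_le_mul_of_nonneg_right hθK hv)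
  have p1 : ∀ h ∈ Icc ht 1, ∀ h' ∈ Icc ht 1, h ≤ h' → h' ≤ hm →
      batta (x h') - batta (x h) ≤ K * (batta (c h') - batta (c h)) := fun h hh h' hh' hle hle' =>
    fin hθ₁lt (le_max_left _ _) (sub_nonneg.2 (hBle h hh h' hh' hle)) (part1 h hh h' hh' hle hle')
  have p2 : ∀ h ∈ Icc ht 1, ∀ h' ∈ Icc ht 1, h ≤ h' → hm ≤ h →
      batta (x h') - batta (x h) ≤ K * (batta (c h') - batta (c h)) := fun h hh h' hh' hle hle' =>
    fin hs1 (le_max_right _ _) (sub_nonneg.2 (hBle h hh h' hh' hle)) (part2 h hh h' hh' hle hle')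
  refine ⟨K, fun h hh h' hh' hle => ?_⟩
  rcases le_total h' hm with h1 | h1
  · exact p1 h hh h' hh' hle h1
  · rcases le_total hm h with h2 | h2
    · exact p2 h hh h' hh' hle h2
    · have := p1 h hh hm hmI h2 le_rfl
      have := p2 hm hmI h' hh' h1 le_rfl
      linarith

lemma continuousOn_mom_fixedPoint (hl : 3 ≤ l) (hr : 3 ≤ r)
    (hc : ∀ h ∈ Icc (0 : ℝ) 1, IsLDist (c h)) (hord : OrderedFamily c)
    (hcomp : CompleteEntropyFamily c) (hx : ∀ h ∈ Icc (0 : ℝ) 1, IsForwardFP l r (c h) (x h))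
    {ht : ℝ} (htilde : IsTildeEntropy l r c ht) (k : ℕ) :
    ContinuousOn (fun h => mom (x h) k) (Icc ht 1) := by
  have ht01 := htilde.1
  rcases ht01.2.eq_or_lt with heq | hlt
  · rw [heq, Icc_self]
    exact continuousOn_singleton _ _
  obtain ⟨K, hK⟩ := exists_batta_sub_le hl hr hc hord hcomp hx htilde hlt
  have hsub : Icc ht 1 ⊆ Icc (0 : ℝ) 1 := Icc_subset_Icc_left ht01.1
  refine continuousOn_of_abs_sub_le (K := K / battaCoeff k)
    ((continuousOn_batta_family hc hord hcomp).mono hsub) ?_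
  intro h hh h' hh' hle
  have hb := hord.better hc (hsub hh) (hsub hh') hle
  have hxx := (hx h (hsub hh)).better (hc h (hsub hh)) (hc h' (hsub hh')) (hx h' (hsub hh')) hb
  have h1 := coeff_mul_mom_sub_le battaCoeff_pos hxx (hx h (hsub hh)).1.hasSum_batta
    (hx h' (hsub hh')).1.hasSum_batta k
  have h2 := hK h hh h' hh' hle
  rw [abs_sub_comm, abs_of_nonneg (sub_nonneg.2 (hxx.mom_le k)), abs_of_nonneg
    (sub_nonneg.2 (hb.batta_le (hc h (hsub hh)) (hc h' (hsub hh')))), div_mul_eq_mul_div,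
    le_div_iff₀ (battaCoeff_pos k), mul_comm]
  exact h1.trans h2

end family

/-! ### The variation of the area functional -/

/-- The graph of t^{n+1} lies above its tangent at x. -/
lemma succ_mul_mul_pow_le {x y : ℝ} (hx : 0 ≤ x) (hy : 0 ≤ y) (n : ℕ) :
    (n + 1) * (y * x ^ n) ≤ n * x ^ (n + 1) + y ^ (n + 1) := by
  induction n with
  | zero => simp
  | succ n ih =>
    have h1 : 0 ≤ (x - y) * (x ^ (n + 1) - y ^ (n + 1)) := by
      rcases le_total x y with h | h
      · exact mul_nonneg_of_nonpos_of_nonpos (sub_nonpos.2 h)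
          (sub_nonpos.2 (pow_le_pow_left₀ hx h _))
      · exact mul_nonneg (sub_nonneg.2 h) (sub_nonneg.2 (pow_le_pow_left₀ hy h _))
    have h2 := mul_le_mul_of_nonneg_left ih hx
    have e1 : x * ((n + 1) * (y * x ^ n)) = (n + 1) * (y * x ^ (n + 1)) := by ring
    have e2 : x * (n * x ^ (n + 1) + y ^ (n + 1)) = n * x ^ (n + 2) + x * y ^ (n + 1) := by ring
    have e3 : (x - y) * (x ^ (n + 1) - y ^ (n + 1))
        = x ^ (n + 2) + y ^ (n + 2) - y * x ^ (n + 1) - x * y ^ (n + 1) := by ring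
    rw [e1, e2] at h2
    rw [e3] at h1
    push_cast
    linarith

/-- Entropy after ⊞ depends on moments only, so a distribution with the moments of x may stand in
for x. -/
lemma checkConv_entropy_eq {x : Measure EReal} (hx : IsLDist x) {w : Measure EReal}
    (hw : IsLDist w) (h : ∀ k, mom w k = mom x k) (n : ℕ) :
    entropy (checkConv w (checkPow x n)) = entropy (checkPow x (n + 1)) := by
  have := hx.prob
  have := hw.prob
  have := (hx.checkPow n).prob
  have h1 := (hw.checkConv (hx.checkPow n)).hasSum_entropy
  have h2 := (hx.checkPow (n + 1)).hasSum_entropy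
  simp only [mom_checkConv, mom_checkPow hx, h, ← pow_succ'] at h1 h2
  linarith [h1.unique h2]

section fixedPoint

variable {l r : ℕ} {c x : Measure EReal}

lemma IsForwardFP.mom_eq (hc : IsLDist c) (h : IsForwardFP l r c x) (k : ℕ) :
    mom (varConv c (varPow (checkPow x (r - 1)) (l - 1))) k = mom x k :=
  (h.evalD_eq hc (evenCont_pow (k + 1))).symm

/-- The area functional as a stationary functional of the fixed point. -/
lemma IsForwardFP.areaA_eq (hl : 1 ≤ l) (hr : 1 ≤ r) (hc : IsLDist c) (h : IsForwardFP l r c x) :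
    areaA l r x = entropy (varConv c (varPow (checkPow x (r - 1)) l))
      - l * entropy (checkPow x (r - 1)) + (l - l / r) * entropy (checkPow x r) := by
  have hx := h.1
  have hy := h.isLDist_node
  have := hc.prob
  have := hy.prob
  have := (hy.varPow (l - 1)).prob
  set w := varConv c (varPow (checkPow x (r - 1)) (l - 1)) with hw
  have hwL : IsLDist w := hc.varConv (hy.varPow _)
  -- One of the l factors is split off: the rest, w, is x as far as moments and entropy can tell,
  -- and duality applies to w ⊛ y.
  have e1 : varConv c (varPow (checkPow x (r - 1)) l) = varConv w (checkPow x (r - 1)) := by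
    conv_lhs => rw [show l = l - 1 + 1 by omega]
    rw [varPow, hw, varConv_assoc]
  have e2 : entropy w = entropy x := by
    rw [hwL.entropy_eq, hx.entropy_eq, h.evalD_eq hc evenCont_etaD]
  have e3 := checkConv_entropy_eq hx hwL (h.mom_eq hc) (r - 1)
  rw [show r - 1 + 1 = r by omega] at e3
  rw [e1, hwL.entropy_varConv hy, e2, e3, areaA]
  ring

/-- Expansion of the change of `H(c ⊛ y^{⊛(n+1)})` with `y`. -/
lemma exists_hasSum_entropy_varPow_sub {y₁ y₂ : Measure EReal} (h₁ : IsLDist y₁)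
    (h₂ : IsLDist y₂) (hb : Better y₁ y₂) (n : ℕ) {c : Measure EReal} (hc : IsLDist c) :
    ∃ s : ℕ → ℝ, (∀ k, (n + 1) * mom (varConv c (varPow y₂ n)) k ≤ s k ∧
        s k ≤ (n + 1) * mom (varConv c (varPow y₁ n)) k) ∧
      HasSum (fun k => entropyCoeff k * (s k * (mom y₁ k - mom y₂ k)))
        ((n + 1) * (entropy y₂ - entropy y₁) -
          (entropy (varConv c (varPow y₂ (n + 1))) - entropy (varConv c (varPow y₁ (n + 1))))) := by
  have := h₁.prob
  have := h₂.prob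
  have single : ∀ {w : Measure EReal}, IsLDist w →
      HasSum (fun k => entropyCoeff k * (mom w k * (mom y₁ k - mom y₂ k)))
        ((entropy y₂ - entropy y₁) - (entropy (varConv w y₂) - entropy (varConv w y₁))) := by
    intro w hw
    have h := (hw.hasSum_entropy_varConv h₁).sub (hw.hasSum_entropy_varConv h₂)
    rw [show ∀ A B C D : ℝ, A - B - (C - D) = 1 - entropy w - B + D - (1 - entropy w - A + C) from
      fun A B C D => by ring]
    simpa only [mul_sub] using h
  induction n generalizing c with
  | zero =>
    have := hc.prob
    have e0 : ∀ y : Measure EReal, varConv c (varPow y 0) = c := fun y => Measure.conv_dirac_zero c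
    have e1 : ∀ y : Measure EReal, IsLDist y → varConv c (varPow y 1) = varConv c y := fun y hy => by
      have := hy.prob
      rw [varPow]
      have : varConv (varPow y 0) y = y := Measure.dirac_zero_conv y
      rw [this]
    refine ⟨fun k => mom c k, fun k => by simp [e0], ?_⟩
    rw [e1 _ h₁, e1 _ h₂]
    simpa using single hc
  | succ n ih =>
    have := hc.prob
    have p1 := fun m => (h₁.varPow m).prob
    have p2 := fun m => (h₂.varPow m).prob
    have hc2 := hc.varConv h₂
    -- Factors y₁ are exchanged for y₂ one at a time and the differences telescope; s collects the
    -- moments of the companions of the exchanged factor, which lie between the two extreme cases.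
    obtain ⟨s, hs, hsum⟩ := ih hc2
    have hw := hc.varConv (h₁.varPow (n + 1))
    have rot : ∀ y z : Measure EReal, IsLDist y → IsLDist z →
        varConv (varConv c y) z = varConv (varConv c z) y := fun y z hy hz => by
      have := hy.prob
      have := hz.prob
      rw [varConv_assoc, varConv_comm y z, ← varConv_assoc]
    have e2 : ∀ m, varConv (varConv c y₂) (varPow y₂ m) = varConv c (varPow y₂ (m + 1)) := fun m => by
      have := p2 m
      rw [varConv_assoc, varConv_comm y₂, varPow]
    have e1 : varConv (varConv c (varPow y₁ (n + 1))) y₁ = varConv c (varPow y₁ (n + 2)) := by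
      have := p1 (n + 1)
      rw [varConv_assoc]
      rfl
    have e3 : varConv (varConv c (varPow y₁ (n + 1))) y₂
        = varConv (varConv c y₂) (varPow y₁ (n + 1)) := rot _ _ (h₁.varPow _) h₂
    refine ⟨fun k => s k + mom (varConv c (varPow y₁ (n + 1))) k, fun k => ?_, ?_⟩
    · have hA : Better (varConv c (varPow y₁ (n + 1))) (varConv c (varPow y₂ (n + 1))) :=
        (Better.refl c).varConv hc hc (h₁.varPow _) (h₂.varPow _) (hb.varPow h₁ h₂ _)
      have hB : Better (varConv c (varPow y₁ (n + 1))) (varConv (varConv c y₂) (varPow y₁ n)) := by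
        have := p1 n
        rw [rot _ _ h₂ (h₁.varPow n), varPow, ← varConv_assoc]
        exact (Better.refl _).varConv (hc.varConv (h₁.varPow n)) (hc.varConv (h₁.varPow n)) h₁ h₂ hb
      have a1 := hA.mom_le k
      have a2 := hB.mom_le k
      obtain ⟨b1, b2⟩ := hs k
      rw [e2] at b1
      have hn : (0 : ℝ) ≤ n + 1 := by positivity
      have a3 := mul_le_mul_of_nonneg_left a2 hn
      push_cast
      constructor <;> linarith
    · have h := hsum.add (single hw)
      rw [e1, e3, e2] at h
      convert h using 1
      · ext k
        ring
      · push_cast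
        ring

/-- The area functional varies along the fixed points like the entropy in the channel alone, up to
a second-order error. -/
lemma abs_areaA_sub_le {c' x' : Measure EReal} (hl : 1 ≤ l) (hr : 1 ≤ r) (hc : IsLDist c)
    (hc' : IsLDist c') (h : IsForwardFP l r c x) (h' : IsForwardFP l r c' x')
    (hcc : Better c c') :
    |areaA l r x' - areaA l r x -
      (entropy (varConv c' (varPow (checkPow x' (r - 1)) l))
        - entropy (varConv c (varPow (checkPow x' (r - 1)) l)))|
      ≤ ∑' k, entropyCoeff k *
        (l * ((mom x k - mom x' k) * (mom x k ^ (r - 1) - mom x' k ^ (r - 1)))) := by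
  have hq := isMomentSeries_etaD.pos
  have hx := h.1
  have hx' := h'.1
  have := hx.prob
  have := hx'.prob
  have hxx := h.better hc hc' h' hcc
  have hy := h.isLDist_node
  have hy' := h'.isLDist_node
  have hyy := hxx.checkPow hx hx' (r - 1)
  obtain ⟨s, hs, hsum⟩ := exists_hasSum_entropy_varPow_sub hy hy' hyy (l - 1) hc
  have hl1 : ((l - 1 : ℕ) : ℝ) + 1 = l := by rw [Nat.cast_sub hl]; push_cast; ring
  rw [hl1, show l - 1 + 1 = l by omega] at hsum
  -- The fixed-point equations identify the extremes: c ⊛ y^{⊛(l-1)} has the moments of x, and c ⊛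
  -- y'^{⊛(l-1)} is better than c' ⊛ y'^{⊛(l-1)}, which has those of x'.
  have hs' : ∀ k, l * mom x' k ≤ s k ∧ s k ≤ l * mom x k := fun k => by
    obtain ⟨a1, a2⟩ := hs k
    rw [hl1] at a1 a2
    rw [h.mom_eq hc] at a2
    have hB : Better (varConv c (varPow (checkPow x' (r - 1)) (l - 1)))
        (varConv c' (varPow (checkPow x' (r - 1)) (l - 1))) :=
      hcc.varConv hc hc' (hy'.varPow _) (hy'.varPow _) (Better.refl _)
    have := hB.mom_le k
    rw [h'.mom_eq hc'] at this
    exact ⟨(mul_le_mul_of_nonneg_left this (Nat.cast_nonneg l)).trans a1, a2⟩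
  simp only [mom_checkPow hx, mom_checkPow hx'] at hsum
  have hsum2 := ((hx.checkPow r).hasSum_entropy.sub (hx'.checkPow r).hasSum_entropy).mul_left
    ((l : ℝ) - l / r)
  simp only [mom_checkPow hx, mom_checkPow hx'] at hsum2
  have htot := hsum2.sub hsum
  have e : areaA l r x' - areaA l r x -
      (entropy (varConv c' (varPow (checkPow x' (r - 1)) l))
        - entropy (varConv c (varPow (checkPow x' (r - 1)) l)))
      = ((l : ℝ) - l / r) * (1 - entropy (checkPow x r) - (1 - entropy (checkPow x' r))) -
        (l * (entropy (checkPow x' (r - 1)) - entropy (checkPow x (r - 1))) -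
          (entropy (varConv c (varPow (checkPow x' (r - 1)) l)) -
            entropy (varConv c (varPow (checkPow x (r - 1)) l)))) := by
    rw [h.areaA_eq hl hr hc, h'.areaA_eq hl hr hc']
    ring
  rw [e, ← htot.tsum_eq, ← Real.norm_eq_abs]
  -- With p = m^{r-1} and p' = m'^{r-1}, both l(1-1/r)(m^r - m'^r) and s_k(p-p') lie between l
  -- m'(p-p') and l m(p-p'), so they differ by at most l(m-m')(p-p'). This is stationarity in
  -- quantitative form.
  have term : ∀ k, ‖((l : ℝ) - l / r) * (entropyCoeff k * mom x k ^ r - entropyCoeff k * mom x' k ^ r)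
      - entropyCoeff k * (s k * (mom x k ^ (r - 1) - mom x' k ^ (r - 1)))‖
      ≤ entropyCoeff k *
        (l * ((mom x k - mom x' k) * (mom x k ^ (r - 1) - mom x' k ^ (r - 1)))) := by
    intro k
    have hm := mom_mem x k
    have hm' := mom_mem x' k
    have hle := hxx.mom_le k
    obtain ⟨b1, b2⟩ := hs' k
    obtain ⟨n, rfl⟩ := Nat.exists_eq_add_of_le' hr
    rw [Nat.add_sub_cancel]
    set m := mom x k
    set m' := mom x' k
    have hp : 0 ≤ m ^ n - m' ^ n := sub_nonneg.2 (pow_le_pow_left₀ hm'.1 hle _)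
    have i1 := succ_mul_mul_pow_le hm.1 hm'.1 n
    have i2 := succ_mul_mul_pow_le hm'.1 hm.1 n
    have hn : (0 : ℝ) < (n : ℝ) + 1 := by positivity
    have hl0 : (0 : ℝ) ≤ l := Nat.cast_nonneg l
    set T := ((l : ℝ) - l / (n + 1 : ℕ)) * (m ^ (n + 1) - m' ^ (n + 1)) with hT
    have hTe : (n + 1) * T = l * (n * (m ^ (n + 1) - m' ^ (n + 1))) := by
      rw [hT]; push_cast; field_simp; ring
    have t1 : l * m' * (m ^ n - m' ^ n) ≤ T := by
      have : (n + 1) * (l * m' * (m ^ n - m' ^ n)) ≤ (n + 1) * T := by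
        rw [hTe]
        have := mul_le_mul_of_nonneg_left i1 hl0
        have e1 : m' ^ (n + 1) = m' * m' ^ n := pow_succ' _ _
        rw [e1] at this ⊢
        nlinarith
      exact le_of_mul_le_mul_left this hn
    have t2 : T ≤ l * m * (m ^ n - m' ^ n) := by
      have : (n + 1) * T ≤ (n + 1) * (l * m * (m ^ n - m' ^ n)) := by
        rw [hTe]
        have := mul_le_mul_of_nonneg_left i2 hl0
        have e1 : m ^ (n + 1) = m * m ^ n := pow_succ' _ _
        rw [e1] at this ⊢
        nlinarith
      exact le_of_mul_le_mul_left this hn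
    have s1 := mul_le_mul_of_nonneg_right b1 hp
    have s2 := mul_le_mul_of_nonneg_right b2 hp
    have e1 : ((l : ℝ) - l / (n + 1 : ℕ)) *
        (entropyCoeff k * m ^ (n + 1) - entropyCoeff k * m' ^ (n + 1))
        - entropyCoeff k * (s k * (m ^ n - m' ^ n))
        = entropyCoeff k * (T - s k * (m ^ n - m' ^ n)) := by rw [hT]; ring
    rw [e1, norm_mul, Real.norm_eq_abs, Real.norm_eq_abs, abs_of_pos (hq k)]
    refine mul_le_mul_of_nonneg_left ?_ (hq k).le
    rw [abs_le]
    constructor <;> nlinarith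
  refine tsum_of_norm_bounded (Summable.hasSum ?_) term
  refine Summable.of_nonneg_of_le (fun k => (norm_nonneg _).trans (term k)) (fun k => ?_)
    (isMomentSeries_etaD.summable.mul_right (l : ℝ))
  have hm := mom_mem x k
  have hm' := mom_mem x' k
  have hle := hxx.mom_le k
  refine mul_le_mul_of_nonneg_left (mul_le_of_le_one_right (Nat.cast_nonneg l) ?_) (hq k).le
  have : mom x k ^ (r - 1) ≤ 1 := pow_le_one₀ hm.1 hm.2
  have : 0 ≤ mom x' k ^ (r - 1) := pow_nonneg hm'.1 _
  exact mul_le_one₀ (by linarith [hm.2, hm'.1])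
    (sub_nonneg.2 (pow_le_pow_left₀ hm'.1 hle _)) (by linarith)

end fixedPoint

/-! ### Differentiability of the entropy along the family -/

lemma measurable_exp_neg_half : Measurable fun y : ℝ => Real.exp (-y / 2) := by fun_prop

lemma exp_neg_half_bound (y : EReal) : |(1 + toD y) *
    (if y = ⊤ ∨ y = ⊥ then 0 else Real.exp (-y.toReal / 2))| ≤ 2 := by
  induction y with
  | bot => simp
  | top => simp
  | coe y =>
    simp only [EReal.coe_ne_top, EReal.coe_ne_bot, or_self, if_false, EReal.toReal_coe]
    have hu := Real.exp_pos (-y / 2)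
    have hsq : Real.exp (-y) = Real.exp (-y / 2) ^ 2 := by
      rw [← Real.exp_nat_mul]; congr 1; push_cast; ring
    rw [one_add_toD_coe, hsq, abs_of_nonneg (by positivity), div_mul_eq_mul_div,
      div_le_iff₀ (by positivity)]
    nlinarith [sq_nonneg (Real.exp (-y / 2) - 1)]

lemma logb_exp_nonneg (t : ℝ) : 0 ≤ Real.logb 2 (1 + Real.exp (-t)) :=
  Real.logb_nonneg one_lt_two (by linarith [Real.exp_pos (-t)])

/-- With s = e^{-t/2}, 1+s² ≤ (1+s)² gives log(1+s²) ≤ 2s: exactly the decay demanded of test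
functions in the smoothness hypothesis. -/
lemma logb_exp_le (t : ℝ) :
    Real.logb 2 (1 + Real.exp (-t)) ≤ 2 / Real.log 2 * Real.exp (-t / 2) := by
  have hl := Real.log_pos (show (1 : ℝ) < 2 by norm_num)
  have hu := Real.exp_pos (-t / 2)
  have hsq : Real.exp (-t) = Real.exp (-t / 2) ^ 2 := by
    rw [← Real.exp_nat_mul]; congr 1; push_cast; ring
  rw [Real.logb, div_mul_eq_mul_div]
  refine div_le_div_of_nonneg_right ?_ hl.le
  calc Real.log (1 + Real.exp (-t)) ≤ Real.log ((1 + Real.exp (-t / 2)) ^ 2) :=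
        Real.log_le_log (by positivity) (by rw [hsq]; nlinarith)
    _ = 2 * Real.log (1 + Real.exp (-t / 2)) := by rw [Real.log_pow]; push_cast; ring
    _ ≤ 2 * Real.exp (-t / 2) := by
      have := Real.log_le_sub_one_of_pos (show 0 < 1 + Real.exp (-t / 2) by positivity)
      linarith

lemma hasDerivAt_logb_exp (t : ℝ) :
    HasDerivAt (fun t => Real.logb 2 (1 + Real.exp (-t)))
      (-(Real.exp (-t) / (1 + Real.exp (-t)) / Real.log 2)) t := by
  have h1 : HasDerivAt (fun t => 1 + Real.exp (-t)) (-Real.exp (-t)) t := by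
    simpa using ((hasDerivAt_neg t).exp).const_add 1
  have h2 := (h1.log (by positivity)).div_const (Real.log 2)
  simpa only [Real.logb, neg_div] using h2

lemma abs_deriv_logb_exp_le (t : ℝ) :
    |-(Real.exp (-t) / (1 + Real.exp (-t)) / Real.log 2)| ≤ 1 / Real.log 2 := by
  have hl := Real.log_pos (show (1 : ℝ) < 2 by norm_num)
  have hu := Real.exp_pos (-t)
  rw [abs_neg, abs_of_nonneg (by positivity)]
  refine div_le_div_of_nonneg_right ?_ hl.le
  rw [div_le_one (by positivity)]
  linarith

/-- The kernel `y ↦ ∫ log₂(1 + e^{-y-w}) z(dw)` of `a ↦ H(a ⊛ z)`. -/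
def entropyKernel (z : Measure EReal) (y : ℝ) : ℝ :=
  lint z fun w => Real.logb 2 (1 + Real.exp (-(y + w)))

section kernel

variable {z : Measure EReal}

lemma IsLDist.integrable_exp_neg_half (hz : IsLDist z) :
    Integrable (fun w : EReal => if w = ⊤ ∨ w = ⊥ then 0 else Real.exp (-w.toReal / 2)) z :=
  (hz.integral_symmetrize (measurable_lint_integrand measurable_exp_neg_half) exp_neg_half_bound).1

lemma measurable_entropyKernel_integrand (y : ℝ) :
    Measurable fun w : EReal =>
      if w = ⊤ ∨ w = ⊥ then 0 else Real.logb 2 (1 + Real.exp (-(y + w.toReal))) :=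
  measurable_lint_integrand (measurable_logb_exp.comp (measurable_const_add y))

lemma entropyKernel_integrand_le (y : ℝ) (w : EReal) :
    ‖if w = ⊤ ∨ w = ⊥ then 0 else Real.logb 2 (1 + Real.exp (-(y + w.toReal)))‖ ≤
      2 / Real.log 2 * Real.exp (-y / 2) *
        (if w = ⊤ ∨ w = ⊥ then 0 else Real.exp (-w.toReal / 2)) := by
  split_ifs
  · simp
  · rw [Real.norm_eq_abs, abs_of_nonneg (logb_exp_nonneg _)]
    refine (logb_exp_le _).trans_eq ?_
    rw [mul_assoc, ← Real.exp_add]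
    congr 2
    ring

lemma IsLDist.integrable_entropyKernel (hz : IsLDist z) (y : ℝ) :
    Integrable (fun w : EReal =>
      if w = ⊤ ∨ w = ⊥ then 0 else Real.logb 2 (1 + Real.exp (-(y + w.toReal)))) z :=
  (hz.integrable_exp_neg_half.const_mul _).mono'
    (measurable_entropyKernel_integrand y).aestronglyMeasurable
    (Eventually.of_forall (entropyKernel_integrand_le y))

lemma IsLDist.abs_exp_mul_entropyKernel_le (hz : IsLDist z) (y : ℝ) :
    |Real.exp (y / 2) * entropyKernel z y| ≤ 2 / Real.log 2 * batta z := by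
  have h1 := norm_integral_le_of_norm_le (hz.integrable_exp_neg_half.const_mul _)
    (Eventually.of_forall (entropyKernel_integrand_le y))
  rw [integral_const_mul] at h1
  rw [abs_mul, abs_of_pos (Real.exp_pos _)]
  calc _ ≤ Real.exp (y / 2) * (2 / Real.log 2 * Real.exp (-y / 2) * batta z) :=
        mul_le_mul_of_nonneg_left h1 (Real.exp_pos _).le
    _ = 2 / Real.log 2 * batta z * (Real.exp (y / 2) * Real.exp (-y / 2)) := by ring
    _ = _ := by rw [← Real.exp_add, show y / 2 + -y / 2 = 0 by ring, Real.exp_zero, mul_one]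

lemma measurable_deriv_logb_exp (y : ℝ) : Measurable fun w : EReal => if w = ⊤ ∨ w = ⊥ then (0 : ℝ)
    else -(Real.exp (-(y + w.toReal)) / (1 + Real.exp (-(y + w.toReal))) / Real.log 2) :=
  measurable_lint_integrand (f := fun w =>
    -(Real.exp (-(y + w)) / (1 + Real.exp (-(y + w))) / Real.log 2)) (by fun_prop)

lemma norm_deriv_logb_exp_le (y : ℝ) (w : EReal) : ‖if w = ⊤ ∨ w = ⊥ then (0 : ℝ)
    else -(Real.exp (-(y + w.toReal)) / (1 + Real.exp (-(y + w.toReal))) / Real.log 2)‖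
      ≤ 1 / Real.log 2 := by
  have hl := Real.log_pos (show (1 : ℝ) < 2 by norm_num)
  split_ifs
  · rw [norm_zero]; positivity
  · exact abs_deriv_logb_exp_le _

lemma IsLDist.hasDerivAt_entropyKernel (hz : IsLDist z) (y : ℝ) :
    HasDerivAt (entropyKernel z) (∫ w : EReal, (if w = ⊤ ∨ w = ⊥ then (0 : ℝ) else
      -(Real.exp (-(y + w.toReal)) / (1 + Real.exp (-(y + w.toReal))) / Real.log 2)) ∂z) y := by
  have := hz.prob
  refine (hasDerivAt_integral_of_dominated_loc_of_deriv_le (s := univ)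
    (bound := fun _ => 1 / Real.log 2) univ_mem
    (Eventually.of_forall fun y => (measurable_entropyKernel_integrand y).aestronglyMeasurable)
    (hz.integrable_entropyKernel y) (F' := fun y (w : EReal) => if w = ⊤ ∨ w = ⊥ then (0 : ℝ) else
      -(Real.exp (-(y + w.toReal)) / (1 + Real.exp (-(y + w.toReal))) / Real.log 2))
    (measurable_deriv_logb_exp y).aestronglyMeasurable
    (Eventually.of_forall fun w y _ => norm_deriv_logb_exp_le y w) (integrable_const _)
    (Eventually.of_forall fun w y _ => ?_)).2
  by_cases hw : w = ⊤ ∨ w = ⊥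
  · simp only [hw, if_true]
    exact hasDerivAt_const _ _
  · simp only [hw, if_false]
    exact (hasDerivAt_logb_exp (y + w.toReal)).comp_add_const y w.toReal

lemma IsLDist.contDiff_entropyKernel (hz : IsLDist z) : ContDiff ℝ 1 (entropyKernel z) := by
  have := hz.prob
  rw [contDiff_one_iff_deriv]
  refine ⟨fun y => (hz.hasDerivAt_entropyKernel y).differentiableAt, ?_⟩
  rw [funext fun y => (hz.hasDerivAt_entropyKernel y).deriv]
  refine continuous_of_dominated (bound := fun _ => 1 / Real.log 2)
    (fun y => (measurable_deriv_logb_exp y).aestronglyMeasurable)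
    (fun y => Eventually.of_forall (norm_deriv_logb_exp_le y)) (integrable_const _)
    (Eventually.of_forall fun w => ?_)
  split_ifs
  · exact continuous_const
  · refine ((Continuous.div (by fun_prop) (by fun_prop) fun y => ?_).div_const _).neg
    positivity

/-- Displays H(a ⊛ z) as the integral of one fixed test function against a, so that smoothness of
the family applies to it. -/
lemma entropy_varConv_eq_lint {a : Measure EReal} (ha : IsLDist a) (hz : IsLDist z) :
    entropy (varConv a z) = lint a (entropyKernel z) := by
  have := ha.prob
  have := hz.prob
  have hm := measurable_lint_integrand measurable_logb_exp
  have hadd : Measurable fun p : EReal × EReal => p.1 + p.2 := measurable_add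
  have hint := ((ha.varConv hz).integral_symmetrize hm logb_exp_bound).1
  rw [varConv, Measure.conv, integrable_map_measure hm.aestronglyMeasurable hadd.aemeasurable]
    at hint
  rw [entropy, lint, varConv, Measure.conv,
    integral_map hadd.aemeasurable hm.aestronglyMeasurable]
  refine (integral_prod _ hint).trans ?_
  rw [lint]
  simp only [Function.comp_apply]
  refine integral_congr_ae ?_
  filter_upwards [ha.ae_ne_bot] with y hy
  induction y with
  | bot => exact absurd rfl hy
  | top =>
    simp only [true_or, if_true]
    rw [← integral_zero EReal ℝ (μ := z)]
    refine integral_congr_ae ?_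
    filter_upwards [hz.ae_ne_bot] with w hw
    simp [EReal.top_add_of_ne_bot hw]
  | coe y =>
    simp only [EReal.coe_ne_top, EReal.coe_ne_bot, or_self, if_false, EReal.toReal_coe]
    refine integral_congr_ae (Eventually.of_forall fun w => ?_)
    induction w with
    | bot => simp
    | top => simp
    | coe w => simp only [← EReal.coe_add, EReal.coe_ne_top, EReal.coe_ne_bot, or_self, if_false,
        EReal.toReal_coe]

end kernel

section family

variable {l r : ℕ} {c x : ℝ → Measure EReal}

/-- The test function is the entropy kernel of y_h^{⊛l}, which changes with h; it matters that the
exceptional set is common to all test functions. -/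
lemma differentiableAt_gexitEntropy (hc : ∀ h ∈ Icc (0 : ℝ) 1, IsLDist (c h))
    (hsmooth : PiecewiseSmoothFamily c) (hx : ∀ h ∈ Icc (0 : ℝ) 1, IsLDist (x h)) :
    ∃ S : Finset ℝ, ∀ h ∈ Ioo (0 : ℝ) 1, h ∉ S →
      DifferentiableAt ℝ (gexitEntropy l r c x h) h := by
  obtain ⟨S, hS⟩ := hsmooth
  refine ⟨S, fun h hh hhS => ?_⟩
  have hz := ((hx h (Ioo_subset_Icc_self hh)).checkPow (r - 1)).varPow l
  obtain ⟨-, h1⟩ := hS _ hz.contDiff_entropyKernel ⟨_, hz.abs_exp_mul_entropyKernel_le⟩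
  have hopen : IsOpen (Ioo (0 : ℝ) 1 \ S) := isOpen_Ioo.sdiff S.finite_toSet.isClosed
  have hmem : Ioo (0 : ℝ) 1 \ S ∈ 𝓝 h := hopen.mem_nhds ⟨hh, hhS⟩
  refine ((h1.differentiableOn one_ne_zero).differentiableAt hmem).congr_of_eventuallyEq ?_
  filter_upwards [hmem] with h' hh'
  exact entropy_varConv_eq_lint (hc h' (Ioo_subset_Icc_self hh'.1)) hz

end family

/-! ### Integrating a partial derivative along the diagonal -/

lemma integral_sub_shift {F : ℝ → ℝ} (hF : Continuous F) (a b δ : ℝ) :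
    ∫ h in a..b, (F h - F (h - δ)) = (∫ h in (b - δ)..b, F h) - ∫ h in (a - δ)..a, F h := by
  have hi : ∀ u v, IntervalIntegrable F volume u v := fun u v => hF.intervalIntegrable u v
  have hshift : Continuous fun h => F (h - δ) := by fun_prop
  rw [intervalIntegral.integral_sub (hi a b) (hshift.intervalIntegrable a b), intervalIntegral.integral_comp_sub_right]
  have h1 := intervalIntegral.integral_add_adjacent_intervals (hi (a - δ) a) (hi a b)
  have h2 := intervalIntegral.integral_add_adjacent_intervals (hi (a - δ) (b - δ)) (hi (b - δ) b)
  linarith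

lemma tendsto_neg_one_div_add_one :
    Tendsto (fun n : ℕ => -(1 / ((n : ℝ) + 1))) atTop (𝓝[≠] 0) := by
  refine tendsto_nhdsWithin_iff.2 ⟨?_, Eventually.of_forall fun n => ?_⟩
  · simpa using (tendsto_one_div_add_atTop_nhds_zero_nat (𝕜 := ℝ)).neg
  · have : 0 < 1 / ((n : ℝ) + 1) := by positivity
    exact (neg_neg_of_pos this).ne

lemma tendsto_backward_quotient {f : ℝ → ℝ} {f' x : ℝ} (h : HasDerivAt f f' x) :
    Tendsto (fun n : ℕ => ((n : ℝ) + 1) * (f x - f (x - 1 / ((n : ℝ) + 1)))) atTop (𝓝 f') := by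
  refine (h.tendsto_slope_zero.comp tendsto_neg_one_div_add_one).congr fun n => ?_
  simp only [Function.comp_apply, smul_eq_mul, ← sub_eq_add_neg, inv_neg, one_div, inv_inv]
  ring

lemma tendsto_mul_integral_sub {F : ℝ → ℝ} (hF : Continuous F) (a b : ℝ) :
    Tendsto (fun n : ℕ => ((n : ℝ) + 1) * ∫ h in a..b, (F h - F (h - 1 / ((n : ℝ) + 1)))) atTop
      (𝓝 (F b - F a)) := by
  have hd : ∀ t, HasDerivAt (fun u => ∫ h in (0 : ℝ)..u, F h) (F t) t := fun t =>
    hF.integral_hasStrictDerivAt 0 t |>.hasDerivAt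
  refine ((tendsto_backward_quotient (hd b)).sub (tendsto_backward_quotient (hd a))).congr
    fun n => ?_
  have hi : ∀ u v, IntervalIntegrable F volume u v := fun u v => hF.intervalIntegrable u v
  rw [integral_sub_shift hF, intervalIntegral.integral_interval_sub_left (hi _ _) (hi _ _),
    intervalIntegral.integral_interval_sub_left (hi _ _) (hi _ _), mul_sub]

/-- The integral of increments telescopes to two windows of length δ; the one with positive sign
contributes at most δ. -/
lemma mul_integral_sub_le_one {p : ℝ → ℝ} (hp : Continuous p) (h01 : ∀ h, p h ∈ Icc (0 : ℝ) 1)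
    (a b : ℝ) (n : ℕ) :
    ((n : ℝ) + 1) * ∫ h in a..b, (p (h - 1 / ((n : ℝ) + 1)) - p h) ≤ 1 := by
  set δ := 1 / ((n : ℝ) + 1) with hδ
  have hn : (0 : ℝ) < n + 1 := by positivity
  have hδ0 : 0 < δ := by positivity
  have hi : ∀ u v, IntervalIntegrable p volume u v := fun u v => hp.intervalIntegrable u v
  have h1 : ∫ h in a..b, (p (h - δ) - p h) = (∫ h in (a - δ)..a, p h) - ∫ h in (b - δ)..b, p h := by
    rw [← neg_sub (∫ h in (b - δ)..b, p h), ← integral_sub_shift hp,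
      ← intervalIntegral.integral_neg]
    simp only [neg_sub]
  have h2 : ∫ h in (a - δ)..a, p h ≤ δ := by
    have := intervalIntegral.integral_mono_on (by linarith : a - δ ≤ a) (hi _ _)
      (intervalIntegrable_const (c := (1 : ℝ))) fun h _ => (h01 h).2
    simpa using this
  have h3 : 0 ≤ ∫ h in (b - δ)..b, p h :=
    intervalIntegral.integral_nonneg (by linarith) fun h _ => (h01 h).1
  calc _ ≤ ((n : ℝ) + 1) * δ := mul_le_mul_of_nonneg_left (by linarith) hn.le
    _ = 1 := by rw [hδ]; field_simp

lemma eventually_forall_shift_sub_le {m : ℝ → ℝ} (hm : Continuous m) (a b : ℝ) {ε : ℝ}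
    (hε : 0 < ε) : ∀ᶠ n : ℕ in atTop, ∀ h ∈ Icc a b, m (h - 1 / ((n : ℝ) + 1)) - m h ≤ ε := by
  have hu := (isCompact_Icc (a := a - 1) (b := b)).uniformContinuousOn_of_continuous
    hm.continuousOn
  obtain ⟨δ, hδ, hu⟩ := Metric.uniformContinuousOn_iff.1 hu ε hε
  filter_upwards [(tendsto_one_div_add_atTop_nhds_zero_nat (𝕜 := ℝ)).eventually_lt_const hδ]
    with n hn h hh
  have h0 : 0 < 1 / ((n : ℝ) + 1) := by positivity
  have h1 : 1 / ((n : ℝ) + 1) ≤ 1 := by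
    rw [div_le_one (by positivity)]; linarith [(Nat.cast_nonneg n : (0 : ℝ) ≤ n)]
  have := hu (h - 1 / ((n : ℝ) + 1)) ⟨by linarith [hh.1], by linarith [hh.2]⟩ h
    ⟨by linarith [hh.1], hh.2⟩ (by
      rw [Real.dist_eq, abs_lt]; constructor <;> linarith)
  rw [Real.dist_eq, abs_lt] at this
  exact this.2.le

/-- In each term the increment of m is uniformly small by continuity, and the increment of p
integrates to at most one step length. The weights q dominate the sum over k. -/
lemma tendsto_tsum_mul_integral {a b : ℝ} (hab : a ≤ b) {m p : ℕ → ℝ → ℝ}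
    (hm : ∀ k, Continuous (m k)) (hp : ∀ k, Continuous (p k))
    (hma : ∀ k, Antitone (m k)) (hpa : ∀ k, Antitone (p k))
    (hm1 : ∀ k h, m k h ∈ Icc (0 : ℝ) 1) (hp1 : ∀ k h, p k h ∈ Icc (0 : ℝ) 1)
    {q : ℕ → ℝ} (hq : ∀ k, 0 ≤ q k) (hs : Summable q) :
    Tendsto (fun n : ℕ => ∑' k, ((n : ℝ) + 1) * ∫ h in a..b, q k *
      ((m k (h - 1 / ((n : ℝ) + 1)) - m k h) * (p k (h - 1 / ((n : ℝ) + 1)) - p k h)))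
      atTop (𝓝 0) := by
  have hle : ∀ (n : ℕ) (h : ℝ), h - 1 / ((n : ℝ) + 1) ≤ h := fun n h => by
    have : 0 < 1 / ((n : ℝ) + 1) := by positivity
    linarith
  have hdm : ∀ (n k : ℕ) (h : ℝ), 0 ≤ m k (h - 1 / ((n : ℝ) + 1)) - m k h := fun n k h =>
    sub_nonneg.2 (hma k (hle n h))
  have hdp : ∀ (n k : ℕ) (h : ℝ), 0 ≤ p k (h - 1 / ((n : ℝ) + 1)) - p k h := fun n k h =>
    sub_nonneg.2 (hpa k (hle n h))
  have hn : ∀ n : ℕ, (0 : ℝ) < (n : ℝ) + 1 := fun n => by positivity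
  have nonneg : ∀ n k : ℕ, 0 ≤ ((n : ℝ) + 1) * ∫ h in a..b, q k *
      ((m k (h - 1 / ((n : ℝ) + 1)) - m k h) * (p k (h - 1 / ((n : ℝ) + 1)) - p k h)) :=
    fun n k => mul_nonneg (hn n).le (intervalIntegral.integral_nonneg hab fun h _ =>
      mul_nonneg (hq k) (mul_nonneg (hdm n k h) (hdp n k h)))
  have bound : ∀ (n k : ℕ) (ε : ℝ), 0 ≤ ε →
      (∀ h ∈ Icc a b, m k (h - 1 / ((n : ℝ) + 1)) - m k h ≤ ε) →
      ((n : ℝ) + 1) * ∫ h in a..b, q k *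
        ((m k (h - 1 / ((n : ℝ) + 1)) - m k h) * (p k (h - 1 / ((n : ℝ) + 1)) - p k h))
      ≤ q k * ε := by
    intro n k ε hε hmε
    have hmk := hm k
    have hpk := hp k
    have c1 : Continuous fun h => q k *
      ((m k (h - 1 / ((n : ℝ) + 1)) - m k h) * (p k (h - 1 / ((n : ℝ) + 1)) - p k h)) := by
      fun_prop
    have c2 : Continuous fun h => q k * ε * (p k (h - 1 / ((n : ℝ) + 1)) - p k h) := by fun_prop
    have h1 := intervalIntegral.integral_mono_on hab (c1.intervalIntegrable (μ := volume) a b)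
      (c2.intervalIntegrable a b) fun h hh => by
        rw [mul_assoc]
        exact mul_le_mul_of_nonneg_left (mul_le_mul_of_nonneg_right (hmε h hh) (hdp n k h)) (hq k)
    rw [intervalIntegral.integral_const_mul (q k * ε)] at h1
    have h2 := mul_integral_sub_le_one (hp k) (hp1 k) a b n
    calc _ ≤ ((n : ℝ) + 1) * (q k * ε * ∫ h in a..b, (p k (h - 1 / ((n : ℝ) + 1)) - p k h)) :=
          mul_le_mul_of_nonneg_left h1 (hn n).le
      _ = q k * ε * (((n : ℝ) + 1) * ∫ h in a..b, (p k (h - 1 / ((n : ℝ) + 1)) - p k h)) := by ring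
      _ ≤ q k * ε * 1 := mul_le_mul_of_nonneg_left h2 (mul_nonneg (hq k) hε)
      _ = q k * ε := mul_one _
  rw [← tsum_zero (α := ℝ) (β := ℕ)]
  refine tendsto_tsum_of_dominated_convergence hs (fun k => ?_) (Eventually.of_forall fun n k => ?_)
  · rw [Metric.tendsto_nhds]
    intro ε hε
    have hq1 : 0 < q k + 1 := by linarith [hq k]
    filter_upwards [eventually_forall_shift_sub_le (hm k) a b (div_pos hε hq1)] with n hn'
    rw [Real.dist_eq, sub_zero, abs_of_nonneg (nonneg n k)]
    refine (bound n k _ (div_pos hε hq1).le hn').trans_lt ?_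
    rw [mul_div_assoc', div_lt_iff₀ hq1]
    nlinarith
  · rw [Real.norm_eq_abs, abs_of_nonneg (nonneg n k)]
    refine (bound n k 1 zero_le_one fun h _ => ?_).trans_eq (mul_one _)
    linarith [(hm1 k (h - 1 / ((n : ℝ) + 1))).2, (hm1 k h).1]

/-- If `F` increases along the diagonal like `G` in its second variable, up to second-order errors,
then the integral of the partial derivative of `G` on the diagonal is the increment of `F`. -/
theorem integral_deriv_diagonal {a b : ℝ} (hab : a ≤ b) {G : ℝ → ℝ → ℝ} {F : ℝ → ℝ}
    (hF : Continuous F)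
    (hlip : ∀ h₁ h₂, h₁ ≤ h₂ → |G h₂ h₂ - G h₂ h₁| ≤ h₂ - h₁)
    (hmeas : ∀ δ, Measurable fun h => G h (h - δ))
    {m p : ℕ → ℝ → ℝ} (hm : ∀ k, Continuous (m k)) (hp : ∀ k, Continuous (p k))
    (hma : ∀ k, Antitone (m k)) (hpa : ∀ k, Antitone (p k))
    (hm1 : ∀ k h, m k h ∈ Icc (0 : ℝ) 1) (hp1 : ∀ k h, p k h ∈ Icc (0 : ℝ) 1)
    {q : ℕ → ℝ} (hq : ∀ k, 0 ≤ q k) (hs : Summable q)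
    (herr : ∀ h₁ h₂, h₁ ≤ h₂ → |F h₂ - F h₁ - (G h₂ h₂ - G h₂ h₁)| ≤
      ∑' k, q k * ((m k h₁ - m k h₂) * (p k h₁ - p k h₂)))
    (hdiff : ∀ᵐ h ∂volume.restrict (Ioc a b), DifferentiableAt ℝ (G h) h) :
    IntervalIntegrable (fun h => deriv (G h) h) volume a b ∧
      ∫ h in a..b, deriv (G h) h = F b - F a := by
  -- Backward quotients keep the first argument of G at the later parameter, as in the error
  -- hypothesis; the Lipschitz bound makes them bounded by 1, ready for dominated convergence.
  set g : ℕ → ℝ → ℝ := fun n h => ((n : ℝ) + 1) * (G h h - G h (h - 1 / ((n : ℝ) + 1))) with hg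
  have hn : ∀ n : ℕ, (0 : ℝ) < (n : ℝ) + 1 := fun n => by positivity
  have hle : ∀ (n : ℕ) (h : ℝ), h - 1 / ((n : ℝ) + 1) ≤ h := fun n h => by
    have : 0 < 1 / ((n : ℝ) + 1) := by positivity
    linarith
  have hgm : ∀ n, Measurable (g n) := fun n => by
    have h0 := hmeas 0
    simp only [sub_zero] at h0
    exact (h0.sub (hmeas _)).const_mul _
  have hg1 : ∀ n h, ‖g n h‖ ≤ 1 := fun n h => by
    have h1 := hlip _ _ (hle n h)
    rw [hg, norm_mul, Real.norm_eq_abs, Real.norm_eq_abs, abs_of_pos (hn n)]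
    calc _ ≤ ((n : ℝ) + 1) * (h - (h - 1 / ((n : ℝ) + 1))) :=
          mul_le_mul_of_nonneg_left h1 (hn n).le
      _ = 1 := by
        have := (hn n).ne'
        field_simp
        ring
  have hlim : ∀ᵐ h ∂volume.restrict (Ioc a b),
      Tendsto (fun n => g n h) atTop (𝓝 (deriv (G h) h)) := by
    filter_upwards [hdiff] with h hh
    exact tendsto_backward_quotient hh.hasDerivAt
  have hgae : AEStronglyMeasurable (fun h => deriv (G h) h) (volume.restrict (Ioc a b)) :=
    aestronglyMeasurable_of_tendsto_ae atTop (fun n => (hgm n).aestronglyMeasurable) hlim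
  have hint : Integrable (fun h => deriv (G h) h) (volume.restrict (Ioc a b)) := by
    refine Integrable.of_bound hgae 1 ?_
    filter_upwards [hlim] with h hh
    exact le_of_tendsto hh.norm (Eventually.of_forall fun n => hg1 n h)
  have hgi : ∀ n, Integrable (g n) (volume.restrict (Ioc a b)) := fun n =>
    Integrable.of_bound (hgm n).aestronglyMeasurable 1 (Eventually.of_forall (hg1 n))
  refine ⟨(intervalIntegrable_iff_integrableOn_Ioc_of_le hab).2 hint, ?_⟩
  rw [intervalIntegral.integral_of_le hab]
  have t1 : Tendsto (fun n => ∫ h in Ioc a b, g n h) atTop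
      (𝓝 (∫ h in Ioc a b, deriv (G h) h)) :=
    tendsto_integral_of_dominated_convergence (fun _ => 1)
      (fun n => (hgm n).aestronglyMeasurable) (integrable_const _)
      (fun n => Eventually.of_forall (hg1 n)) hlim
  have t2 := tendsto_mul_integral_sub hF a b
  have t3 := tendsto_tsum_mul_integral hab hm hp hma hpa hm1 hp1 hq hs
  have key : ∀ n : ℕ, |(((n : ℝ) + 1) * ∫ h in a..b, (F h - F (h - 1 / ((n : ℝ) + 1))))
      - ∫ h in Ioc a b, g n h| ≤ ∑' k, ((n : ℝ) + 1) * ∫ h in a..b, q k *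
      ((m k (h - 1 / ((n : ℝ) + 1)) - m k h) * (p k (h - 1 / ((n : ℝ) + 1)) - p k h)) := by
    intro n
    set δ := 1 / ((n : ℝ) + 1) with hδ
    set u : ℕ → ℝ → ℝ := fun k h => q k * ((m k (h - δ) - m k h) * (p k (h - δ) - p k h)) with hu
    have hu0 : ∀ k h, 0 ≤ u k h := fun k h => mul_nonneg (hq k)
      (mul_nonneg (sub_nonneg.2 (hma k (hle n h))) (sub_nonneg.2 (hpa k (hle n h))))
    have huq : ∀ k h, u k h ≤ q k := fun k h => by
      refine mul_le_of_le_one_right (hq k) (mul_le_one₀ ?_ (sub_nonneg.2 (hpa k (hle n h))) ?_)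
      · linarith [(hm1 k (h - δ)).2, (hm1 k h).1]
      · linarith [(hp1 k (h - δ)).2, (hp1 k h).1]
    have huc : ∀ k, Continuous (u k) := fun k => by
      have := hm k
      have := hp k
      fun_prop
    have hui : ∀ k, Integrable (u k) (volume.restrict (Ioc a b)) := fun k =>
      Integrable.of_bound (huc k).aestronglyMeasurable (q k) (Eventually.of_forall fun h => by
        rw [Real.norm_eq_abs, abs_of_nonneg (hu0 k h)]
        exact huq k h)
    have hsum : HasSum (fun k => ∫ h in Ioc a b, u k h) (∫ h in Ioc a b, ∑' k, u k h) := by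
      refine hasSum_integral_of_summable_integral_norm hui ?_
      refine Summable.of_nonneg_of_le (fun k => integral_nonneg fun h => norm_nonneg _) (fun k => ?_)
        (hs.mul_right (volume.real (Ioc a b)))
      have := norm_integral_le_of_norm_le_const (μ := volume.restrict (Ioc a b)) (C := q k)
        (f := fun h => ‖u k h‖) (Eventually.of_forall fun h => by
          rw [norm_norm, Real.norm_eq_abs, abs_of_nonneg (hu0 k h)]
          exact huq k h)
      rw [measureReal_restrict_apply_univ] at this
      exact (le_abs_self _).trans this
    have hFi : Integrable (fun h => F h - F (h - δ)) (volume.restrict (Ioc a b)) :=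
      ((by fun_prop : Continuous fun h => F h - F (h - δ)).integrableOn_Icc).mono_set
        Ioc_subset_Icc_self
    have e1 : (((n : ℝ) + 1) * ∫ h in a..b, (F h - F (h - δ))) - ∫ h in Ioc a b, g n h
        = ∫ h in Ioc a b, (((n : ℝ) + 1) * (F h - F (h - δ)) - g n h) := by
      rw [integral_sub (hFi.const_mul _) (hgi n), integral_const_mul ((n : ℝ) + 1)
        (fun h => F h - F (h - δ)), intervalIntegral.integral_of_le hab]
    rw [e1, tsum_mul_left]
    simp only [intervalIntegral.integral_of_le hab]
    rw [hsum.tsum_eq, ← integral_const_mul, ← Real.norm_eq_abs]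
    have hti : Integrable (fun h => ∑' k, u k h) (volume.restrict (Ioc a b)) := by
      have : Continuous fun h => ∑' k, u k h :=
        continuous_tsum huc hs fun k h => by
          rw [Real.norm_eq_abs, abs_of_nonneg (hu0 k h)]
          exact huq k h
      exact this.integrableOn_Icc.mono_set Ioc_subset_Icc_self
    refine norm_integral_le_of_norm_le (hti.const_mul _) (Eventually.of_forall fun h => ?_)
    rw [hg, ← mul_sub, norm_mul, Real.norm_eq_abs, Real.norm_eq_abs, abs_of_pos (hn n)]
    exact mul_le_mul_of_nonneg_left (herr _ _ (hle n h)) (hn n).le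
  have t4 := squeeze_zero_norm (fun n => (Real.norm_eq_abs _).trans_le (key n)) t3
  have t5 := t2.sub t4
  simp only [sub_sub_cancel, sub_zero] at t5
  exact tendsto_nhds_unique t1 t5

/-! ### The GEXIT integral -/

lemma Better.entropy_le {a b : Measure EReal} (ha : IsLDist a) (hb : IsLDist b)
    (h : Better a b) : entropy a ≤ entropy b := by
  have := hasSum_le (fun k => mul_le_mul_of_nonneg_left (h.mom_le k) (isMomentSeries_etaD.pos k).le)
    hb.hasSum_entropy ha.hasSum_entropy
  linarith

/-- By duality the increments after ⊛ and after ⊞ add up to the increment of the entropy itself, and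
both are nonnegative. -/
lemma abs_entropy_varConv_sub_le {a b z : Measure EReal} (ha : IsLDist a) (hb : IsLDist b)
    (hz : IsLDist z) (h : Better a b) :
    |entropy (varConv b z) - entropy (varConv a z)| ≤ entropy b - entropy a := by
  have := ha.prob
  have := hb.prob
  have := hz.prob
  have h1 := (h.varConv ha hb hz hz (Better.refl z)).entropy_le (ha.varConv hz) (hb.varConv hz)
  have h2 := (h.checkConv (Better.refl z)).entropy_le (ha.checkConv hz) (hb.checkConv hz)
  have e1 := ha.entropy_varConv hz
  have e2 := hb.entropy_varConv hz
  rw [abs_of_nonneg (sub_nonneg.2 h1)]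
  linarith

lemma mom_eq_zero_of_tsum {a : Measure EReal} [IsProbabilityMeasure a] {q : ℕ → ℝ}
    (hq : ∀ k, 0 < q k) (h : HasSum (fun k => q k * mom a k) 0) (k : ℕ) : mom a k = 0 := by
  have := (hasSum_zero_iff_of_nonneg fun k => mul_nonneg (hq k).le (mom_mem a k).1).1 h
  have hk := congrFun this k
  simpa [(hq k).ne'] using hk

/-- Over the useless channel the area functional equals the design rate. -/
lemma IsForwardFP.areaA_eq_of_entropy_eq_one {l r : ℕ} {c x : Measure EReal} (hr : 2 ≤ r)
    (hc : IsLDist c) (h : IsForwardFP l r c x) (hc1 : entropy c = 1) :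
    areaA l r x = 1 - (l : ℝ) / r := by
  have := hc.prob
  have hx := h.1
  have := hx.prob
  have h1 := hc.hasSum_entropy
  rw [hc1, sub_self] at h1
  have h2 := hc.hasSum_batta
  simp only [mom_eq_zero_of_tsum isMomentSeries_etaD.pos h1, mul_zero] at h2
  have h3 : batta c = 1 := by linarith [h2.unique hasSum_zero]
  -- For 𝔅(c) = 1 the value X = 1 is a subsolution of the scalar recursion, so 𝔅(x) = 1 and all
  -- moments of x vanish.
  have h4 : 1 ≤ batta x ^ 2 := h.sq_batta_ge hc zero_le_one le_rfl (by
    rw [h3, aFun, sub_self, zero_pow (by omega)]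
    simp)
  have h5 : batta x = 1 := by
    obtain ⟨b0, b1⟩ := hx.batta_mem
    nlinarith
  have h6 := hx.hasSum_batta
  rw [h5, sub_self] at h6
  have hm := mom_eq_zero_of_tsum battaCoeff_pos h6
  have h7 := hx.hasSum_entropy
  have h8 : ∀ n, n ≠ 0 → entropy (checkPow x n) = 1 := fun n hn => by
    have h9 := (hx.checkPow n).hasSum_entropy
    simp only [mom_checkPow hx, hm, zero_pow hn, mul_zero] at h9
    linarith [h9.unique hasSum_zero]
  simp only [hm, mul_zero] at h7
  have h10 : entropy x = 1 := by linarith [h7.unique hasSum_zero]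
  rw [areaA, h8 r (by omega), h8 (r - 1) (by omega), h10]
  ring

section family

variable {l r : ℕ} {c x : ℝ → Measure EReal}

lemma continuousOn_areaA {s : Set ℝ} (hx : ∀ h ∈ s, IsLDist (x h))
    (hm : ∀ k, ContinuousOn (fun h => mom (x h) k) s) :
    ContinuousOn (fun h => areaA l r (x h)) s := by
  have hmem : ∀ k, ∀ h ∈ s, mom (x h) k ∈ Icc (0 : ℝ) 1 := fun k h hh => by
    have := (hx h hh).prob
    exact mom_mem _ k
  have h0 : ContinuousOn (fun h => entropy (x h)) s := by
    refine ((continuousOn_const (c := (1 : ℝ))).sub (continuousOn_tsum_coeff_mul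
      isMomentSeries_etaD.pos isMomentSeries_etaD.summable hm hmem)).congr fun h hh => ?_
    change entropy (x h) = 1 - ∑' k, entropyCoeff k * mom (x h) k
    rw [(hx h hh).hasSum_entropy.tsum_eq]
    ring
  have hn : ∀ n, ContinuousOn (fun h => entropy (checkPow (x h) n)) s := fun n => by
    refine ((continuousOn_const (c := (1 : ℝ))).sub (continuousOn_tsum_coeff_mul
      isMomentSeries_etaD.pos isMomentSeries_etaD.summable (fun k => (hm k).pow n) fun k h hh =>
      ⟨pow_nonneg (hmem k h hh).1 n, pow_le_one₀ (hmem k h hh).1 (hmem k h hh).2⟩)).congr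
      fun h hh => ?_
    change entropy (checkPow (x h) n) = 1 - ∑' k, entropyCoeff k * mom (x h) k ^ n
    have := ((hx h hh).checkPow n).hasSum_entropy
    simp only [mom_checkPow (hx h hh)] at this
    rw [this.tsum_eq]
    ring
  exact (h0.add (continuousOn_const.mul (hn r))).sub (continuousOn_const.mul (hn (r - 1)))

/-- Monotonicity in both arguments makes h ↦ G(h, h-δ) monotone, hence measurable, without any
regularity of h ↦ x_h. -/
lemma gexitEntropy_mono (hc : ∀ h ∈ Icc (0 : ℝ) 1, IsLDist (c h)) (hord : OrderedFamily c)
    (hx : ∀ h ∈ Icc (0 : ℝ) 1, IsForwardFP l r (c h) (x h)) {h₁ h₂ h₁' h₂' : ℝ}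
    (hh₁ : h₁ ∈ Icc (0 : ℝ) 1) (hh₂ : h₂ ∈ Icc (0 : ℝ) 1) (hh₁' : h₁' ∈ Icc (0 : ℝ) 1)
    (hh₂' : h₂' ∈ Icc (0 : ℝ) 1) (hle : h₁ ≤ h₂) (hle' : h₁' ≤ h₂') :
    gexitEntropy l r c x h₁ h₁' ≤ gexitEntropy l r c x h₂ h₂' := by
  have hb := hord.better hc hh₁ hh₂ hle
  have hb' := hord.better hc hh₁' hh₂' hle'
  have x1 := (hx h₁ hh₁).1
  have x2 := (hx h₂ hh₂).1
  have hxx := (hx h₁ hh₁).better (hc h₁ hh₁) (hc h₂ hh₂) (hx h₂ hh₂) hb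
  have z1 := (x1.checkPow (r - 1)).varPow l
  have z2 := (x2.checkPow (r - 1)).varPow l
  have hz := (hxx.checkPow x1 x2 (r - 1)).varPow (x1.checkPow _) (x2.checkPow _) l
  exact (hb'.varConv (hc _ hh₁') (hc _ hh₂') z1 z2 hz).entropy_le ((hc _ hh₁').varConv z1)
    ((hc _ hh₂').varConv z2)

theorem integral_gexit (hl : 3 ≤ l) (hr : 3 ≤ r)
    (hc : ∀ h ∈ Icc (0 : ℝ) 1, IsLDist (c h)) (hord : OrderedFamily c)
    (hcomp : CompleteEntropyFamily c) (hsmooth : PiecewiseSmoothFamily c)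
    (hx : ∀ h ∈ Icc (0 : ℝ) 1, IsForwardFP l r (c h) (x h))
    {ht hs : ℝ} (htilde : IsTildeEntropy l r c ht) (hhs : hs ∈ Icc ht 1) :
    (∀ᵐ h ∂(volume.restrict (Ioc hs 1)), DifferentiableAt ℝ (gexitEntropy l r c x h) h) ∧
      IntervalIntegrable (gexit l r c x) volume hs 1 ∧
      ∫ h in hs..1, gexit l r c x h = areaA l r (x 1) - areaA l r (x hs) := by
  have hs1 := hhs.2
  have hs0 : 0 ≤ hs := htilde.1.1.trans hhs.1
  have hsub : Icc hs 1 ⊆ Icc (0 : ℝ) 1 := Icc_subset_Icc_left hs0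
  obtain ⟨S, hS⟩ := differentiableAt_gexitEntropy (l := l) (r := r) hc hsmooth
    fun h hh => (hx h hh).1
  -- The endpoint 1 is dropped too: the extended functions below agree with the original ones only
  -- in a neighbourhood of interior points.
  have hgood : ∀ᵐ h ∂(volume.restrict (Ioc hs 1)), h ∈ Ioo hs 1 ∧ h ∉ S := by
    have h1 : ∀ᵐ h ∂(volume.restrict (Ioc hs 1)), h ∉ (S : Set ℝ) ∪ {1} :=
      ae_restrict_of_ae (measure_eq_zero_iff_ae_notMem.1
        ((S.finite_toSet.union (finite_singleton 1)).measure_zero _))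
    filter_upwards [h1, ae_restrict_mem measurableSet_Ioc] with h hh hI
    simp only [mem_union, Finset.mem_coe, mem_singleton_iff, not_or] at hh
    exact ⟨⟨hI.1, lt_of_le_of_ne hI.2 hh.2⟩, hh.1⟩
  have hdiff : ∀ᵐ h ∂(volume.restrict (Ioc hs 1)),
      DifferentiableAt ℝ (gexitEntropy l r c x h) h := by
    filter_upwards [hgood] with h hh
    exact hS h ⟨hs0.trans_lt hh.1.1, hh.1.2⟩ hh.2
  refine ⟨hdiff, ?_⟩
  -- extend all functions constantly beyond `[hs, 1]`
  set π : ℝ → ℝ := fun h => projIcc hs 1 hs1 h with hπ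
  have hπc : Continuous π := continuous_subtype_val.comp continuous_projIcc
  have hπm : Monotone π := fun h h' hle => monotone_projIcc hs1 hle
  have hπI : ∀ h, π h ∈ Icc hs 1 := fun h => (projIcc hs 1 hs1 h).2
  have hπ0 : ∀ h, π h ∈ Icc (0 : ℝ) 1 := fun h => hsub (hπI h)
  have hπe : ∀ h ∈ Icc hs 1, π h = h := fun h hh => by rw [hπ]; simp only [projIcc_of_mem hs1 hh]
  have hπl : ∀ h₁ h₂, h₁ ≤ h₂ → π h₂ - π h₁ ≤ h₂ - h₁ := fun h₁ h₂ hle => by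
    simp only [hπ, coe_projIcc]
    rcases max_cases hs (min 1 h₁) with ⟨e1, f1⟩ | ⟨e1, f1⟩ <;>
    rcases max_cases hs (min 1 h₂) with ⟨e2, f2⟩ | ⟨e2, f2⟩ <;>
    rcases min_cases 1 h₁ with ⟨e3, f3⟩ | ⟨e3, f3⟩ <;>
    rcases min_cases 1 h₂ with ⟨e4, f4⟩ | ⟨e4, f4⟩ <;> linarith
  have hbet : ∀ h₁ h₂, h₁ ≤ h₂ → Better (c (π h₁)) (c (π h₂)) := fun h₁ h₂ hle =>
    hord.better hc (hπ0 _) (hπ0 _) (hπm hle)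
  have hL : ∀ h, IsLDist (x (π h)) := fun h => (hx _ (hπ0 h)).1
  have hmcont : ∀ k, ContinuousOn (fun h => mom (x h) k) (Icc hs 1) := fun k =>
    (continuousOn_mom_fixedPoint hl hr hc hord hcomp hx htilde k).mono (Icc_subset_Icc_left hhs.1)
  have hmc : ∀ k, Continuous fun h => mom (x (π h)) k := fun k =>
    (hmcont k).comp_continuous hπc hπI
  have hma : ∀ k, Antitone fun h => mom (x (π h)) k := fun k h₁ h₂ hle =>
    ((hx _ (hπ0 h₁)).better (hc _ (hπ0 _)) (hc _ (hπ0 _)) (hx _ (hπ0 h₂)) (hbet _ _ hle)).mom_le k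
  have hm1 : ∀ k h, mom (x (π h)) k ∈ Icc (0 : ℝ) 1 := fun k h => by
    have := (hL h).prob
    exact mom_mem _ k
  have hF : Continuous fun h => areaA l r (x (π h)) :=
    (continuousOn_areaA (fun h hh => (hx h (hsub hh)).1) hmcont).comp_continuous hπc hπI
  have hev : ∀ h ∈ Ioo hs 1, (fun h' => gexitEntropy l r c x (π h) (π h'))
      =ᶠ[𝓝 h] gexitEntropy l r c x h := fun h hh => by
    filter_upwards [Ioo_mem_nhds hh.1 hh.2] with h' hh'
    rw [hπe h (Ioo_subset_Icc_self hh), hπe h' (Ioo_subset_Icc_self hh')]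
  have main := integral_deriv_diagonal hs1 (G := fun h h' => gexitEntropy l r c x (π h) (π h'))
    (F := fun h => areaA l r (x (π h))) hF
    (m := fun k h => mom (x (π h)) k) (p := fun k h => mom (x (π h)) k ^ (r - 1))
    (q := fun k => entropyCoeff k * l)
    (fun h₁ h₂ hle => ?_) (fun δ => ?_) hmc (fun k => (hmc k).pow _) hma
    (fun k h₁ h₂ hle => pow_le_pow_left₀ (hm1 k h₂).1 (hma k hle) _) hm1
    (fun k h => ⟨pow_nonneg (hm1 k h).1 _, pow_le_one₀ (hm1 k h).1 (hm1 k h).2⟩)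
    (fun k => mul_nonneg (isMomentSeries_etaD.pos k).le (Nat.cast_nonneg l))
    (isMomentSeries_etaD.summable.mul_right _) (fun h₁ h₂ hle => ?_) ?_
  · obtain ⟨m1, m2⟩ := main
    have hae : ∀ᵐ h ∂(volume.restrict (Ioc hs 1)),
        deriv (fun h' => gexitEntropy l r c x (π h) (π h')) h = gexit l r c x h := by
      filter_upwards [hgood] with h hh
      exact (hev h hh.1).deriv_eq
    have hae' : (fun h => deriv (fun h' => gexitEntropy l r c x (π h) (π h')) h)
        =ᵐ[volume.restrict (uIoc hs 1)] gexit l r c x := by rwa [uIoc_of_le hs1]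
    rw [hπe 1 ⟨hs1, le_rfl⟩, hπe hs ⟨le_rfl, hs1⟩] at m2
    refine ⟨m1.congr_ae hae', ?_⟩
    rw [← m2]
    exact (intervalIntegral.integral_congr_ae_restrict hae').symm
  -- The Lipschitz constant is 1 because H(c_h) = h and the projection onto [h*, 1] is nonexpansive.
  · have hz := ((hL h₂).checkPow (r - 1)).varPow l
    have := abs_entropy_varConv_sub_le (hc _ (hπ0 h₁)) (hc _ (hπ0 h₂)) hz (hbet _ _ hle)
    rw [hcomp _ (hπ0 _), hcomp _ (hπ0 _)] at this
    exact this.trans (hπl _ _ hle)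
  · exact Monotone.measurable fun h h' hle => gexitEntropy_mono hc hord hx (hπ0 _) (hπ0 _) (hπ0 _)
      (hπ0 _) (hπm hle) (hπm (sub_le_sub_right hle δ))
  · have := abs_areaA_sub_le (by omega) (by omega) (hc _ (hπ0 h₁)) (hc _ (hπ0 h₂)) (hx _ (hπ0 h₁))
      (hx _ (hπ0 h₂)) (hbet _ _ hle)
    simpa only [mul_assoc, gexitEntropy] using this
  · filter_upwards [hgood, hdiff] with h hh hd
    exact hd.congr_of_eventuallyEq (hev h hh.1)

end family

end GEXIT

end

theorem mainTheorem8 (l r : ℕ) (hl : 3 ≤ l) (hlr : l ≤ r)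
    (c : ℝ → Measure EReal)
    (hc : ∀ h ∈ Set.Icc (0 : ℝ) 1, GEXIT.IsLDist (c h))
    (hord : GEXIT.OrderedFamily c)
    (hcomp : GEXIT.CompleteEntropyFamily c)
    (hsmooth : GEXIT.PiecewiseSmoothFamily c)
    (x : ℝ → Measure EReal)
    (hx : ∀ h ∈ Set.Icc (0 : ℝ) 1, GEXIT.IsForwardFP l r (c h) (x h))
    (ht hs : ℝ)
    (htilde : GEXIT.IsTildeEntropy l r c ht)
    (hhs : hs ∈ Set.Icc ht 1) :
    (∀ᵐ h ∂(volume.restrict (Set.Ioc hs 1)),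
        DifferentiableAt ℝ (GEXIT.gexitEntropy l r c x h) h) ∧
      IntervalIntegrable (GEXIT.gexit l r c x) volume hs 1 ∧
      ∫ h in hs..1, GEXIT.gexit l r c x h = 1 - (l : ℝ) / r - GEXIT.areaA l r (x hs) := by
  have h1 : (1 : ℝ) ∈ Set.Icc (0 : ℝ) 1 := ⟨zero_le_one, le_rfl⟩
  rw [← (hx 1 h1).areaA_eq_of_entropy_eq_one (by omega) (hc 1 h1) (hcomp 1 h1)]
  exact GEXIT.integral_gexit hl (hl.trans hlr) hc hord hcomp hsmooth hx htilde hhs
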